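/- **Setting.** Let $(Z,\mathcal B,m)$ be a Lebesgue space (modelled by a standard Borel space) with $0<m(Z)<\infty$, and let $T:Z\to Z$ be a Markov map with partition $\delta$. That is, $T$ is measurable and nonsingular; $\delta$ is a countable measurable partition of $Z$ into sets of positive measure; for each $d\in\delta$, $Td$ is mod $m$ a union of elements of $\delta$, and $T:d\to Td$ is injective with nonsingular inverse; and the preimages $T^{-n}d$ ($n\ge 0$, $d\in\delta$) generate $\mathcal B$ up to null sets. Assume that $m$ is $T$-invariant and ergodic. Let $t(x,y)\in\mathbb N\cup\{\infty\}$ be the least $n$ such that $T^nx,T^ny$ are not in the same element of $\delta$. Fix $0<\tau<1$ and put $\tau^\infty=0$. For a function $f$, let $D_\tau f$ be the least $c\in[0,\infty]$ with $|f(x)-f(y)|\le c\,\tau^{t(x,y)}$ whenever $t(x,y)\ge 1$; let $D_\tau f(d)$ be the same constant for $f|_d$. Let $\mathcal L_\tau$ be the space of bounded functions $f:Z\to\mathbb C$ with $D_\tau f<\infty$, taken up to a.e. equality. Let $g_m=\frac{dm}{d(m\circ T)}$, where $(m\circ T)(A)=\sum_{d\in\delta}m(T(A\cap d))$, and assume that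 $\log g_m$ has a version $\ell$ with $D_\tau \ell<\infty$. Assume that $T$ has the *bounded tower big image property*. That is, there are $q\in\mathbb N$, $\delta_0\subset\delta$ and $H:\delta_0\to\{1,\dots,q\}$ such that the elements of $\delta$ are labelled bijectively as $d_{a,k}$ with $a\in\delta_0$, $0\le k<H(a)$, where $d_{a,0}=a$, $T d_{a,k}=d_{a,k+1}$ mod $m$ if $k+1<H(a)$, and $T d_{a,H(a)-1}\subset \Delta_0:=\bigcup_{a\in\delta_0}a$ mod $m$. Moreover, there is $\eta>0$ with $m(Td)>\eta$ for every $d\in\delta$ such that $Td\subset\Delta_0$ mod $m$. Let $h:Z\to\mathbb R$ be in $L^2(m)$ with $\int h\,dm=0$ and $\sum_{d\in\delta}m(d)\,D_\tau h(d)<\infty$. Assume that, on the union of the elements $d\in\delta$ for which $Td\not\subset\Delta_0$ mod $m$, $h$ is bounded and $\sup D_\tau h(d)<\infty$. Let $R$ be the transfer operator, $\int f\cdot (g\circ T)\,dm=\int (Rf)\,g\,dm$, and $R_t\psi=R(e^{ith}\psi)$ for $t\in\mathbb R$. **Theorem.** The operators $R_t$ (in particular $R=R_0$) map $\mathcal L_\tau$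 to itself. The operator $I-R$ is invertible (bijective) on the subspace of functions of $\mathcal L_\tau$ with zero average, and $Rh$ belongs to this subspace. Let $a=(I-R)^{-1}(Rh)$ be computed in this subspace, and let $u=h+a$ (so that $(I-R)u=h$). Then there is a real number $\sigma$ with $$\sigma^2=\int h^2\,dm+2\int ah\,dm=\int \bigl(R(u^2)-(Ru)^2\bigr)\,dm ,$$ and, for all sufficiently small $t$, the operator $R_t$ acting on $\mathcal L_\tau$ has exactly one eigenvalue $\lambda(t)$ in some fixed neighbourhood of $1$; it satisfies $$\lambda(t)=1-\frac{\sigma^2}{2m(Z)}t^2+o(t^2)\qquad(t\to0).$$ Moreover, $\sigma^2=0$ if and only if there is $\psi\in\mathcal L_\tau$ with $h=\psi\circ T-\psi$ almost everywhere. -/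

import Mathlib

open MeasureTheory Filter Topology Asymptotics
open scoped ENNReal

noncomputable section

namespace MarkovTower

variable {Z ι : Type*}

/-- `x` and `y` lie in the same element of the partition `δ`. -/
def SameElement (δ : ι → Set Z) (x y : Z) : Prop := ∃ i, x ∈ δ i ∧ y ∈ δ i

/-- Separation time `t(x,y)`: the least `n` such that `T^n x` and `T^n y` are not in the same
element of the partition, and `∞` if there is no such `n`. -/
def sepTime (T : Z → Z) (δ : ι → Set Z) (x y : Z) : ℕ∞ :=
  ⨅ (n : ℕ) (_ : ¬ SameElement δ (T^[n] x) (T^[n] y)), (n : ℕ∞)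

/-- `τ ^ t` for `t ∈ ℕ ∪ {∞}`, with `τ ^ ∞ = 0`. -/
def sepPow (τ : ℝ) (t : ℕ∞) : ℝ≥0∞ :=
  if t = ⊤ then 0 else ENNReal.ofReal τ ^ t.toNat

/-- `D_τ f` on the set `s`: the least `c ∈ [0,∞]` such that `|f x - f y| ≤ c τ^{t(x,y)}` for all
`x, y ∈ s` with `t(x,y) ≥ 1`. -/
def holderConst {E : Type*} [NormedAddCommGroup E] (T : Z → Z) (δ : ι → Set Z) (τ : ℝ)
    (f : Z → E) (s : Set Z) : ℝ≥0∞ :=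
  sInf {c : ℝ≥0∞ | ∀ x ∈ s, ∀ y ∈ s, 1 ≤ sepTime T δ x y →
    ‖f x - f y‖ₑ ≤ c * sepPow τ (sepTime T δ x y)}

variable [MeasurableSpace Z]

/-- `T` is a Markov map of `(Z, m)` for the partition `δ`. -/
structure IsMarkovMap (m : Measure Z) (T : Z → Z) (δ : ι → Set Z) : Prop where
  measurable : Measurable T
  nonsingular : ∀ A, MeasurableSet A → (m (T ⁻¹' A) = 0 ↔ m A = 0)
  measurableSet : ∀ i, MeasurableSet (δ i)
  disjoint : Pairwise fun i j => Disjoint (δ i) (δ j)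
  iUnion_eq : ⋃ i, δ i = Set.univ
  pos : ∀ i, 0 < m (δ i)
  /-- The image of an element is, mod `m`, a union of elements. -/
  image_eq : ∀ i, ∃ J : Set ι, T '' (δ i) =ᵐ[m] ⋃ j ∈ J, δ j
  /-- `T : δ i → T (δ i)` is invertible, ... -/
  injOn : ∀ i, Set.InjOn T (δ i)
  /-- ... with a nonsingular inverse. -/
  null_image : ∀ i, ∀ A, MeasurableSet A → A ⊆ δ i → m A = 0 → m (T '' A) = 0
  /-- Up to null sets, the preimages `T^{-n} (δ i)` generate all measurable sets. -/
  generates : ∀ A, MeasurableSet A →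
    ∃ B, MeasurableSet[MeasurableSpace.generateFrom {s | ∃ (n : ℕ) (i : ι), s = T^[n] ⁻¹' (δ i)}] B ∧
      B =ᵐ[m] A

/-- The measure `m ∘ T`, that is `A ↦ ∑ i, m (T (A ∩ δ i))`. -/
def imageMeasure (m : Measure Z) (T : Z → Z) (δ : ι → Set Z) : Measure Z :=
  Measure.sum fun i => (Measure.comap (fun x : δ i => T x) m).map Subtype.val

/-- The weight `g_m = dm / d(m ∘ T)`, the inverse of the jacobian of `T`. -/
def weight (m : Measure Z) (T : Z → Z) (δ : ι → Set Z) : Z → ℝ≥0∞ :=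
  m.rnDeriv (imageMeasure m T δ)

/-- `log g_m` is (has a version which is) `τ`-Hölder. -/
def HolderDistortion (m : Measure Z) (T : Z → Z) (δ : ι → Set Z) (τ : ℝ) : Prop :=
  ∃ l : Z → ℝ, holderConst T δ τ l Set.univ < ⊤ ∧
    weight m T δ =ᵐ[m] fun x => ENNReal.ofReal (Real.exp (l x))

/-- The union `Δ₀` of the elements of the partition which form the basis of the tower. -/
def basis (δ : ι → Set Z) (base : Set ι) : Set Z := ⋃ i ∈ base, δ i

/-- The element `δ j` returns to the basis at the next iteration, i.e. `T (δ j) ⊆ Δ₀` mod `m`. -/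
def Returns (m : Measure Z) (T : Z → Z) (δ : ι → Set Z) (base : Set ι) (j : ι) : Prop :=
  T '' (δ j) ≤ᵐ[m] basis δ base

/-- The set of points which do not return to the basis at the next iteration. -/
def nonReturning (m : Measure Z) (T : Z → Z) (δ : ι → Set Z) (base : Set ι) : Set Z :=
  ⋃ (j : ι) (_ : ¬ Returns m T δ base j), δ j

/-- Bounded tower with basis `base` and height function `height ≤ q`. The partition element
`a × {k}` of the tower over `a ∈ base` is `δ (floor a k)`, for `k < height a`. -/
structure IsBoundedTower (m : Measure Z) (T : Z → Z) (δ : ι → Set Z) (q : ℕ)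
    (base : Set ι) (height : ι → ℕ) (floor : ι → ℕ → ι) : Prop where
  height_pos : ∀ a ∈ base, 1 ≤ height a
  height_le : ∀ a ∈ base, height a ≤ q
  floor_zero : ∀ a ∈ base, floor a 0 = a
  /-- Every partition element is a floor of the tower, in exactly one way. -/
  floor_unique : ∀ j : ι, ∃! p : ι × ℕ, p.1 ∈ base ∧ p.2 < height p.1 ∧ floor p.1 p.2 = j
  /-- `T` climbs from a floor onto the next one ... -/
  climb : ∀ a ∈ base, ∀ k, k + 1 < height a →
    T '' (δ (floor a k)) =ᵐ[m] δ (floor a (k + 1))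
  /-- ... and falls from the last one to the basis. -/
  fall : ∀ a ∈ base, ∀ k, k + 1 = height a → Returns m T δ base (floor a k)

/-- Returns to the basis have measure bounded away from `0`. -/
def BigImage (m : Measure Z) (T : Z → Z) (δ : ι → Set Z) (base : Set ι) : Prop :=
  ∃ η : ℝ, 0 < η ∧ ∀ j, Returns m T δ base j → ENNReal.ofReal η < m (T '' (δ j))

/-- The space `𝓛_τ` of bounded functions with `D_τ f < ∞`; functions are considered up to
equality almost everywhere. -/
def MemL (m : Measure Z) (T : Z → Z) (δ : ι → Set Z) (τ : ℝ) (f : Z → ℂ) : Prop :=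
  ∃ f' : Z → ℂ, f =ᵐ[m] f' ∧ (∃ C : ℝ, ∀ x, ‖f' x‖ ≤ C) ∧ holderConst T δ τ f' Set.univ < ⊤

/-- The functions of `𝓛_τ` with zero average. -/
def MemL0 (m : Measure Z) (T : Z → Z) (δ : ι → Set Z) (τ : ℝ) (f : Z → ℂ) : Prop :=
  MemL m T δ τ f ∧ ∫ x, f x ∂m = 0

/-- The transfer operator of `T` on integrable functions: `R f` is the density with respect to
`m` of the image under `T` of the complex measure `f dm`. Equivalently,
`∫ f · (g ∘ T) dm = ∫ (R f) · g dm` for bounded measurable `g`. -/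
def transfer (m : Measure Z) (T : Z → Z) (f : Z → ℂ) : Z → ℂ :=
  ComplexMeasure.rnDeriv ((m.withDensityᵥ f).map T) m

/-- The perturbed transfer operator `R_t f = R (e^{ith} f)`. -/
def perturbed (m : Measure Z) (T : Z → Z) (h : Z → ℝ) (t : ℝ) (f : Z → ℂ) : Z → ℂ :=
  transfer m T fun x => Complex.exp (Complex.I * t * h x) * f x

/-- `z` is an eigenvalue of the operator `L` acting on `𝓛_τ`. -/
def IsEigenvalue (m : Measure Z) (T : Z → Z) (δ : ι → Set Z) (τ : ℝ)
    (L : (Z → ℂ) → Z → ℂ) (z : ℂ) : Prop :=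
  ∃ ξ : Z → ℂ, MemL m T δ τ ξ ∧ ¬ ξ =ᵐ[m] 0 ∧ L ξ =ᵐ[m] fun x => z * ξ x

end MarkovTower

end

open MeasureTheory Filter Topology Asymptotics
open scoped ENNReal

noncomputable section

namespace MarkovTower

/-! ### Cylinders and Hölder functions -/

section Cylinders

variable {Z ι E : Type*} [NormedAddCommGroup E] {T : Z → Z} {δ : ι → Set Z} {τ : ℝ}

/-! The transfer operator `R` is quasi-compact on functions that are Hölder for the symbolic metric,
and everything follows by perturbing its simple eigenvalue `1`.

Spectral gap. By bounded distortion, the iterate that carries a cylinder onto its last image spreads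
mass almost evenly there; when this image lies in the basis it has measure more than `η`, so the
densities are uniformly bounded and Hölder. A set on floor `l` comes only from a set of equal
measure in the basis, `l < q` steps earlier. Together these give the Lasota-Yorke inequality `‖R^n
F‖ ≤ C (∫ |F| + ‖F‖ τ^(n-q))` (`Setting.exists_lasotaYorke`). Bounded sequences have pointwise
convergent subsequences, and a limit of approximate fixed vectors is a fixed function of `R`,
constant by ergodicity. With `P` the projection onto constants given by the mean, `1 - R + P` is
therefore invertible (`Setting.isUnit_one_sub`). No mixing is needed: only the point `1` of the
spectrum matters.

Perturbation. The observable is unbounded, but `R` averages over the branches that land in the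
basis: the norm of `F ↦ R (φ F)` is controlled by `∑ m(d) (sup + Hölder constant of φ on d)`, with a
uniform bound needed only on the elements that climb (`Setting.exists_operator`). Hence `R_t - R =
O(t)` and `R_t 1 = 1 + i t R h + o(t)`. By `exists_perturbed_eigenvalue` the eigenvector is `1 + i t
a + o(t)`. Integrating the eigenvalue equation expresses `λ(t)` through `∫ e^{ith} (1 + v_t)`, whose
second order expansion needs only `h ∈ L²` (`isLittleO_integral_exp`).

Variance. Since `R (h + a) = a`, both formulas for `σ²` equal `∫ (h + a - a ∘ T)²`
(`exists_variance`), so `σ = 0` exactly for coboundaries.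

Classes of functions are handled through the points all of whose cylinders have positive measure: a
Hölder function is determined there by its class, and a retraction `p` onto this set selects one
representative of each class. -/

/-- `x` and `y` have the same itinerary up to time `n`. -/
def Near (T : Z → Z) (δ : ι → Set Z) (n : ℕ) (x y : Z) : Prop :=
  ∀ k < n, SameElement δ (T^[k] x) (T^[k] y)

/-- `f` is Hölder on `s`, with constant `K`. -/
def HolderBound (T : Z → Z) (δ : ι → Set Z) (τ K : ℝ) (f : Z → E) (s : Set Z) : Prop :=
  ∀ n : ℕ, 1 ≤ n → ∀ x ∈ s, ∀ y ∈ s, Near T δ n x y → ‖f x - f y‖ ≤ K * τ ^ n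

theorem le_sepTime_iff {n : ℕ} {x y : Z} : (n : ℕ∞) ≤ sepTime T δ x y ↔ Near T δ n x y := by
  unfold sepTime Near
  rw [le_iInf₂_iff]
  constructor
  · intro H k hk
    by_contra hc
    have := H k hc
    exact absurd (by exact_mod_cast this : n ≤ k) (by omega)
  · intro H k hk
    by_contra hc
    have hkn : k < n := by
      have := not_le.1 hc
      exact_mod_cast this
    exact hk (H k hkn)

theorem sepPow_le (hτ0 : 0 < τ) (hτ1 : τ < 1) {n : ℕ} {t : ℕ∞} (h : (n : ℕ∞) ≤ t) :
    sepPow τ t ≤ ENNReal.ofReal (τ ^ n) := by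
  unfold sepPow
  split_ifs with ht
  · exact zero_le
  · lift t to ℕ using ht
    rw [← ENNReal.ofReal_pow hτ0.le]
    apply ENNReal.ofReal_le_ofReal
    exact pow_le_pow_of_le_one hτ0.le hτ1.le (by simpa using h)

/-- The `+ 1` leaves room above the infimum, so that some admissible constant lies below it; whether
the infimum is attained plays no role. -/
theorem exists_holderBound (hτ0 : 0 < τ) (hτ1 : τ < 1) {f : Z → E} {s : Set Z}
    (h : holderConst T δ τ f s < ⊤) :
    HolderBound T δ τ ((holderConst T δ τ f s).toReal + 1) f s := by
  have h1 : holderConst T δ τ f s < holderConst T δ τ f s + 1 :=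
    ENNReal.lt_add_right h.ne one_ne_zero
  obtain ⟨c, hc, hlt⟩ := sInf_lt_iff.1 (show sInf _ < _ from h1)
  intro n hn x hx y hy hxy
  have h2 := hc x hx y hy (le_trans (by exact_mod_cast hn) (le_sepTime_iff.2 hxy))
  have h3 : ‖f x - f y‖ₑ ≤ (holderConst T δ τ f s + 1) * ENNReal.ofReal (τ ^ n) :=
    h2.trans (mul_le_mul' hlt.le (sepPow_le hτ0 hτ1 (le_sepTime_iff.2 hxy)))
  have h4 := ENNReal.toReal_mono (ENNReal.mul_ne_top (ENNReal.add_ne_top.2 ⟨h.ne, ENNReal.one_ne_top⟩) ENNReal.ofReal_ne_top) h3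
  rw [ENNReal.toReal_mul, ENNReal.toReal_ofReal (by positivity),
    ENNReal.toReal_add h.ne (by simp)] at h4
  simpa using h4

theorem HolderBound.holderConst_le (hτ0 : 0 < τ) (hτ1 : τ < 1) {f : Z → E} {s : Set Z} {K : ℝ}
    (h : HolderBound T δ τ K f s) : holderConst T δ τ f s ≤ ENNReal.ofReal K := by
  apply sInf_le
  intro x hx y hy hxy
  -- For infinite separation time the target is `f x = f y`, because `τ ^ ∞ = 0`; it follows by
  -- letting `n → ∞` in the bounds at finite levels.
  by_cases ht : sepTime T δ x y = ⊤
  · have h1 : ∀ n : ℕ, 1 ≤ n → ‖f x - f y‖ ≤ K * τ ^ n := fun n hn =>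
      h n hn x hx y hy (le_sepTime_iff.1 (by rw [ht]; exact le_top))
    have h2 : Tendsto (fun n : ℕ => K * τ ^ n) atTop (𝓝 (K * 0)) :=
      (tendsto_pow_atTop_nhds_zero_of_lt_one hτ0.le hτ1).const_mul K
    have h3 := ge_of_tendsto h2 (eventually_atTop.2 ⟨1, h1⟩)
    have h4 : f x - f y = 0 := by
      rw [mul_zero] at h3
      exact norm_le_zero_iff.1 h3
    simp [h4]
  · obtain ⟨n, hn⟩ := ENat.ne_top_iff_exists.1 ht
    rw [← hn] at hxy ⊢
    have h1 := h n (by exact_mod_cast hxy) x hx y hy (le_sepTime_iff.1 hn.le)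
    rw [sepPow, if_neg (by simp), ← ofReal_norm, ENat.toNat_natCast,
      ← ENNReal.ofReal_pow hτ0.le, ← ENNReal.ofReal_mul' (by positivity)]
    exact ENNReal.ofReal_le_ofReal h1

theorem Near.mono {n k : ℕ} {x y : Z} (h : Near T δ n x y) (hk : k ≤ n) : Near T δ k x y :=
  fun j hj => h j (hj.trans_le hk)

theorem near_add {n k : ℕ} {x y : Z} (h : Near T δ n x y)
    (h' : Near T δ k (T^[n] x) (T^[n] y)) : Near T δ (n + k) x y := by
  intro j hj
  by_cases hjn : j < n
  · exact h j hjn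
  · obtain ⟨i, rfl⟩ := Nat.exists_eq_add_of_le (not_lt.1 hjn)
    have := h' i (by omega)
    rwa [← Function.iterate_add_apply, ← Function.iterate_add_apply, add_comm i n] at this

theorem near_succ_of_mem {k : ℕ} {i : ι} {x y : Z} (hx : x ∈ δ i) (hy : y ∈ δ i)
    (h : Near T δ k (T x) (T y)) : Near T δ (k + 1) x y := by
  rw [add_comm]
  refine near_add ?_ h
  intro j hj
  obtain rfl : j = 0 := by omega
  exact ⟨i, hx, hy⟩

/-- The set of points with prescribed itinerary up to time `n`. -/
def piece (T : Z → Z) (δ : ι → Set Z) (n : ℕ) (w : Fin n → ι) : Set Z :=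
  {x | ∀ k : Fin n, T^[k] x ∈ δ (w k)}

/-- The cylinder of length `n` containing `x`. -/
def cyl (T : Z → Z) (δ : ι → Set Z) (n : ℕ) (x : Z) : Set Z := {y | Near T δ n x y}

theorem near_of_mem_piece {n : ℕ} {w : Fin n → ι} {x y : Z} (hx : x ∈ piece T δ n w)
    (hy : y ∈ piece T δ n w) : Near T δ n x y := fun k hk => ⟨w ⟨k, hk⟩, hx ⟨k, hk⟩, hy ⟨k, hk⟩⟩

theorem Near.symm {n : ℕ} {x y : Z} (h : Near T δ n x y) : Near T δ n y x := fun k hk =>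
  let ⟨i, h1, h2⟩ := h k hk; ⟨i, h2, h1⟩

theorem cyl_anti {n k : ℕ} (h : k ≤ n) (x : Z) : cyl T δ n x ⊆ cyl T δ k x :=
  fun _ hy => Near.mono hy h

theorem cyl_zero (x : Z) : cyl T δ 0 x = Set.univ :=
  Set.eq_univ_of_forall fun _ _ hk => absurd hk (Nat.not_lt_zero _)

end Cylinders

/-! ### Cylinders of a Markov map -/

section Markov

variable {Z ι : Type*} [MeasurableSpace Z] {m : Measure Z} {T : Z → Z} {δ : ι → Set Z} {τ : ℝ}

namespace IsMarkovMap

variable (hM : IsMarkovMap m T δ)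
include hM

theorem exists_mem (x : Z) : ∃ i, x ∈ δ i := by
  have := hM.iUnion_eq ▸ Set.mem_univ x
  exact Set.mem_iUnion.1 this

theorem index_unique {i j : ι} {x : Z} (hi : x ∈ δ i) (hj : x ∈ δ j) : i = j := by
  by_contra hne
  exact Set.disjoint_left.1 (hM.disjoint hne) hi hj

theorem near_refl (n : ℕ) (x : Z) : Near T δ n x x := fun k _ =>
  let ⟨i, hi⟩ := hM.exists_mem (T^[k] x); ⟨i, hi, hi⟩

theorem near_trans {n : ℕ} {x y z : Z} (h : Near T δ n x y) (h' : Near T δ n y z) :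
    Near T δ n x z := fun k hk => by
  obtain ⟨i, h1, h2⟩ := h k hk
  obtain ⟨j, h3, h4⟩ := h' k hk
  obtain rfl := hM.index_unique h2 h3
  exact ⟨i, h1, h4⟩

theorem exists_piece (n : ℕ) (x : Z) : ∃ w : Fin n → ι, x ∈ piece T δ n w := by
  choose i hi using hM.exists_mem
  exact ⟨fun k => i (T^[k] x), fun k => hi _⟩

theorem piece_eq_cyl {n : ℕ} {w : Fin n → ι} {x : Z} (hx : x ∈ piece T δ n w) :
    piece T δ n w = cyl T δ n x := by
  ext y
  refine ⟨fun hy => near_of_mem_piece hx hy, fun hy k => ?_⟩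
  obtain ⟨i, h1, h2⟩ := hy k k.2
  rwa [hM.index_unique h1 (hx k)] at h2

theorem measurableSet_piece (n : ℕ) (w : Fin n → ι) : MeasurableSet (piece T δ n w) := by
  have : piece T δ n w = ⋂ k : Fin n, T^[k] ⁻¹' (δ (w k)) := by ext; simp [piece]
  rw [this]
  exact MeasurableSet.iInter fun k => (hM.measurable.iterate k) (hM.measurableSet _)

theorem measurableSet_cyl (n : ℕ) (x : Z) : MeasurableSet (cyl T δ n x) := by
  obtain ⟨w, hw⟩ := hM.exists_piece n x
  rw [← hM.piece_eq_cyl hw]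
  exact hM.measurableSet_piece n w

theorem cyl_eq_of_near {n : ℕ} {x y : Z} (h : Near T δ n x y) : cyl T δ n x = cyl T δ n y := by
  ext z
  exact ⟨fun hz => hM.near_trans (h.symm) hz, fun hz => hM.near_trans h hz⟩

theorem pairwise_disjoint_piece (n : ℕ) :
    Pairwise fun v w => Disjoint (piece T δ n v) (piece T δ n w) := by
  intro v w hne
  rw [Set.disjoint_left]
  intro x hv hw
  exact hne (funext fun k => hM.index_unique (hv k) (hw k))

theorem iUnion_piece (n : ℕ) : ⋃ w, piece T δ n w = Set.univ :=
  Set.eq_univ_of_forall fun x => Set.mem_iUnion.2 (hM.exists_piece n x)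

theorem cyl_succ {n : ℕ} {x : Z} {i : ι} (hi : T^[n] x ∈ δ i) :
    cyl T δ (n + 1) x = cyl T δ n x ∩ T^[n] ⁻¹' (δ i) := by
  ext y
  constructor
  · intro hy
    refine ⟨hy.mono (Nat.le_succ n), ?_⟩
    obtain ⟨j, h1, h2⟩ := hy n (Nat.lt_succ_self n)
    rwa [Set.mem_preimage, hM.index_unique hi h1]
  · rintro ⟨h1, h2⟩ k hk
    rcases Nat.lt_succ_iff_lt_or_eq.1 hk with hk | rfl
    · exact h1 k hk
    · exact ⟨i, hi, h2⟩

theorem cyl_one {x : Z} {i : ι} (hi : x ∈ δ i) : cyl T δ 1 x = δ i := by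
  have := hM.cyl_succ (n := 0) (x := x) (i := i) hi
  rw [this, cyl_zero]
  simp

/-- A function which is locally Hölder is measurable. -/
theorem measurable_of_holder [Countable ι] (hτ0 : 0 < τ) (hτ1 : τ < 1) {f : Z → ℂ} {D : ι → ℝ}
    (hf : ∀ i, HolderBound T δ τ (D i) f (δ i)) : Measurable f := by
  by_cases hZ : Nonempty Z
  swap
  · have := not_nonempty_iff.1 hZ
    exact measurable_of_empty f
  choose w hw using fun n => hM.exists_piece n
  have hwm : ∀ n, Measurable[_, ⊤] (w n) := by
    intro n
    have : MeasurableSpace (Fin n → ι) := ⊤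
    refine @measurable_to_countable' _ _ ⊤ _ _ _ fun v => ?_
    have : w n ⁻¹' {v} = piece T δ n v := by
      ext x
      constructor
      · rintro rfl
        exact hw n x
      · intro hx
        exact funext fun k => hM.index_unique (hw n x k) (hx k)
    rw [this]
    exact hM.measurableSet_piece n v
  -- On each piece of length `n`, `f` is replaced by its value at a chosen point of the piece. These
  -- approximations factor through a countable set, and they converge to `f` pointwise.
  let g : (n : ℕ) → (Fin n → ι) → ℂ := fun n v => f (Classical.epsilon fun y => y ∈ piece T δ n v)
  have hg : ∀ n, Measurable fun x => g n (w n x) := fun n =>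
    (@measurable_from_top _ _ _ (g n)).comp (hwm n)
  refine measurable_of_tendsto_metrizable (f := fun n x => g n (w n x)) hg ?_
  rw [tendsto_pi_nhds]
  intro x
  obtain ⟨i, hi⟩ := hM.exists_mem x
  have hy : ∀ n, (Classical.epsilon fun y => y ∈ piece T δ n (w n x)) ∈ piece T δ n (w n x) :=
    fun n => Classical.epsilon_spec ⟨x, hw n x⟩
  rw [tendsto_iff_norm_sub_tendsto_zero]
  have h2 : Tendsto (fun n : ℕ => D i * τ ^ n) atTop (𝓝 (D i * 0)) :=
    (tendsto_pow_atTop_nhds_zero_of_lt_one hτ0.le hτ1).const_mul _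
  rw [mul_zero] at h2
  refine squeeze_zero' (Eventually.of_forall fun n => norm_nonneg _) ?_ h2
  filter_upwards [eventually_ge_atTop 1] with n hn
  have hnear := near_of_mem_piece (hy n) (hw n x)
  refine hf i n hn _ ?_ x hi hnear
  have h3 := hnear.mono hn 0 one_pos
  obtain ⟨j, h4, h5⟩ := h3
  rw [hM.index_unique hi h5]
  exact h4

end IsMarkovMap

/-! ### The points all of whose cylinders have positive measure -/

/-- The points all of whose cylinders have positive measure. -/
def core (m : Measure Z) (T : Z → Z) (δ : ι → Set Z) : Set Z :=
  {x | ∀ n, m (cyl T δ n x) ≠ 0}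

theorem IsMarkovMap.ae_mem_core [Countable ι] (hM : IsMarkovMap m T δ) :
    ∀ᵐ x ∂m, x ∈ core m T δ := by
  have h : ∀ n : ℕ, ∀ w : Fin n → ι, m (piece T δ n w) = 0 → ∀ᵐ x ∂m, x ∉ piece T δ n w :=
    fun n w hw => measure_eq_zero_iff_ae_notMem.1 hw
  have h' : ∀ᵐ x ∂m, ∀ n : ℕ, ∀ w : Fin n → ι, m (piece T δ n w) = 0 → x ∉ piece T δ n w := by
    simp_rw [ae_all_iff]
    exact h
  filter_upwards [h'] with x hx n h0
  obtain ⟨w, hw⟩ := hM.exists_piece n x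
  rw [← hM.piece_eq_cyl hw] at h0
  exact hx n w h0 hw

theorem IsMarkovMap.exists_mem_core [Countable ι] (hM : IsMarkovMap m T δ) {s : Set Z}
    (hs : m s ≠ 0) : ∃ x ∈ s, x ∈ core m T δ := by
  by_contra hc
  push Not at hc
  exact hs (measure_mono_null (fun x hx => hc x hx) (mem_ae_iff.1 hM.ae_mem_core))

/-- A point outside the core is sent to a chosen core point of its longest cylinder of positive
measure. The choice depends on the cylinder and not on the point, which is why common itineraries
survive. -/
theorem IsMarkovMap.exists_retraction [Countable ι] [NeZero m] (hM : IsMarkovMap m T δ) :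
    ∃ p : Z → Z, (∀ x, p x ∈ core m T δ) ∧ (∀ x ∈ core m T δ, p x = x) ∧
      ∀ n x y, Near T δ n x y → Near T δ n (p x) (p y) := by
  classical
  let c : Set Z → Z := fun s => if h : ∃ x ∈ s, x ∈ core m T δ then h.choose else
    (hM.exists_mem_core (NeZero.ne (m Set.univ))).choose
  have hc : ∀ s, m s ≠ 0 → c s ∈ s ∧ c s ∈ core m T δ := fun s hs => by
    have h := hM.exists_mem_core hs
    simp only [c, dif_pos h]
    exact h.choose_spec
  have hlvl : ∀ x, x ∉ core m T δ → ∃ n, m (cyl T δ (n + 1) x) = 0 ∧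
      ∀ k ≤ n, m (cyl T δ k x) ≠ 0 := by
    intro x hx
    have hex : ∃ n, m (cyl T δ n x) = 0 := by simpa [core] using hx
    have h0 : Nat.find hex ≠ 0 := by
      intro h
      have := Nat.find_spec hex
      rw [h, cyl_zero] at this
      exact NeZero.ne (m Set.univ) this
    obtain ⟨n, hn⟩ := Nat.exists_eq_succ_of_ne_zero h0
    refine ⟨n, by have := Nat.find_spec hex; rwa [hn] at this, fun k hk => Nat.find_min hex (by omega)⟩
  choose! N hN1 hN2 using hlvl
  refine ⟨fun x => if x ∈ core m T δ then x else c (cyl T δ (N x) x), ?_, ?_, ?_⟩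
  · intro x
    by_cases hx : x ∈ core m T δ
    · beta_reduce
      rwa [if_pos hx]
    · simp only [hx, if_false]
      exact (hc _ (hN2 x hx _ le_rfl)).2
  · intro x hx
    simp [hx]
  · have key : ∀ n x, m (cyl T δ n x) ≠ 0 →
        Near T δ n x (if x ∈ core m T δ then x else c (cyl T δ (N x) x)) := by
      intro n x hn
      by_cases hx : x ∈ core m T δ
      · simpa [hx] using hM.near_refl n x
      · simp only [hx, if_false]
        have h1 : n ≤ N x := by
          by_contra hlt
          exact hn (measure_mono_null (cyl_anti (by omega) x) (hN1 x hx))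
        exact Near.mono (hc _ (hN2 x hx _ le_rfl)).1 h1
    intro n x y hxy
    -- If the common `n`-cylinder is null, both points have the same longest non-null cylinder,
    -- hence the same image. Otherwise each image keeps the first `n` symbols of its point.
    by_cases hn : m (cyl T δ n x) = 0
    · have hn' : m (cyl T δ n y) = 0 := by rwa [← hM.cyl_eq_of_near hxy]
      have hx : x ∉ core m T δ := fun h => h n hn
      have hy : y ∉ core m T δ := fun h => h n hn'
      have hlt : ∀ z, z ∉ core m T δ → m (cyl T δ n z) = 0 → N z < n := by
        intro z hz h0
        by_contra hge
        exact hN2 z hz n (by omega) h0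
      have hNxy : N x = N y := by
        have e1 : ∀ k ≤ n, cyl T δ k x = cyl T δ k y := fun k hk => hM.cyl_eq_of_near (hxy.mono hk)
        apply le_antisymm
        · by_contra hgt
          refine hN2 x hx (N y + 1) (by omega) ?_
          rw [e1 _ (hlt y hy hn')]
          exact hN1 y hy
        · by_contra hgt
          refine hN2 y hy (N x + 1) (by omega) ?_
          rw [← e1 _ (hlt x hx hn)]
          exact hN1 x hx
      simp only [hx, hy, if_false]
      rw [hNxy, hM.cyl_eq_of_near (hxy.mono (hNxy ▸ (hlt x hx hn)).le)]
      exact hM.near_refl _ _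
    · have hn' : m (cyl T δ n y) ≠ 0 := by rwa [← hM.cyl_eq_of_near hxy]
      exact hM.near_trans ((key n x hn).symm) (hM.near_trans hxy (key n y hn'))

end Markov

/-! ### The transfer operator -/

section Transfer

variable {Z : Type*} [MeasurableSpace Z] {m : Measure Z} {T : Z → Z}

theorem transfer_congr {f g : Z → ℂ} (h : f =ᵐ[m] g) : transfer m T f = transfer m T g := by
  unfold transfer
  rw [WithDensityᵥEq.congr_ae h]

theorem integrable_transfer (f : Z → ℂ) : Integrable (transfer m T f) m :=
  ComplexMeasure.integrable_rnDeriv _ _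

variable [IsFiniteMeasure m]

/-- Invariance of `m` makes the image of `f dm` absolutely continuous, so its Radon-Nikodym
derivative is a true density. Real and imaginary parts are treated as signed measures. -/
theorem setIntegral_transfer (hT : MeasurePreserving T m m) {f : Z → ℂ} (hf : Integrable f m)
    {A : Set Z} (hA : MeasurableSet A) :
    ∫ x in A, transfer m T f x ∂m = ∫ x in T ⁻¹' A, f x ∂m := by
  set c : ComplexMeasure Z := (m.withDensityᵥ f).map T with hc
  have hcA : ∀ B, MeasurableSet B → c B = ∫ x in T ⁻¹' B, f x ∂m := fun B hB => by
    rw [hc, VectorMeasure.map_apply _ hT.measurable hB, withDensityᵥ_apply hf (hT.measurable hB)]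
  have hac : c ≪ᵥ m.toENNRealVectorMeasure := by
    refine VectorMeasure.AbsolutelyContinuous.mk fun B hB h0 => ?_
    rw [Measure.toENNRealVectorMeasure_apply_measurable hB] at h0
    rw [hcA B hB]
    apply setIntegral_measure_zero
    rw [hT.measure_preimage hB.nullMeasurableSet, h0]
  obtain ⟨hre, him⟩ := (ComplexMeasure.absolutelyContinuous_ennreal_iff _ _).1 hac
  have h1 := SignedMeasure.withDensityᵥ_rnDeriv_eq _ _ hre
  have h2 := SignedMeasure.withDensityᵥ_rnDeriv_eq _ _ him
  rw [← hcA A hA]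
  have hi : Integrable (transfer m T f) m := integrable_transfer f
  have e1 : (∫ x in A, transfer m T f x ∂m).re = (c A).re := by
    rw [← RCLike.re_eq_complex_re, ← integral_re hi.integrableOn]
    have := congrArg (fun s : SignedMeasure Z => s A) h1
    rw [withDensityᵥ_apply (SignedMeasure.integrable_rnDeriv _ _) hA] at this
    exact this
  have e2 : (∫ x in A, transfer m T f x ∂m).im = (c A).im := by
    rw [← RCLike.im_eq_complex_im, ← integral_im hi.integrableOn]
    have := congrArg (fun s : SignedMeasure Z => s A) h2
    rw [withDensityᵥ_apply (SignedMeasure.integrable_rnDeriv _ _) hA] at this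
    exact this
  exact Complex.ext e1 e2

/-- The working criterion: `R f` is recognised by its integrals over sets, and the algebraic
properties below are all checked in this way. -/
theorem transfer_ae_eq (hT : MeasurePreserving T m m) {f g : Z → ℂ} (hf : Integrable f m)
    (hg : Integrable g m)
    (h : ∀ A, MeasurableSet A → ∫ x in A, g x ∂m = ∫ x in T ⁻¹' A, f x ∂m) :
    transfer m T f =ᵐ[m] g :=
  (integrable_transfer f).ae_eq_of_forall_setIntegral_eq _ _ hg fun A hA _ => by
    rw [setIntegral_transfer hT hf hA, h A hA]

theorem integral_transfer (hT : MeasurePreserving T m m) {f : Z → ℂ} (hf : Integrable f m) :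
    ∫ x, transfer m T f x ∂m = ∫ x, f x ∂m := by
  simpa using setIntegral_transfer hT hf MeasurableSet.univ

theorem transfer_add (hT : MeasurePreserving T m m) {f g : Z → ℂ} (hf : Integrable f m)
    (hg : Integrable g m) :
    transfer m T (f + g) =ᵐ[m] transfer m T f + transfer m T g := by
  refine transfer_ae_eq hT (hf.add hg) ((integrable_transfer f).add (integrable_transfer g)) ?_
  intro A hA
  simp only [Pi.add_apply]
  rw [integral_add (integrable_transfer f).integrableOn (integrable_transfer g).integrableOn,
    setIntegral_transfer hT hf hA, setIntegral_transfer hT hg hA,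
    integral_add hf.integrableOn hg.integrableOn]

theorem transfer_smul (hT : MeasurePreserving T m m) {f : Z → ℂ} (hf : Integrable f m) (c : ℂ) :
    transfer m T (c • f) =ᵐ[m] c • transfer m T f := by
  refine transfer_ae_eq hT (hf.smul c) ((integrable_transfer f).smul c) ?_
  intro A hA
  simp only [Pi.smul_apply]
  rw [integral_smul, setIntegral_transfer hT hf hA, integral_smul]

theorem transfer_sub (hT : MeasurePreserving T m m) {f g : Z → ℂ} (hf : Integrable f m)
    (hg : Integrable g m) :
    transfer m T (f - g) =ᵐ[m] transfer m T f - transfer m T g := by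
  refine transfer_ae_eq hT (hf.sub hg) ((integrable_transfer f).sub (integrable_transfer g)) ?_
  intro A hA
  simp only [Pi.sub_apply]
  rw [integral_sub (integrable_transfer f).integrableOn (integrable_transfer g).integrableOn,
    setIntegral_transfer hT hf hA, setIntegral_transfer hT hg hA,
    integral_sub hf.integrableOn hg.integrableOn]

theorem transfer_conj (hT : MeasurePreserving T m m) {f : Z → ℂ} (hf : Integrable f m) :
    transfer m T (fun x => (starRingEnd ℂ) (f x)) =ᵐ[m]
      fun x => (starRingEnd ℂ) (transfer m T f x) := by
  have hc : ∀ {g : Z → ℂ}, Integrable g m → Integrable (fun x => (starRingEnd ℂ) (g x)) m :=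
    fun {g} hg => hg.mono (Complex.continuous_conj.comp_aestronglyMeasurable hg.1)
      (ae_of_all _ fun x => by simp)
  refine transfer_ae_eq hT (hc hf) (hc (integrable_transfer f)) ?_
  intro A hA
  rw [integral_conj, setIntegral_transfer hT hf hA, integral_conj]

/-- The transfer operator is a left inverse of the composition with `T`. -/
theorem transfer_comp (hT : MeasurePreserving T m m) {f : Z → ℂ} (hf : Integrable f m) :
    transfer m T (fun x => f (T x)) =ᵐ[m] f := by
  refine transfer_ae_eq hT (hT.integrable_comp_of_integrable hf) hf ?_
  intro A hA
  have h1 : (m.restrict (T ⁻¹' A)).map T = m.restrict A := by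
    rw [← Measure.restrict_map hT.measurable hA, hT.map_eq]
  rw [← h1, integral_map hT.measurable.aemeasurable]
  rw [h1]
  exact hf.1.restrict

/-- The duality relation which characterizes the transfer operator. -/
theorem integral_mul_comp (hT : MeasurePreserving T m m) {f g : Z → ℂ} (hf : Integrable f m)
    (hg : AEStronglyMeasurable g m) {C : ℝ} (hC : ∀ᵐ x ∂m, ‖g x‖ ≤ C) :
    ∫ x, f x * g (T x) ∂m = ∫ x, transfer m T f x * g x ∂m := by
  by_cases hm : m = 0
  · simp [hm]
  have hC0 : 0 ≤ C := by
    have : NeZero m := ⟨hm⟩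
    obtain ⟨x, hx⟩ := hC.exists
    exact (norm_nonneg _).trans hx
  have hs : ∀ s : SimpleFunc Z ℂ,
      ∫ x, f x * s (T x) ∂m = ∫ x, transfer m T f x * s x ∂m := by
    intro s
    have hbd : ∀ s : SimpleFunc Z ℂ, ∀ F : Z → ℂ, Integrable F m →
        Integrable (fun x => F x * s x) m := by
      intro s F hF
      obtain ⟨c, hc⟩ := s.exists_forall_norm_le
      exact hF.mul_bdd s.aestronglyMeasurable (ae_of_all _ hc)
    have hbd' : ∀ s : SimpleFunc Z ℂ, Integrable (fun x => f x * s (T x)) m :=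
      fun s => hbd (s.comp T hT.measurable) f hf
    induction s using SimpleFunc.induction with
    | const c hs =>
      rename_i S
      have e1 : ∀ F : Z → ℂ, ∀ y : Z → Z, (fun x => F x * (SimpleFunc.piecewise S hs
          (SimpleFunc.const Z c) (SimpleFunc.const Z 0)) (y x)) =
          (y ⁻¹' S).indicator fun x => c • F x := by
        classical
        intro F y
        ext x
        by_cases hx : y x ∈ S <;> simp [Set.indicator, hx, mul_comm]
      have e2 := e1 f T
      have e3 := e1 (transfer m T f) id
      simp only [id] at e3
      rw [e2, e3, integral_indicator (hT.measurable hs), Set.preimage_id, integral_indicator hs,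
        integral_smul, integral_smul, setIntegral_transfer hT hf hs]
    | add _ h1 h2 =>
      rename_i s1 s2 _
      simp only [SimpleFunc.coe_add, Pi.add_apply, mul_add]
      rw [integral_add (hbd' s1) (hbd' s2),
        integral_add (hbd s1 _ (integrable_transfer f)) (hbd s2 _ (integrable_transfer f)), h1, h2]
  obtain ⟨G, hG, hGg⟩ := hg
  have hGC : ∀ᵐ x ∂m, ‖G x‖ ≤ C := by
    filter_upwards [hGg, hC] with x h1 h2
    rwa [← h1]
  -- Since `f` is only integrable, the simple approximations of `G` must be uniformly bounded for
  -- dominated convergence to apply.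
  have l1 : Tendsto (fun n => ∫ x, f x * hG.approxBounded C n (T x) ∂m) atTop
      (𝓝 (∫ x, f x * G (T x) ∂m)) := by
    refine tendsto_integral_of_dominated_convergence (fun x => ‖f x‖ * C) ?_
      (hf.norm.mul_const C) ?_ ?_
    · intro n
      exact hf.1.mul ((hG.approxBounded C n).stronglyMeasurable.comp_measurable
        hT.measurable).aestronglyMeasurable
    · intro n
      refine ae_of_all _ fun x => ?_
      rw [norm_mul]
      gcongr
      exact hG.norm_approxBounded_le hC0 n _
    · have := hT.quasiMeasurePreserving.ae hGC
      filter_upwards [this] with x hx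
      exact (hG.tendsto_approxBounded_of_norm_le hx).const_mul _
  have l2 : Tendsto (fun n => ∫ x, transfer m T f x * hG.approxBounded C n x ∂m) atTop
      (𝓝 (∫ x, transfer m T f x * G x ∂m)) := by
    refine tendsto_integral_of_dominated_convergence (fun x => ‖transfer m T f x‖ * C) ?_
      ((integrable_transfer f).norm.mul_const C) ?_ ?_
    · intro n
      exact (integrable_transfer f).1.mul (hG.approxBounded C n).aestronglyMeasurable
    · intro n
      refine ae_of_all _ fun x => ?_
      rw [norm_mul]
      gcongr
      exact hG.norm_approxBounded_le hC0 n _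
    · filter_upwards [hGC] with x hx
      exact (hG.tendsto_approxBounded_of_norm_le hx).const_mul _
  have l3 := tendsto_nhds_unique (l1.congr fun n => hs (hG.approxBounded C n)) l2
  have e1 : ∫ x, f x * g (T x) ∂m = ∫ x, f x * G (T x) ∂m := by
    refine integral_congr_ae ?_
    filter_upwards [hT.quasiMeasurePreserving.ae hGg] with x hx
    rw [hx]
  have e2 : ∫ x, transfer m T f x * g x ∂m = ∫ x, transfer m T f x * G x ∂m := by
    refine integral_congr_ae ?_
    filter_upwards [hGg] with x hx
    rw [hx]
  rw [e1, e2, l3]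

/-- For an ergodic map, the bounded fixed points of the transfer operator are constant. -/
theorem ae_eq_const_of_transfer_eq (hE : Ergodic T m) {v : Z → ℂ}
    (hv : AEStronglyMeasurable v m) {C : ℝ} (hC : ∀ x, ‖v x‖ ≤ C)
    (hRv : transfer m T v =ᵐ[m] v) : ∃ c : ℂ, v =ᵐ[m] fun _ => c := by
  have hT := hE.toMeasurePreserving
  have hvi : Integrable v m := Integrable.of_bound hv C (ae_of_all _ hC)
  have hcv : AEStronglyMeasurable (fun x => (starRingEnd ℂ) (v x)) m :=
    Complex.continuous_conj.comp_aestronglyMeasurable hv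
  have hvT : AEStronglyMeasurable (fun x => v (T x)) m :=
    hv.comp_quasiMeasurePreserving hT.quasiMeasurePreserving
  have hcvT : AEStronglyMeasurable (fun x => (starRingEnd ℂ) (v (T x))) m :=
    Complex.continuous_conj.comp_aestronglyMeasurable hvT
  have hprod : ∀ {f g : Z → ℂ}, AEStronglyMeasurable f m → AEStronglyMeasurable g m →
      (∀ x, ‖f x‖ ≤ C) → (∀ x, ‖g x‖ ≤ C) → Integrable (fun x => f x * g x) m := by
    intro f g hf hg h1 h2
    refine Integrable.of_bound (hf.mul hg) (C * C) (ae_of_all _ fun x => ?_)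
    rw [norm_mul]
    exact mul_le_mul (h1 x) (h2 x) (norm_nonneg _) ((norm_nonneg _).trans (h1 x))
  -- By duality `⟨v, v ∘ T⟩ = ⟨R v, v⟩ = ‖v‖²`, and `‖v ∘ T‖ = ‖v‖` by invariance, so expanding `‖v
  -- ∘ T - v‖²` in `L²` gives `0`; ergodicity concludes.
  have d1 : ∫ x, v x * (starRingEnd ℂ) (v (T x)) ∂m = ∫ x, v x * (starRingEnd ℂ) (v x) ∂m := by
    rw [integral_mul_comp hT hvi hcv (C := C) (ae_of_all _ fun x => by simpa using hC x)]
    refine integral_congr_ae ?_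
    filter_upwards [hRv] with x hx
    rw [hx]
  have d2 : ∫ x, v (T x) * (starRingEnd ℂ) (v x) ∂m = ∫ x, v x * (starRingEnd ℂ) (v x) ∂m := by
    have h1 := congrArg (starRingEnd ℂ) d1
    rw [← integral_conj, ← integral_conj] at h1
    simp only [map_mul, Complex.conj_conj] at h1
    simp only [mul_comm _ (v _)] at h1
    rw [← h1]
  have d3 : ∫ x, v (T x) * (starRingEnd ℂ) (v (T x)) ∂m =
      ∫ x, v x * (starRingEnd ℂ) (v x) ∂m := by
    have := integral_map (μ := m) hT.measurable.aemeasurable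
      (f := fun x => v x * (starRingEnd ℂ) (v x)) (by rw [hT.map_eq]; exact hv.mul hcv)
    rw [hT.map_eq] at this
    exact this.symm
  have d4 : ∫ x, ((‖v (T x) - v x‖ ^ 2 : ℝ) : ℂ) ∂m = 0 := by
    have e : ∀ x, ((‖v (T x) - v x‖ ^ 2 : ℝ) : ℂ) =
        (v (T x) * (starRingEnd ℂ) (v (T x)) - v (T x) * (starRingEnd ℂ) (v x)) -
        (v x * (starRingEnd ℂ) (v (T x)) - v x * (starRingEnd ℂ) (v x)) := by
      intro x
      rw [← Complex.normSq_eq_norm_sq, Complex.normSq_eq_conj_mul_self, map_sub]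
      ring
    simp_rw [e]
    have c1 : ∀ x, ‖v (T x)‖ ≤ C := fun x => hC _
    have c2 : ∀ x, ‖(starRingEnd ℂ) (v x)‖ ≤ C := fun x => by simpa using hC x
    have c3 : ∀ x, ‖(starRingEnd ℂ) (v (T x))‖ ≤ C := fun x => by simpa using hC _
    have i1 := hprod hvT hcvT c1 c3
    have i2 := hprod hvT hcv c1 c2
    have i3 := hprod hv hcvT hC c3
    have i4 := hprod hv hcv hC c2
    have h1 := integral_sub (i1.sub i2) (i3.sub i4)
    simp only [Pi.sub_apply] at h1
    rw [h1, integral_sub i1 i2, integral_sub i3 i4, d1, d2, d3]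
    ring
  rw [integral_complex_ofReal, Complex.ofReal_eq_zero,
    integral_eq_zero_iff_of_nonneg (fun x => by positivity)] at d4
  · have h5 : v ∘ T =ᵐ[m] v := by
      filter_upwards [d4] with x hx
      simpa [sub_eq_zero] using hx
    exact hE.quasiErgodic.ae_eq_const_of_ae_eq_comp_ae hv h5
  · refine Integrable.of_bound ((hvT.sub hv).norm.pow 2) ((C + C) ^ 2) (ae_of_all _ fun x => ?_)
    rw [Real.norm_of_nonneg (by positivity)]
    exact pow_le_pow_left₀ (norm_nonneg _)
      ((norm_sub_le _ _).trans (add_le_add (hC _) (hC _))) 2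

end Transfer

/-! ### Bounded distortion -/

section Distortion

variable {Z ι : Type*} [MeasurableSpace Z] [StandardBorelSpace Z] [Countable ι]
  {m : Measure Z} [IsFiniteMeasure m] {T : Z → Z} {δ : ι → Set Z} {τ : ℝ}

namespace IsMarkovMap

variable (hM : IsMarkovMap m T δ)
include hM

omit [Countable ι] [IsFiniteMeasure m] in
theorem measurableSet_image {i : ι} {A : Set Z} (hA : MeasurableSet A) (hi : A ⊆ δ i) :
    MeasurableSet (T '' A) :=
  hA.image_of_measurable_injOn hM.measurable ((hM.injOn i).mono hi)

omit [Countable ι] [IsFiniteMeasure m] in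
theorem imageMeasure_apply {i : ι} {A : Set Z} (hA : MeasurableSet A) (hi : A ⊆ δ i) :
    imageMeasure m T δ A = m (T '' A) := by
  have h1 : ∀ j, ((Measure.comap (fun x : δ j => T x) m).map Subtype.val) A =
      m (T '' (A ∩ δ j)) := by
    intro j
    have hsb := (hM.measurableSet j).standardBorel
    have hinj : Function.Injective fun x : δ j => T x := fun x y hxy =>
      Subtype.ext (hM.injOn j x.2 y.2 hxy)
    have hmeas : Measurable fun x : δ j => T x := hM.measurable.comp measurable_subtype_coe
    rw [Measure.map_apply measurable_subtype_coe hA,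
      Measure.comap_apply _ hinj (fun s hs => hs.image_of_measurable_injOn hmeas hinj.injOn) _
        (measurable_subtype_coe hA)]
    congr 1
    ext y
    constructor
    · rintro ⟨x, hx, rfl⟩
      exact ⟨x, ⟨hx, x.2⟩, rfl⟩
    · rintro ⟨x, ⟨hx, hj⟩, rfl⟩
      exact ⟨⟨x, hj⟩, hx, rfl⟩
  rw [imageMeasure, Measure.sum_apply _ hA]
  simp_rw [h1]
  rw [tsum_eq_single i]
  · rw [Set.inter_eq_left.2 hi]
  · intro j hj
    rw [(Set.disjoint_iff_inter_eq_empty.1 ((hM.disjoint hj.symm).mono_left hi))]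
    simp

/-- Radon-Nikodym for `m` with respect to `m ∘ T`: absolute continuity holds because `A ⊆ T⁻¹ (T
A)`, and `m ∘ T` is σ-finite since each partition element has finite image. -/
theorem lintegral_weight {A : Set Z} (hA : MeasurableSet A) :
    ∫⁻ x in A, weight m T δ x ∂(imageMeasure m T δ) = m A := by
  have hσ : SigmaFinite (imageMeasure m T δ) := by
    refine Measure.sigmaFinite_of_countable (S := Set.range δ) (Set.countable_range δ) ?_ ?_
    · rintro _ ⟨j, rfl⟩
      rw [hM.imageMeasure_apply (hM.measurableSet j) subset_rfl]
      exact measure_lt_top _ _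
    · rw [Set.sUnion_range, hM.iUnion_eq]
  have hac : m ≪ imageMeasure m T δ := by
    refine Measure.AbsolutelyContinuous.mk fun B hB h0 => ?_
    have h1 : ∀ j, m (B ∩ δ j) = 0 := fun j => by
      have h2 : imageMeasure m T δ (B ∩ δ j) = 0 := measure_mono_null Set.inter_subset_left h0
      rw [hM.imageMeasure_apply (hB.inter (hM.measurableSet j)) Set.inter_subset_right] at h2
      have h3 := (hM.nonsingular _ (hM.measurableSet_image (hB.inter (hM.measurableSet j))
        Set.inter_subset_right)).2 h2
      exact measure_mono_null (Set.subset_preimage_image _ _) h3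
    have : B = ⋃ j, B ∩ δ j := by rw [← Set.inter_iUnion, hM.iUnion_eq, Set.inter_univ]
    rw [this]
    exact measure_iUnion_null h1
  have h2 := Measure.withDensity_rnDeriv_eq m (imageMeasure m T δ) hac
  conv_rhs => rw [← h2, withDensity_apply _ hA]
  rfl

omit [IsFiniteMeasure m] in
theorem imageMeasure_absolutelyContinuous : imageMeasure m T δ ≪ m := by
  refine Measure.AbsolutelyContinuous.mk fun B hB h0 => ?_
  have h1 : ∀ j, imageMeasure m T δ (B ∩ δ j) = 0 := fun j => by
    rw [hM.imageMeasure_apply (hB.inter (hM.measurableSet j)) Set.inter_subset_right]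
    exact hM.null_image j _ (hB.inter (hM.measurableSet j)) Set.inter_subset_right
      (measure_mono_null Set.inter_subset_left h0)
  have : B = ⋃ j, B ∩ δ j := by rw [← Set.inter_iUnion, hM.iUnion_eq, Set.inter_univ]
  rw [this]
  exact measure_iUnion_null h1

/-- Distortion control for one iteration. -/
theorem distortion_one (hτ0 : 0 < τ) (hτ1 : τ < 1) (hdist : HolderDistortion m T δ τ) :
    ∃ c : ℝ, 0 ≤ c ∧ ∀ (i : ι) (k : ℕ) (A B : Set Z), MeasurableSet A → MeasurableSet B →
      (∀ x ∈ A, ∀ y ∈ B, Near T δ k x y) →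
      m (δ i ∩ T ⁻¹' A) * m (B ∩ T '' (δ i)) ≤
        ENNReal.ofReal (Real.exp (c * τ ^ (k + 1))) * (m (δ i ∩ T ⁻¹' B) * m A) := by
  obtain ⟨l, hl, hw⟩ := hdist
  have hl' := exists_holderBound hτ0 hτ1 hl
  set c := (holderConst T δ τ l Set.univ).toReal + 1
  refine ⟨c, by positivity, fun i k A B hA hB hnear => ?_⟩
  set μ := imageMeasure m T δ with hμ
  have hwμ : weight m T δ =ᵐ[μ] fun x => ENNReal.ofReal (Real.exp (l x)) :=
    hM.imageMeasure_absolutelyContinuous.ae_le hw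
  have himg : ∀ A : Set Z, T '' (δ i ∩ T ⁻¹' A) = T '' (δ i) ∩ A := fun A =>
    Set.image_inter_preimage T (δ i) A
  have hE : ∀ {A : Set Z}, MeasurableSet A → MeasurableSet (δ i ∩ T ⁻¹' A) := fun hA =>
    (hM.measurableSet i).inter (hM.measurable hA)
  have hμE : ∀ {A : Set Z}, MeasurableSet A → μ (δ i ∩ T ⁻¹' A) = m (A ∩ T '' (δ i)) := by
    intro A hA
    rw [hμ, hM.imageMeasure_apply (hE hA) Set.inter_subset_left, himg, Set.inter_comm]
  have hmE : ∀ {A : Set Z}, MeasurableSet A → m (δ i ∩ T ⁻¹' A) =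
      ∫⁻ x in δ i ∩ T ⁻¹' A, ENNReal.ofReal (Real.exp (l x)) ∂μ := by
    intro A hA
    rw [← hM.lintegral_weight (hE hA)]
    exact lintegral_congr_ae (ae_restrict_of_ae hwμ)
  -- Inverse branches are avoided. With `S` the supremum of the weight over the part of `δ i` above
  -- `A`, that part has measure at most `S * m A`, while the weight is at least `S * exp (-c
  -- τ^(k+1))` above `B`. The exponent is `k + 1` because points of `δ i` above `A` and `B` share
  -- one more symbol than their images.
  set S : ℝ≥0∞ := ⨆ x ∈ δ i ∩ T ⁻¹' A, ENNReal.ofReal (Real.exp (l x)) with hS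
  set Q : ℝ≥0∞ := ENNReal.ofReal (Real.exp (c * τ ^ (k + 1))) with hQ
  have h1 : m (δ i ∩ T ⁻¹' A) ≤ S * m A := by
    rw [hmE hA]
    calc ∫⁻ x in δ i ∩ T ⁻¹' A, ENNReal.ofReal (Real.exp (l x)) ∂μ
        ≤ ∫⁻ _ in δ i ∩ T ⁻¹' A, S ∂μ :=
          setLIntegral_mono' (hE hA) fun x hx => le_iSup₂_of_le x hx le_rfl
      _ = S * m (A ∩ T '' (δ i)) := by rw [setLIntegral_const, hμE hA]
      _ ≤ S * m A := by gcongr; exact Set.inter_subset_left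
  have h2 : S * m (B ∩ T '' (δ i)) ≤ Q * m (δ i ∩ T ⁻¹' B) := by
    rw [hmE hB, ← lintegral_const_mul' _ _ ENNReal.ofReal_ne_top, ← hμE hB, ← setLIntegral_const]
    refine setLIntegral_mono' (hE hB) fun y hy => ?_
    refine iSup₂_le fun x hx => ?_
    rw [← ENNReal.ofReal_mul (Real.exp_pos _).le, ← Real.exp_add]
    apply ENNReal.ofReal_le_ofReal
    apply Real.exp_le_exp.2
    have h3 := hl' (k + 1) (by omega) x trivial y trivial
      (near_succ_of_mem hx.1 hy.1 (hnear _ hx.2 _ hy.2))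
    have := (le_abs_self _).trans h3
    linarith
  calc m (δ i ∩ T ⁻¹' A) * m (B ∩ T '' (δ i)) ≤ (S * m A) * m (B ∩ T '' (δ i)) := by gcongr
    _ = (S * m (B ∩ T '' (δ i))) * m A := by ring
    _ ≤ (Q * m (δ i ∩ T ⁻¹' B)) * m A := by gcongr
    _ = Q * (m (δ i ∩ T ⁻¹' B) * m A) := by ring

omit [StandardBorelSpace Z] [Countable ι] [IsFiniteMeasure m] in
/-- An element of the partition is contained in the image of another one or disjoint from it. -/
theorem image_dichotomy (i j : ι) : m (δ j \ T '' (δ i)) = 0 ∨ m (δ j ∩ T '' (δ i)) = 0 := by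
  obtain ⟨J, hJ⟩ := hM.image_eq i
  by_cases hj : j ∈ J
  · left
    have h1 : (δ j \ T '' (δ i) : Set Z) =ᵐ[m] (δ j \ ⋃ j ∈ J, δ j : Set Z) :=
      (ae_eq_refl _).diff hJ
    rw [measure_congr h1, Set.sdiff_eq_empty.2 (Set.subset_biUnion_of_mem (u := δ) hj),
      measure_empty]
  · right
    have h1 : (δ j ∩ T '' (δ i) : Set Z) =ᵐ[m] (δ j ∩ ⋃ j ∈ J, δ j : Set Z) :=
      (ae_eq_refl _).inter hJ
    rw [measure_congr h1, Set.disjoint_iff_inter_eq_empty.1, measure_empty]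
    rw [Set.disjoint_iUnion₂_right]
    intro k hk
    exact hM.disjoint (by rintro rfl; exact hj hk)

/-- Distortion control for `n` iterations. -/
theorem distortion (hτ0 : 0 < τ) (hτ1 : τ < 1) (hdist : HolderDistortion m T δ τ) :
    ∃ L : ℝ, 0 ≤ L ∧ ∀ (n : ℕ) (x : Z) (i : ι), T^[n] x ∈ δ i →
      m (cyl T δ (n + 1) x) = 0 ∨
      ∀ (k : ℕ) (A B : Set Z), MeasurableSet A → MeasurableSet B →
      (∀ x ∈ A, ∀ y ∈ B, Near T δ k x y) →
      m (cyl T δ (n + 1) x ∩ T^[n + 1] ⁻¹' A) * m (B ∩ T '' (δ i)) ≤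
        ENNReal.ofReal (Real.exp (L * τ ^ k)) *
          (m (cyl T δ (n + 1) x ∩ T^[n + 1] ⁻¹' B) * m A) := by
  obtain ⟨c, hc0, hc⟩ := hM.distortion_one hτ0 hτ1 hdist
  have h1τ : 0 < 1 - τ := by linarith
  -- The solution of `L τ + c τ = L`: the successive losses `c τ^(k+1)`, `c τ^(k+2)`, ... sum to `L
  -- τ^k`.
  set L := c * τ / (1 - τ) with hL
  have hL0 : 0 ≤ L := by positivity
  have hLc : ∀ k : ℕ, L * τ ^ (k + 1) + c * τ ^ (k + 1) = L * τ ^ k := by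
    intro k
    have : L * τ + c * τ = L := by rw [hL]; field_simp; ring
    calc L * τ ^ (k + 1) + c * τ ^ (k + 1) = (L * τ + c * τ) * τ ^ k := by ring
      _ = _ := by rw [this]
  have hcL : ∀ k : ℕ, c * τ ^ (k + 1) ≤ L * τ ^ k := fun k => by
    rw [← hLc k]
    have : 0 ≤ L * τ ^ (k + 1) := by positivity
    linarith
  refine ⟨L, hL0, fun n => ?_⟩
  induction n with
  | zero =>
    intro x i hi
    right
    intro k A B hA hB hnear
    have hi' : x ∈ δ i := hi
    rw [zero_add, hM.cyl_one hi', Function.iterate_one]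
    refine (hc i k A B hA hB hnear).trans ?_
    exact mul_le_mul' (ENNReal.ofReal_le_ofReal (Real.exp_le_exp.2 (hcL k))) le_rfl
  | succ n ih =>
    intro x i hi
    obtain ⟨j, hj⟩ := hM.exists_mem (T^[n] x)
    have hcyl := hM.cyl_succ hi
    have hcyl' := hM.cyl_succ hj
    have hiter : ∀ s : Set Z, T^[n + 1] ⁻¹' s = T^[n] ⁻¹' (T ⁻¹' s) := fun s => by
      rw [Function.iterate_succ', Set.preimage_comp]
    have hiter' : ∀ s : Set Z, T^[n + 1 + 1] ⁻¹' s = T^[n + 1] ⁻¹' (T ⁻¹' s) := fun s => by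
      rw [Function.iterate_succ' T (n + 1), Set.preimage_comp]
    have hnull : ∀ (n : ℕ) (s : Set Z), m s = 0 → m (T^[n] ⁻¹' s) = 0 := by
      have hq : Measure.QuasiMeasurePreserving T m m := by
        refine ⟨hM.measurable, Measure.AbsolutelyContinuous.mk fun s hs h0 => ?_⟩
        rw [Measure.map_apply hM.measurable hs]
        exact (hM.nonsingular s hs).2 h0
      intro n s hs
      exact (hq.iterate n).preimage_null hs
    -- Markov property: either `δ i` lies essentially inside `T (δ j)`, or the cylinder is null.
    rcases hM.image_dichotomy j i with hd | hd
    swap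
    · left
      refine measure_mono_null ?_ (hnull (n + 1) _ hd)
      rw [hcyl, hcyl']
      rintro y ⟨⟨h1, h2⟩, h3⟩
      refine ⟨h3, ?_⟩
      rw [Function.iterate_succ_apply']
      exact ⟨_, h2, rfl⟩
    rcases ih x j hj with h0 | h0
    · left
      rw [hcyl]
      exact measure_mono_null Set.inter_subset_left h0
    right
    intro k A B hA hB hnear
    set EA := δ i ∩ T ⁻¹' A with hEA
    set EB := δ i ∩ T ⁻¹' B with hEB
    have hEAm : MeasurableSet EA := (hM.measurableSet i).inter (hM.measurable hA)
    have hEBm : MeasurableSet EB := (hM.measurableSet i).inter (hM.measurable hB)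
    have e : ∀ s : Set Z, cyl T δ (n + 1 + 1) x ∩ T^[n + 1 + 1] ⁻¹' s =
        cyl T δ (n + 1) x ∩ T^[n + 1] ⁻¹' (δ i ∩ T ⁻¹' s) := by
      intro s
      rw [hcyl, hiter', Set.preimage_inter, Set.inter_assoc]
    rw [e, e, ← hEA, ← hEB]
    have hIH := h0 (k + 1) EA EB hEAm hEBm fun x hx y hy =>
      near_succ_of_mem hx.1 hy.1 (hnear _ hx.2 _ hy.2)
    have hD := hc i k A B hA hB hnear
    rw [← hEA, ← hEB] at hD
    have hEBd : m (EB ∩ T '' (δ j)) = m EB := by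
      have hz : m (EB \ T '' (δ j)) = 0 :=
        measure_mono_null (Set.sdiff_subset_sdiff_left Set.inter_subset_left) hd
      exact measure_inter_conull' hz
    rw [hEBd] at hIH
    -- The induction hypothesis compares `EA` with `EB`, the one-step estimate compares `A` with
    -- `B`, and the common factor `m EB` is cancelled. When it vanishes, `B ∩ T (δ i)` is null
    -- because the inverse branch is nonsingular.
    by_cases hEB0 : m EB = 0
    · have h4 := hM.null_image i EB hEBm Set.inter_subset_left hEB0
      rw [hEB, Set.image_inter_preimage, Set.inter_comm] at h4
      rw [h4, mul_zero]
      exact zero_le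
    have hfin : m EB ≠ ∞ := measure_ne_top _ _
    rw [← ENNReal.mul_le_mul_iff_left hEB0 hfin]
    set P := m (cyl T δ (n + 1) x ∩ T^[n + 1] ⁻¹' EA)
    set P' := m (cyl T δ (n + 1) x ∩ T^[n + 1] ⁻¹' EB)
    calc P * m (B ∩ T '' δ i) * m EB = (P * m EB) * m (B ∩ T '' δ i) := by ring
      _ ≤ (ENNReal.ofReal (Real.exp (L * τ ^ (k + 1))) * (P' * m EA)) * m (B ∩ T '' δ i) := by
        gcongr
      _ = ENNReal.ofReal (Real.exp (L * τ ^ (k + 1))) * P' * (m EA * m (B ∩ T '' δ i)) := by ring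
      _ ≤ ENNReal.ofReal (Real.exp (L * τ ^ (k + 1))) * P' *
          (ENNReal.ofReal (Real.exp (c * τ ^ (k + 1))) * (m EB * m A)) := by gcongr
      _ = (ENNReal.ofReal (Real.exp (L * τ ^ (k + 1))) *
          ENNReal.ofReal (Real.exp (c * τ ^ (k + 1)))) * (P' * m A) * m EB := by ring
      _ = ENNReal.ofReal (Real.exp (L * τ ^ k)) * (P' * m A) * m EB := by
        rw [← ENNReal.ofReal_mul (Real.exp_pos _).le, ← Real.exp_add, hLc]

end IsMarkovMap

end Distortion

/-! ### The tower -/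

section Tower

variable {Z ι : Type*} [MeasurableSpace Z] {m : Measure Z} {T : Z → Z} {δ : ι → Set Z} {τ : ℝ}
  {q : ℕ} {base : Set ι} {height : ι → ℕ} {floor : ι → ℕ → ι}

namespace IsBoundedTower

variable (hM : IsMarkovMap m T δ) (hW : IsBoundedTower m T δ q base height floor)
include hW

theorem exists_floor (j : ι) : ∃ a ∈ base, ∃ k < height a, floor a k = j := by
  obtain ⟨p, ⟨h1, h2, h3⟩, -⟩ := hW.floor_unique j
  exact ⟨p.1, h1, p.2, h2, h3⟩

theorem floor_inj {a b : ι} {k l : ℕ} (ha : a ∈ base) (hb : b ∈ base) (hk : k < height a)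
    (hl : l < height b) (h : floor a k = floor b l) : a = b ∧ k = l := by
  obtain ⟨p, -, hp⟩ := hW.floor_unique (floor a k)
  have h1 := hp (a, k) ⟨ha, hk, rfl⟩
  have h2 := hp (b, l) ⟨hb, hl, h.symm⟩
  exact Prod.ext_iff.1 (h1.trans h2.symm)

theorem floor_succ_notMem {a : ι} {k : ℕ} (ha : a ∈ base) (hk : k + 1 < height a) :
    floor a (k + 1) ∉ base := by
  intro hb
  have := hW.floor_inj ha hb hk (hW.height_pos _ hb) (hW.floor_zero _ hb).symm
  omega

include hM

omit hW in
theorem disjoint_basis {j : ι} (hj : j ∉ base) : Disjoint (δ j) (basis δ base) := by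
  rw [basis, Set.disjoint_iUnion₂_right]
  intro i hi
  exact hM.disjoint (by rintro rfl; exact hj hi)

theorem null_of_not_returns {i : ι} (hi : ¬ Returns m T δ base i) :
    m (T '' (δ i) ∩ basis δ base) = 0 := by
  obtain ⟨a, ha, k, hk, rfl⟩ := hW.exists_floor i
  have hk' : k + 1 < height a := by
    by_contra h
    exact hi (hW.fall a ha k (by omega))
  have h1 : (T '' δ (floor a k) ∩ basis δ base : Set Z) =ᵐ[m]
      (δ (floor a (k + 1)) ∩ basis δ base : Set Z) := (hW.climb a ha k hk').inter (ae_eq_refl _)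
  rw [measure_congr h1, Set.disjoint_iff_inter_eq_empty.1
    (disjoint_basis hM (hW.floor_succ_notMem ha hk')), measure_empty]

theorem not_returns {a : ι} {k : ℕ} (ha : a ∈ base) (hk : k + 1 < height a) :
    ¬ Returns m T δ base (floor a k) := by
  intro h
  have h1 : δ (floor a (k + 1)) ≤ᵐ[m] basis δ base :=
    (hW.climb a ha k hk).symm.le.trans h
  have h2 := ae_le_set.1 h1
  rw [(disjoint_basis hM (hW.floor_succ_notMem ha hk)).sdiff_eq_left] at h2
  exact (hM.pos _).ne' h2

/-- The preimage of a subset of a floor is contained in the previous floor. -/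
theorem preimage_ae_eq [Countable ι] {a : ι} {k : ℕ} (ha : a ∈ base) (hk : k + 1 < height a)
    {A : Set Z} (hAj : A ⊆ δ (floor a (k + 1))) :
    (T ⁻¹' A : Set Z) =ᵐ[m] (δ (floor a k) ∩ T ⁻¹' A : Set Z) := by
  -- Elements other than `floor a k` have images that miss `A`: the returning ones land in the
  -- basis, which is disjoint from `floor a (k + 1)`, and the others climb to a different floor.
  have hnull : ∀ i, i ≠ floor a k → m (T '' (δ i) ∩ A) = 0 := by
    intro i hi
    by_cases hr : Returns m T δ base i
    · refine measure_mono_null ?_ (ae_le_set.1 hr)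
      rintro y ⟨h1, h2⟩
      exact ⟨h1, Set.disjoint_left.1
        (disjoint_basis hM (hW.floor_succ_notMem ha hk)) (hAj h2)⟩
    · obtain ⟨b, hb, l, hl, rfl⟩ := hW.exists_floor i
      have hl' : l + 1 < height b := by
        by_contra h
        exact hr (hW.fall b hb l (by omega))
      have hne : floor b (l + 1) ≠ floor a (k + 1) := by
        intro h
        obtain ⟨rfl, h2⟩ := hW.floor_inj hb ha hl' hk h
        exact hi (by rw [Nat.succ_injective h2])
      refine measure_mono_null (Set.inter_subset_inter_right _ hAj) ?_
      have h1 : (T '' δ (floor b l) ∩ δ (floor a (k + 1)) : Set Z) =ᵐ[m]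
        (δ (floor b (l + 1)) ∩ δ (floor a (k + 1)) : Set Z) :=
          (hW.climb b hb l hl').inter (ae_eq_refl _)
      rw [measure_congr h1, Set.disjoint_iff_inter_eq_empty.1 (hM.disjoint hne), measure_empty]
  have hpre : ∀ i, i ≠ floor a k → m (δ i ∩ T ⁻¹' A) = 0 := by
    intro i hi
    obtain ⟨C, hC1, hC2, hC3⟩ := exists_measurable_superset_of_null (hnull i hi)
    refine measure_mono_null ?_ ((hM.nonsingular C hC2).2 hC3)
    rintro x ⟨h1, h2⟩
    exact hC1 ⟨⟨x, h1, rfl⟩, h2⟩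
  symm
  refine (Set.inter_subset_right.eventuallyLE).antisymm ?_
  rw [ae_le_set]
  refine measure_mono_null (t := ⋃ (i : ι) (_ : i ≠ floor a k), δ i ∩ T ⁻¹' A) ?_ ?_
  · rintro x ⟨h1, h2⟩
    obtain ⟨i, hi⟩ := hM.exists_mem x
    simp only [Set.mem_iUnion]
    refine ⟨i, ?_, hi, h1⟩
    rintro rfl
    exact h2 ⟨hi, h1⟩
  · rw [measure_iUnion_null_iff]
    intro i
    rw [measure_iUnion_null_iff]
    exact hpre i

variable [StandardBorelSpace Z] [Countable ι] [IsFiniteMeasure m]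

/-- Measure of the set of points in a cylinder which come back to a subset of the basis. -/
theorem exists_cyl_bound (hT : MeasurePreserving T m m)
    (hτ0 : 0 < τ) (hτ1 : τ < 1) (hdist : HolderDistortion m T δ τ)
    (hBig : BigImage m T δ base) :
    ∃ K : ℝ, 0 ≤ K ∧ ∀ (n : ℕ) (x : Z),
      (∀ A, MeasurableSet A → A ⊆ basis δ base →
        m.real (cyl T δ (n + 1) x ∩ T^[n + 1] ⁻¹' A) ≤ K * m.real (cyl T δ (n + 1) x) * m.real A) ∧
      ∀ (k : ℕ) (A B : Set Z), 1 ≤ k → MeasurableSet A → MeasurableSet B →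
      A ⊆ basis δ base → B ⊆ basis δ base → m A ≠ 0 → m B ≠ 0 →
      (∀ x ∈ A, ∀ y ∈ B, Near T δ k x y) →
      |m.real (cyl T δ (n + 1) x ∩ T^[n + 1] ⁻¹' A) / m.real A -
        m.real (cyl T δ (n + 1) x ∩ T^[n + 1] ⁻¹' B) / m.real B| ≤
        K * m.real (cyl T δ (n + 1) x) * τ ^ k := by
  obtain ⟨L, hL0, hL⟩ := hM.distortion hτ0 hτ1 hdist
  obtain ⟨η, hη, hbig⟩ := hBig
  -- Distortion with `k = 0` and `B = T (δ i)`, a set of measure more than `η`, gives this constant.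
  -- This is where big images act.
  set K₀ := Real.exp L / η with hK₀
  have hK₀0 : 0 ≤ K₀ := by positivity
  have hnull : ∀ (n : ℕ) (s : Set Z), m s = 0 → m (T^[n] ⁻¹' s) = 0 := fun n s hs =>
    ((hT.iterate n).quasiMeasurePreserving).preimage_null hs
  have hcylsub : ∀ (n : ℕ) (x : Z) (i : ι), T^[n] x ∈ δ i → ∀ A, m (A ∩ T '' (δ i)) = 0 →
      m (cyl T δ (n + 1) x ∩ T^[n + 1] ⁻¹' A) = 0 := by
    intro n x i hi A hA
    refine measure_mono_null ?_ (hnull (n + 1) _ hA)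
    rw [hM.cyl_succ hi]
    rintro y ⟨⟨h1, h2⟩, h3⟩
    refine ⟨h3, ?_⟩
    rw [Function.iterate_succ_apply']
    exact ⟨_, h2, rfl⟩
  have ha : ∀ (n : ℕ) (x : Z) (A : Set Z), MeasurableSet A → A ⊆ basis δ base →
        m.real (cyl T δ (n + 1) x ∩ T^[n + 1] ⁻¹' A) ≤
          K₀ * m.real (cyl T δ (n + 1) x) * m.real A := by
    intro n x A hA hAb
    obtain ⟨i, hi⟩ := hM.exists_mem (T^[n] x)
    by_cases hr : Returns m T δ base i
    swap
    · have h0 : m (A ∩ T '' (δ i)) = 0 := by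
        refine measure_mono_null ?_ (hW.null_of_not_returns hM hr)
        rw [Set.inter_comm]
        exact Set.inter_subset_inter_right _ hAb
      rw [measureReal_def, hcylsub n x i hi A h0]
      simp only [ENNReal.toReal_zero]
      positivity
    rcases hL n x i hi with h0 | h0
    · rw [measureReal_def, measure_mono_null Set.inter_subset_left h0]
      simp only [ENNReal.toReal_zero]
      positivity
    have h1 := h0 0 A (T '' δ i) hA (hM.measurableSet_image (hM.measurableSet i) subset_rfl)
      (fun x _ y _ k hk => absurd hk (Nat.not_lt_zero _))
    rw [Set.inter_self, pow_zero, mul_one] at h1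
    have h2 : m (cyl T δ (n + 1) x ∩ T^[n + 1] ⁻¹' A) * ENNReal.ofReal η ≤
        ENNReal.ofReal (Real.exp L) * (m (cyl T δ (n + 1) x) * m A) := by
      calc _ ≤ m (cyl T δ (n + 1) x ∩ T^[n + 1] ⁻¹' A) * m (T '' δ i) := by
            gcongr
            exact (hbig i hr).le
        _ ≤ _ := h1
        _ ≤ _ := by
          gcongr
          exact Set.inter_subset_left
    have h3 := ENNReal.toReal_mono (by finiteness) h2
    rw [ENNReal.toReal_mul, ENNReal.toReal_mul, ENNReal.toReal_mul, ENNReal.toReal_ofReal hη.le,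
      ENNReal.toReal_ofReal (Real.exp_pos _).le] at h3
    rw [hK₀, div_mul_eq_mul_div, div_mul_eq_mul_div, le_div_iff₀ hη]
    simp only [measureReal_def]
    linarith
  -- The factor `L exp L` comes from `exp (L τ^k) - 1 ≤ L (exp L) τ^k`; the `1` lets the same
  -- constant serve the first estimate.
  refine ⟨K₀ * (1 + L * Real.exp L), by positivity, fun n x => ⟨fun A hA hAb => ?_, ?_⟩⟩
  · refine (ha n x A hA hAb).trans ?_
    gcongr
    have : 0 ≤ L * Real.exp L := by positivity
    nlinarith
  intro k A B hk hA hB hAb hBb hA0 hB0 hnear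
  obtain ⟨i, hi⟩ := hM.exists_mem (T^[n] x)
  have hpos : ∀ {s : Set Z}, m s ≠ 0 → 0 < m.real s := fun {s} hs =>
    ENNReal.toReal_pos hs (measure_ne_top _ _)
  have hrhs : 0 ≤ K₀ * (1 + L * Real.exp L) * m.real (cyl T δ (n + 1) x) * τ ^ k := by positivity
  rcases hL n x i hi with h0 | h0
  · rw [measureReal_def, measure_mono_null Set.inter_subset_left h0, measureReal_def (s := _ ∩ _),
      measure_mono_null Set.inter_subset_left h0]
    simpa using hrhs
  obtain ⟨y₀, hy₀⟩ := nonempty_of_measure_ne_zero hB0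
  obtain ⟨j, hj⟩ := hM.exists_mem y₀
  have hAj : A ⊆ δ j := by
    intro z hz
    obtain ⟨l, h1, h2⟩ := hnear z hz y₀ hy₀ 0 (by omega)
    rwa [hM.index_unique hj h2]
  obtain ⟨z₀, hz₀⟩ := nonempty_of_measure_ne_zero hA0
  have hBj : B ⊆ δ j := by
    intro z hz
    obtain ⟨l, h1, h2⟩ := hnear z₀ hz₀ z hz 0 (by omega)
    rwa [hM.index_unique (hAj hz₀) h1]
  rcases hM.image_dichotomy i j with hd | hd
  swap
  · have e : ∀ {A : Set Z}, A ⊆ δ j → m (cyl T δ (n + 1) x ∩ T^[n + 1] ⁻¹' A) = 0 := fun hA =>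
      hcylsub n x i hi _ (measure_mono_null (Set.inter_subset_inter_left _ hA) hd)
    rw [measureReal_def, e hAj, measureReal_def (s := _ ∩ _), e hBj]
    simpa using hrhs
  have hfull : ∀ {A : Set Z}, A ⊆ δ j → m (A ∩ T '' (δ i)) = m A := fun hA =>
    measure_inter_conull' (measure_mono_null (Set.sdiff_subset_sdiff_left hA) hd)
  have key : ∀ A B : Set Z, MeasurableSet A → MeasurableSet B → A ⊆ basis δ base →
      B ⊆ basis δ base → m A ≠ 0 → m B ≠ 0 → A ⊆ δ j → B ⊆ δ j →
      (∀ x ∈ A, ∀ y ∈ B, Near T δ k x y) →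
      m.real (cyl T δ (n + 1) x ∩ T^[n + 1] ⁻¹' A) / m.real A -
        m.real (cyl T δ (n + 1) x ∩ T^[n + 1] ⁻¹' B) / m.real B ≤
        K₀ * (1 + L * Real.exp L) * m.real (cyl T δ (n + 1) x) * τ ^ k := by
    intro A B hA hB hAb hBb hA0 hB0 hAj hBj hnear
    have h1 := h0 k A B hA hB hnear
    rw [hfull hBj] at h1
    have h2 := ENNReal.toReal_mono (by finiteness) h1
    rw [ENNReal.toReal_mul, ENNReal.toReal_mul, ENNReal.toReal_mul,
      ENNReal.toReal_ofReal (Real.exp_pos _).le] at h2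
    have hb := ha n x B hB hBb
    have hA' := hpos hA0
    have hB' := hpos hB0
    simp only [← measureReal_def] at h2
    set P := m.real (cyl T δ (n + 1) x ∩ T^[n + 1] ⁻¹' A)
    set P' := m.real (cyl T δ (n + 1) x ∩ T^[n + 1] ⁻¹' B)
    set M := m.real (cyl T δ (n + 1) x)
    have hM0 : 0 ≤ M := measureReal_nonneg
    have hP' : 0 ≤ P' := measureReal_nonneg
    have h3 : P / m.real A ≤ Real.exp (L * τ ^ k) * (P' / m.real B) := by
      rw [div_le_iff₀ hA', mul_assoc, div_mul_eq_mul_div, ← mul_div_assoc, le_div_iff₀ hB']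
      exact h2
    have h4 : P' / m.real B ≤ K₀ * M := by
      rw [div_le_iff₀ hB']
      exact hb
    have hτk : τ ^ k ≤ 1 := pow_le_one₀ hτ0.le hτ1.le
    have hτk0 : 0 < τ ^ k := pow_pos hτ0 k
    have h5 : Real.exp (L * τ ^ k) - 1 ≤ L * Real.exp L * τ ^ k := by
      have e1 : Real.exp (L * τ ^ k) - 1 ≤ L * τ ^ k * Real.exp (L * τ ^ k) := by
        have := Real.add_one_le_exp (-(L * τ ^ k))
        have e2 : Real.exp (-(L * τ ^ k)) * Real.exp (L * τ ^ k) = 1 := by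
          rw [← Real.exp_add]; simp
        nlinarith [Real.exp_pos (L * τ ^ k)]
      have e2 : Real.exp (L * τ ^ k) ≤ Real.exp L :=
        Real.exp_le_exp.2 (by nlinarith)
      calc _ ≤ _ := e1
        _ ≤ L * τ ^ k * Real.exp L := by gcongr
        _ = _ := by ring
    have h6 : 0 ≤ P' / m.real B := by positivity
    calc P / m.real A - P' / m.real B ≤ (Real.exp (L * τ ^ k) - 1) * (P' / m.real B) := by
          linarith
      _ ≤ (L * Real.exp L * τ ^ k) * (K₀ * M) := by
        apply mul_le_mul h5 h4 h6
        positivity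
      _ ≤ (L * Real.exp L * τ ^ k) * (K₀ * M) + K₀ * M * τ ^ k :=
        le_add_of_nonneg_right (by positivity)
      _ = K₀ * (1 + L * Real.exp L) * M * τ ^ k := by ring
  rw [abs_le]
  constructor
  · have := key B A hB hA hBb hAb hB0 hA0 hBj hAj fun x hx y hy => (hnear y hy x hx).symm
    linarith
  · exact key A B hA hB hAb hBb hA0 hB0 hAj hBj hnear

end IsBoundedTower

end Tower

/-! ### Estimates on the iterates of the transfer operator -/

section Estimates

variable {Z ι : Type*} [MeasurableSpace Z] [Countable ι]
  {m : Measure Z} [IsFiniteMeasure m] {T : Z → Z} {δ : ι → Set Z} {τ : ℝ}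

omit [IsFiniteMeasure m] in
theorem IsMarkovMap.hasSum_setIntegral_piece (hM : IsMarkovMap m T δ) {f : Z → ℂ}
    (hf : Integrable f m) (n : ℕ) {A : Set Z} (hA : MeasurableSet A) :
    HasSum (fun w => ∫ x in piece T δ n w ∩ A, f x ∂m) (∫ x in A, f x ∂m) := by
  have h := hasSum_integral_iUnion (μ := m) (f := f) (s := fun w => piece T δ n w ∩ A)
    (fun w => (hM.measurableSet_piece n w).inter hA)
    (fun v w hvw => ((hM.pairwise_disjoint_piece n hvw).mono Set.inter_subset_left
      Set.inter_subset_left)) hf.integrableOn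
  rwa [← Set.iUnion_inter, hM.iUnion_piece, Set.univ_inter] at h

theorem norm_setIntegral_le_mul {f : Z → ℂ} {s : ℝ} {E : Set Z} (h : ∀ x ∈ E, ‖f x‖ ≤ s) :
    ‖∫ x in E, f x ∂m‖ ≤ s * m.real E :=
  norm_setIntegral_le_of_norm_le_const (measure_lt_top m E) h

/-- Both integrals are compared with one value `f y`. In the applications `E` and `F` are the parts
of a cylinder above `A` and `B`, and `a`, `b` are the measures of `A`, `B`: the first term is the
distortion of the map, the second the oscillation of `f`. -/
theorem norm_average_sub_average_le {f : Z → ℂ} {s K a b : ℝ} {E F : Set Z} (ha : 0 < a)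
    (hb : 0 < b) (hfE : IntegrableOn f E m) (hfF : IntegrableOn f F m)
    (hE : ∀ x ∈ E, ‖f x‖ ≤ s) (hF : ∀ x ∈ F, ‖f x‖ ≤ s)
    (hEF : ∀ x ∈ E ∪ F, ∀ y ∈ E ∪ F, ‖f x - f y‖ ≤ K) :
    ‖(∫ x in E, f x ∂m) / (a : ℂ) - (∫ x in F, f x ∂m) / (b : ℂ)‖ ≤
      |m.real E / a - m.real F / b| * s + (m.real E / a + m.real F / b) * K := by
  rcases (E ∪ F).eq_empty_or_nonempty with h0 | ⟨y, hy⟩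
  · obtain ⟨rfl, rfl⟩ := Set.union_empty_iff.1 h0
    simp
  have hsub : ∀ G : Set Z, G ⊆ E ∪ F → IntegrableOn f G m →
      ‖(∫ x in G, f x ∂m) - m.real G * f y‖ ≤ K * m.real G := by
    intro G hG hfG
    have e : (∫ x in G, f x ∂m) - m.real G * f y = ∫ x in G, (f x - f y) ∂m := by
      rw [integral_sub hfG (integrable_const _)]
      simp
    rw [e]
    exact norm_setIntegral_le_mul fun x hx => hEF x (hG hx) y hy
  have h1 := hsub E Set.subset_union_left hfE
  have h2 := hsub F Set.subset_union_right hfF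
  have hys : ‖f y‖ ≤ s := by
    rcases hy with hy | hy
    · exact hE y hy
    · exact hF y hy
  have ha' : (a : ℂ) ≠ 0 := by exact_mod_cast ha.ne'
  have hb' : (b : ℂ) ≠ 0 := by exact_mod_cast hb.ne'
  have e : (∫ x in E, f x ∂m) / (a : ℂ) - (∫ x in F, f x ∂m) / (b : ℂ) =
      ((m.real E / a - m.real F / b : ℝ) : ℂ) * f y +
      ((∫ x in E, f x ∂m) - m.real E * f y) / a - ((∫ x in F, f x ∂m) - m.real F * f y) / b := by
    push_cast
    field_simp
    ring
  rw [e]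
  refine (norm_sub_le _ _).trans ?_
  refine (add_le_add_left (norm_add_le _ _) _).trans ?_
  rw [norm_mul, norm_div, norm_div, Complex.norm_real, Complex.norm_real, Complex.norm_real,
    Real.norm_of_nonneg ha.le, Real.norm_of_nonneg hb.le, Real.norm_eq_abs]
  have h3 : ‖(∫ x in E, f x ∂m) - m.real E * f y‖ / a ≤ K * m.real E / a := by gcongr
  have h4 : ‖(∫ x in F, f x ∂m) - m.real F * f y‖ / b ≤ K * m.real F / b := by gcongr
  have h5 : |m.real E / a - m.real F / b| * ‖f y‖ ≤ |m.real E / a - m.real F / b| * s := by gcongr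
  have h6 : (m.real E / a + m.real F / b) * K = K * m.real E / a + K * m.real F / b := by ring
  linarith

variable [StandardBorelSpace Z] {q : ℕ} {base : Set ι} {height : ι → ℕ} {floor : ι → ℕ → ι}

/-- The averages of `R^{n+1} f` on the basis of the tower. -/
theorem IsBoundedTower.exists_basis_estimate (hM : IsMarkovMap m T δ)
    (hW : IsBoundedTower m T δ q base height floor) (hT : MeasurePreserving T m m)
    (hτ0 : 0 < τ) (hτ1 : τ < 1) (hdist : HolderDistortion m T δ τ)
    (hBig : BigImage m T δ base) :
    ∃ K : ℝ, 0 ≤ K ∧ ∀ (n : ℕ) (f : Z → ℂ) (s D : (Fin (n + 1) → ι) → ℝ) (N : ℝ),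
      Integrable f m → (∀ w, 0 ≤ s w) → (∀ w, 0 ≤ D w) →
      (∀ w, ∀ x ∈ piece T δ (n + 1) w, ‖f x‖ ≤ s w) →
      (∀ w k, 1 ≤ k → ∀ x ∈ piece T δ (n + 1) w, ∀ y ∈ piece T δ (n + 1) w,
        Near T δ (n + 1 + k) x y → ‖f x - f y‖ ≤ D w * τ ^ k) →
      HasSum (fun w => m.real (piece T δ (n + 1) w) * (s w + D w)) N →
      (∀ A, MeasurableSet A → A ⊆ basis δ base →
        ‖∫ x in T^[n + 1] ⁻¹' A, f x ∂m‖ ≤ K * N * m.real A) ∧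
      ∀ (k : ℕ) (A B : Set Z), 1 ≤ k → MeasurableSet A → MeasurableSet B →
      A ⊆ basis δ base → B ⊆ basis δ base → m A ≠ 0 → m B ≠ 0 →
      (∀ x ∈ A, ∀ y ∈ B, Near T δ k x y) →
      ‖(∫ x in T^[n + 1] ⁻¹' A, f x ∂m) / (m.real A : ℂ) -
        (∫ x in T^[n + 1] ⁻¹' B, f x ∂m) / (m.real B : ℂ)‖ ≤ K * N * τ ^ k := by
  obtain ⟨K, hK0, hK⟩ := hW.exists_cyl_bound hM hT hτ0 hτ1 hdist hBig
  have hpos : ∀ {s : Set Z}, m s ≠ 0 → 0 < m.real s := fun {s} hs =>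
    ENNReal.toReal_pos hs (measure_ne_top _ _)
  -- The oscillation of `f` enters twice, above `A` and above `B`, whence `2 * K`. The Hölder
  -- hypothesis only counts symbols after time `n + 1`, so a contraction `τ^(n+1)` can be carried by
  -- `D`.
  refine ⟨2 * K, by positivity, fun n f s D N hf hs0 hD0 hs hD hN => ?_⟩
  have hNn : 0 ≤ N := hN.nonneg fun w =>
    mul_nonneg measureReal_nonneg (add_nonneg (hs0 w) (hD0 w))
  have hmeas : ∀ {A : Set Z}, MeasurableSet A → MeasurableSet (T^[n + 1] ⁻¹' A) := fun hA =>
    hM.measurable.iterate (n + 1) hA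
  have hpiece : ∀ w, piece T δ (n + 1) w = ∅ ∨ ∃ x, piece T δ (n + 1) w = cyl T δ (n + 1) x := by
    intro w
    rcases (piece T δ (n + 1) w).eq_empty_or_nonempty with h | ⟨x, hx⟩
    · exact Or.inl h
    · exact Or.inr ⟨x, hM.piece_eq_cyl hx⟩
  have hb1 : ∀ w A, MeasurableSet A → A ⊆ basis δ base →
      m.real (piece T δ (n + 1) w ∩ T^[n + 1] ⁻¹' A) ≤
        K * m.real (piece T δ (n + 1) w) * m.real A := by
    intro w A hA hAb
    rcases hpiece w with h | ⟨x, hx⟩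
    · simp [h]
    · rw [hx]
      exact (hK n x).1 A hA hAb
  constructor
  · intro A hA hAb
    have h1 := hM.hasSum_setIntegral_piece hf (n + 1) (hmeas hA)
    rw [← h1.tsum_eq]
    refine tsum_of_norm_bounded ((hN.mul_left (2 * K)).mul_right (m.real A)) fun w => ?_
    have hP : 0 ≤ m.real (piece T δ (n + 1) w) := measureReal_nonneg
    calc _ ≤ s w * m.real (piece T δ (n + 1) w ∩ T^[n + 1] ⁻¹' A) :=
          norm_setIntegral_le_mul fun x hx => hs w x hx.1
      _ ≤ s w * (K * m.real (piece T δ (n + 1) w) * m.real A) := by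
        gcongr
        · exact hs0 w
        · exact hb1 w A hA hAb
      _ = K * (m.real (piece T δ (n + 1) w) * s w) * m.real A := by ring
      _ ≤ 2 * K * (m.real (piece T δ (n + 1) w) * (s w + D w)) * m.real A := by
        have := hs0 w
        have := hD0 w
        gcongr
        · linarith
        · linarith
  · intro k A B hk hA hB hAb hBb hA0 hB0 hnear
    have h1 := (hM.hasSum_setIntegral_piece hf (n + 1) (hmeas hA)).div_const (m.real A : ℂ)
    have h2 := (hM.hasSum_setIntegral_piece hf (n + 1) (hmeas hB)).div_const (m.real B : ℂ)
    have h3 := h1.sub h2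
    rw [← h3.tsum_eq]
    refine tsum_of_norm_bounded ((hN.mul_left (2 * K)).mul_right (τ ^ k)) fun w => ?_
    set P := piece T δ (n + 1) w with hP
    have hτk : 0 < τ ^ k := pow_pos hτ0 k
    have hnear' : ∀ x ∈ A ∪ B, ∀ y ∈ A ∪ B, Near T δ k x y := by
      obtain ⟨a, ha⟩ := nonempty_of_measure_ne_zero hA0
      obtain ⟨b, hb⟩ := nonempty_of_measure_ne_zero hB0
      have hall : ∀ x ∈ A ∪ B, Near T δ k x b := by
        rintro x (hx | hx)
        · exact hnear x hx b hb
        · exact hM.near_trans (hnear a ha x hx).symm (hnear a ha b hb)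
      exact fun x hx y hy => hM.near_trans (hall x hx) (hall y hy).symm
    have h4 := norm_average_sub_average_le (f := f) (s := s w) (K := D w * τ ^ k)
      (E := P ∩ T^[n + 1] ⁻¹' A) (F := P ∩ T^[n + 1] ⁻¹' B) (hpos hA0) (hpos hB0)
      hf.integrableOn hf.integrableOn (fun x hx => hs w x hx.1) (fun x hx => hs w x hx.1) (by
        intro x hx y hy
        rw [← Set.inter_union_distrib_left, ← Set.preimage_union] at hx hy
        exact hD w k hk x hx.1 y hy.1
          (near_add (near_of_mem_piece hx.1 hy.1) (hnear' _ hx.2 _ hy.2)))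
    refine h4.trans ?_
    have h5 : |m.real (P ∩ T^[n + 1] ⁻¹' A) / m.real A - m.real (P ∩ T^[n + 1] ⁻¹' B) / m.real B| ≤
        K * m.real P * τ ^ k := by
      rcases hpiece w with h | ⟨x, hx⟩
      · simp [hP, h]
      · rw [hP, hx]
        exact (hK n x).2 k A B hk hA hB hAb hBb hA0 hB0 hnear
    have h6 : m.real (P ∩ T^[n + 1] ⁻¹' A) / m.real A ≤ K * m.real P := by
      rw [div_le_iff₀ (hpos hA0)]
      exact hb1 w A hA hAb
    have h7 : m.real (P ∩ T^[n + 1] ⁻¹' B) / m.real B ≤ K * m.real P := by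
      rw [div_le_iff₀ (hpos hB0)]
      exact hb1 w B hB hBb
    have hPn : 0 ≤ m.real P := measureReal_nonneg
    calc _ ≤ K * m.real P * τ ^ k * s w + (K * m.real P + K * m.real P) * (D w * τ ^ k) := by
          have := hs0 w
          have := hD0 w
          gcongr
      _ = K * (m.real P * (s w + D w)) * τ ^ k + K * (m.real P * D w) * τ ^ k := by ring
      _ ≤ K * (m.real P * (s w + D w)) * τ ^ k + K * (m.real P * (s w + D w)) * τ ^ k := by
        have := hs0 w
        have := hD0 w
        gcongr
        linarith
      _ = 2 * K * (m.real P * (s w + D w)) * τ ^ k := by ring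

omit [StandardBorelSpace Z] [IsFiniteMeasure m] in
/-- Going down one floor in the tower. -/
theorem IsBoundedTower.setIntegral_climb (hM : IsMarkovMap m T δ)
    (hW : IsBoundedTower m T δ q base height floor) (hT : MeasurePreserving T m m) {a : ι} {k : ℕ}
    (ha : a ∈ base) (hk : k + 1 < height a) {A : Set Z} (hA : MeasurableSet A)
    (hAj : A ⊆ δ (floor a (k + 1))) (f : Z → ℂ) (n : ℕ) :
    MeasurableSet (δ (floor a k) ∩ T ⁻¹' A) ∧ m (δ (floor a k) ∩ T ⁻¹' A) = m A ∧
    ∫ x in T^[n + 1] ⁻¹' A, f x ∂m = ∫ x in T^[n] ⁻¹' (δ (floor a k) ∩ T ⁻¹' A), f x ∂m := by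
  have h1 := hW.preimage_ae_eq hM ha hk hAj
  refine ⟨(hM.measurableSet _).inter (hM.measurable hA), ?_, ?_⟩
  · rw [← measure_congr h1, hT.measure_preimage hA.nullMeasurableSet]
  · apply setIntegral_congr_set
    rw [Function.iterate_succ', Set.preimage_comp]
    exact ((hT.iterate n).quasiMeasurePreserving).preimage_ae_eq h1

end Estimates

/-! ### The Banach space of bounded Hölder functions -/

section LSpace

variable {Z ι : Type*}

/-- The difference quotients of a function. -/
def quotients (T : Z → Z) (δ : ι → Set Z) (τ : ℝ) : (Z → ℂ) →ₗ[ℂ] (ℕ × Z × Z → ℂ) where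
  toFun f p := by
    classical
    exact if 1 ≤ p.1 ∧ Near T δ p.1 p.2.1 p.2.2 then (f p.2.1 - f p.2.2) / (τ : ℂ) ^ p.1 else 0
  map_add' f g := by
    ext p
    simp only [Pi.add_apply]
    split_ifs <;> ring
  map_smul' c f := by
    ext p
    simp only [Pi.smul_apply, smul_eq_mul, RingHom.id_apply]
    split_ifs <;> ring

/-- The bounded Hölder functions which are invariant under the retraction `p`, embedded in a
space of bounded functions via their values and their difference quotients. -/
def lSubmodule (T : Z → Z) (δ : ι → Set Z) (τ : ℝ) (p : Z → Z) :
    Submodule ℂ (lp (fun _ : Z => ℂ) ∞ × lp (fun _ : ℕ × Z × Z => ℂ) ∞) where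
  carrier := {F | (∀ x, F.1 (p x) = F.1 x) ∧ ∀ i, F.2 i = quotients T δ τ (fun x => F.1 x) i}
  add_mem' := by
    rintro F G ⟨h1, h2⟩ ⟨h3, h4⟩
    refine ⟨fun x => ?_, fun i => ?_⟩
    · simp [h1, h3]
    · have : (fun x => (F + G).1 x) = (fun x => F.1 x) + fun x => G.1 x := by ext; simp
      rw [this, map_add]
      simp [h2, h4]
  zero_mem' := by
    refine ⟨fun x => by simp, fun i => ?_⟩
    have : (fun x => (0 : lp (fun _ : Z => ℂ) ∞ × lp (fun _ : ℕ × Z × Z => ℂ) ∞).1 x) = 0 := by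
      ext; simp
    rw [this, map_zero]
    simp
  smul_mem' := by
    rintro c F ⟨h1, h2⟩
    refine ⟨fun x => ?_, fun i => ?_⟩
    · simp [h1]
    · have : (fun x => (c • F).1 x) = c • fun x => F.1 x := by ext; simp
      rw [this, map_smul]
      simp [h2]

/-- The Banach space of bounded Hölder functions which are invariant under `p`. -/
abbrev LSpace (T : Z → Z) (δ : ι → Set Z) (τ : ℝ) (p : Z → Z) : Type _ := lSubmodule T δ τ p

variable {T : Z → Z} {δ : ι → Set Z} {τ : ℝ} {p : Z → Z}

/-- Membership is a family of equalities between coordinates, each of them closed. `LSpace` thus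
inherits completeness, for the maximum of the sup norm and the best Hölder constant. -/
theorem isClosed_lSubmodule :
    IsClosed (lSubmodule T δ τ p : Set (lp (fun _ : Z => ℂ) ∞ × lp (fun _ : ℕ × Z × Z => ℂ) ∞)) := by
  have hc : ∀ {I : Type _} (i : I), Continuous fun f : lp (fun _ : I => ℂ) ∞ => f i := by
    intro I i
    have := (lp.uniformContinuous_coe (E := fun _ : I => ℂ) (p := ∞)).continuous
    exact (continuous_apply i).comp this
  have h1 : ∀ x : Z, Continuous fun F : lp (fun _ : Z => ℂ) ∞ × lp (fun _ : ℕ × Z × Z => ℂ) ∞ =>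
      F.1 x := fun x => (hc x).comp continuous_fst
  have h2 : ∀ i, Continuous fun F : lp (fun _ : Z => ℂ) ∞ × lp (fun _ : ℕ × Z × Z => ℂ) ∞ =>
      F.2 i := fun i => (hc i).comp continuous_snd
  have e : (lSubmodule T δ τ p : Set (lp (fun _ : Z => ℂ) ∞ × lp (fun _ : ℕ × Z × Z => ℂ) ∞)) =
      (⋂ x, {F | F.1 (p x) = F.1 x}) ∩ ⋂ i, {F | F.2 i = quotients T δ τ (fun x => F.1 x) i} := by
    ext F
    simp only [Set.mem_inter_iff, Set.mem_iInter]
    rfl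
  rw [e]
  refine IsClosed.inter ?_ ?_
  · exact isClosed_iInter fun x => isClosed_eq (h1 _) (h1 _)
  · refine isClosed_iInter fun i => isClosed_eq (h2 _) ?_
    simp only [quotients, LinearMap.coe_mk, AddHom.coe_mk]
    split_ifs
    · exact ((Continuous.sub (G := ℂ) (h1 _) (h1 _))).div_const (G₀ := ℂ) _
    · exact continuous_const

instance : CompleteSpace (LSpace T δ τ p) := isClosed_lSubmodule.completeSpace_coe

instance : CoeFun (LSpace T δ τ p) fun _ => Z → ℂ := ⟨fun F => F.1.1⟩

namespace LSpace

@[simp]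
theorem add_apply (F G : LSpace T δ τ p) (x : Z) : (F + G) x = F x + G x := rfl

@[simp]
theorem sub_apply (F G : LSpace T δ τ p) (x : Z) : (F - G) x = F x - G x := rfl

@[simp]
theorem smul_apply (c : ℂ) (F : LSpace T δ τ p) (x : Z) : (c • F) x = c * F x := rfl

theorem apply_retraction (F : LSpace T δ τ p) (x : Z) : F (p x) = F x := F.2.1 x

theorem norm_apply_le (F : LSpace T δ τ p) (x : Z) : ‖F x‖ ≤ ‖F‖ :=
  (lp.norm_apply_le_norm (by simp) F.1.1 x).trans (norm_fst_le F.1)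

theorem holder (hτ0 : 0 < τ) (F : LSpace T δ τ p) {n : ℕ} (hn : 1 ≤ n) {x y : Z}
    (h : Near T δ n x y) : ‖F x - F y‖ ≤ ‖F‖ * τ ^ n := by
  have h1 := (lp.norm_apply_le_norm (by simp) F.1.2 (n, x, y)).trans (norm_snd_le F.1)
  rw [F.2.2 (n, x, y)] at h1
  simp only [quotients, LinearMap.coe_mk, AddHom.coe_mk, hn, h, and_self, if_true] at h1
  rw [norm_div, norm_pow, Complex.norm_real, Real.norm_of_nonneg hτ0.le,
    div_le_iff₀ (pow_pos hτ0 n)] at h1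
  exact h1

theorem holderBound (hτ0 : 0 < τ) (F : LSpace T δ τ p) (s : Set Z) :
    HolderBound T δ τ ‖F‖ (F : Z → ℂ) s := fun _ hn _ _ _ _ h => F.holder hτ0 hn h

theorem ext {F G : LSpace T δ τ p} (h : ∀ x, F x = G x) : F = G := by
  have h1 : F.1.1 = G.1.1 := lp.ext (funext h)
  refine Subtype.ext (Prod.ext h1 (lp.ext (funext fun i => ?_)))
  rw [F.2.2 i, G.2.2 i, h1]

/-- Constructor for elements of `LSpace`. -/
theorem exists_of_bounds (hτ0 : 0 < τ) {f : Z → ℂ} {K : ℝ} (hp : ∀ x, f (p x) = f x)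
    (h1 : ∀ x, ‖f x‖ ≤ K) (h2 : HolderBound T δ τ K f Set.univ) (hK : 0 ≤ K) :
    ∃ F : LSpace T δ τ p, (∀ x, F x = f x) ∧ ‖F‖ ≤ K := by
  have hq : ∀ i, ‖quotients T δ τ f i‖ ≤ K := by
    rintro ⟨n, x, y⟩
    simp only [quotients, LinearMap.coe_mk, AddHom.coe_mk]
    split_ifs with h
    · rw [norm_div, norm_pow, Complex.norm_real, Real.norm_of_nonneg hτ0.le,
        div_le_iff₀ (pow_pos hτ0 n)]
      exact h2 n h.1 x trivial y trivial h.2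
    · simpa using hK
  let F1 : lp (fun _ : Z => ℂ) ∞ := ⟨f, memℓp_infty ⟨K, by rintro _ ⟨x, rfl⟩; exact h1 x⟩⟩
  let F2 : lp (fun _ : ℕ × Z × Z => ℂ) ∞ :=
    ⟨quotients T δ τ f, memℓp_infty ⟨K, by rintro _ ⟨x, rfl⟩; exact hq x⟩⟩
  refine ⟨⟨(F1, F2), hp, fun i => rfl⟩, fun x => rfl, ?_⟩
  exact max_le (lp.norm_le_of_forall_le hK h1) (lp.norm_le_of_forall_le hK hq)

end LSpace

end LSpace

/-! ### Canonical representatives of the classes in `𝓛_τ` -/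

section Versions

variable {Z ι : Type*} [MeasurableSpace Z] [Countable ι]
  {m : Measure Z} [IsFiniteMeasure m] {T : Z → Z} {δ : ι → Set Z} {τ : ℝ} {p : Z → Z}

/-- `p` is a retraction on the points all of whose cylinders have positive measure, which preserves
the itineraries as much as possible. -/
structure IsRetraction (m : Measure Z) (T : Z → Z) (δ : ι → Set Z) (p : Z → Z) : Prop where
  mem : ∀ x, p x ∈ core m T δ
  eq : ∀ x ∈ core m T δ, p x = x
  near : ∀ n x y, Near T δ n x y → Near T δ n (p x) (p y)

namespace LSpace

omit [IsFiniteMeasure m] in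
theorem measurable (hM : IsMarkovMap m T δ) (hτ0 : 0 < τ) (hτ1 : τ < 1) (F : LSpace T δ τ p) :
    Measurable (F : Z → ℂ) :=
  hM.measurable_of_holder hτ0 hτ1 fun _ => F.holderBound hτ0 _

theorem integrable (hM : IsMarkovMap m T δ) (hτ0 : 0 < τ) (hτ1 : τ < 1) (F : LSpace T δ τ p) :
    Integrable (F : Z → ℂ) m :=
  Integrable.of_bound (F.measurable hM hτ0 hτ1).aestronglyMeasurable ‖F‖
    (ae_of_all _ F.norm_apply_le)

-- Every cylinder around a core point has positive measure, so it meets the set where the functions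
-- agree; Hölder continuity carries the equality to that point and the retraction to all others.
omit [Countable ι] [IsFiniteMeasure m] in
theorem ext_ae (hτ0 : 0 < τ) (hτ1 : τ < 1)
    (hp : IsRetraction m T δ p) {F G : LSpace T δ τ p}
    (h : (F : Z → ℂ) =ᵐ[m] (G : Z → ℂ)) : F = G := by
  refine LSpace.ext fun x => ?_
  rw [← F.apply_retraction, ← G.apply_retraction]
  have hx := hp.mem x
  set y := p x
  have h1 : ∀ n : ℕ, 1 ≤ n → ‖F y - G y‖ ≤ (‖F‖ + ‖G‖) * τ ^ n := by
    intro n hn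
    obtain ⟨z, hz1, hz2⟩ : ∃ z ∈ cyl T δ n y, F z = G z := by
      by_contra hc
      push Not at hc
      exact hx n (measure_mono_null (fun z hz => hc z hz) h)
    have e : F y - G y = (F y - F z) - (G y - G z) := by rw [hz2]; ring
    rw [e, add_mul]
    exact (norm_sub_le _ _).trans (add_le_add (F.holder hτ0 hn hz1) (G.holder hτ0 hn hz1))
  have h2 : Tendsto (fun n : ℕ => (‖F‖ + ‖G‖) * τ ^ n) atTop (𝓝 ((‖F‖ + ‖G‖) * 0)) :=
    (tendsto_pow_atTop_nhds_zero_of_lt_one hτ0.le hτ1).const_mul _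
  rw [mul_zero] at h2
  have h3 := ge_of_tendsto h2 (eventually_atTop.2 ⟨1, h1⟩)
  exact sub_eq_zero.1 (norm_le_zero_iff.1 h3)

omit [Countable ι] [IsFiniteMeasure m] in
theorem memL (hτ0 : 0 < τ) (hτ1 : τ < 1) (F : LSpace T δ τ p) {f : Z → ℂ}
    (h : f =ᵐ[m] (F : Z → ℂ)) : MemL m T δ τ f :=
  ⟨F, h, ⟨‖F‖, F.norm_apply_le⟩, ((F.holderBound hτ0 _).holderConst_le hτ0 hτ1).trans_lt
    ENNReal.ofReal_lt_top⟩

end LSpace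

-- Composing a bounded Hölder version with `p` alters it on a null set only, and makes it invariant
-- under `p`.
omit [IsFiniteMeasure m] in
theorem MemL.exists_lSpace (hM : IsMarkovMap m T δ) (hτ0 : 0 < τ) (hτ1 : τ < 1)
    (hp : IsRetraction m T δ p) {f : Z → ℂ} (hf : MemL m T δ τ f) :
    ∃ F : LSpace T δ τ p, f =ᵐ[m] (F : Z → ℂ) := by
  obtain ⟨g, hfg, ⟨C, hC⟩, hg⟩ := hf
  have hg' := exists_holderBound hτ0 hτ1 hg
  set K := (holderConst T δ τ g Set.univ).toReal + 1
  have hpp : ∀ x, p (p x) = p x := fun x => hp.eq _ (hp.mem x)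
  have hmax : 0 ≤ max |C| K := (abs_nonneg C).trans (le_max_left _ _)
  obtain ⟨F, hF, -⟩ := LSpace.exists_of_bounds (T := T) (δ := δ) (τ := τ) (p := p)
    (f := fun x => g (p x)) (K := max |C| K) hτ0 (fun x => by simp only [hpp])
    (fun x => (hC _).trans ((le_abs_self C).trans (le_max_left _ _)))
    (fun n hn x _ y _ hxy => (hg' n hn _ trivial _ trivial (hp.near n x y hxy)).trans (by
      gcongr
      exact le_max_right _ _)) hmax
  refine ⟨F, ?_⟩
  filter_upwards [hfg, hM.ae_mem_core] with x h1 h2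
  rw [h1, hF, hp.eq x h2]

/-- A function whose averages on cylinders are regular coincides almost everywhere with a Hölder
function. -/
theorem exists_version (hM : IsMarkovMap m T δ) (hτ0 : 0 < τ) (hτ1 : τ < 1)
    (hp : IsRetraction m T δ p) {f : Z → ℂ} (hf : Integrable f m) {K : ℝ} (hK : 0 ≤ K)
    (h1 : ∀ (i : ι) (A : Set Z), MeasurableSet A → A ⊆ δ i →
      ‖∫ x in A, f x ∂m‖ ≤ K * m.real A)
    (h2 : ∀ (k : ℕ) (A B : Set Z), 1 ≤ k → MeasurableSet A → MeasurableSet B → m A ≠ 0 → m B ≠ 0 →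
      (∀ x ∈ A, ∀ y ∈ B, Near T δ k x y) →
      ‖(∫ x in A, f x ∂m) / (m.real A : ℂ) - (∫ x in B, f x ∂m) / (m.real B : ℂ)‖ ≤ K * τ ^ k) :
    ∃ F : LSpace T δ τ p, f =ᵐ[m] (F : Z → ℂ) ∧ ‖F‖ ≤ K := by
  have hpos : ∀ {s : Set Z}, m s ≠ 0 → 0 < m.real s := fun {s} hs =>
    ENNReal.toReal_pos hs (measure_ne_top _ _)
  -- At a core point the averages over shrinking cylinders form a Cauchy sequence by `h2`; the
  -- limit, composed with `p`, is the required version.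
  set avg : ℕ → Z → ℂ := fun n x =>
    (∫ y in cyl T δ n x, f y ∂m) / (m.real (cyl T δ n x) : ℂ) with havg
  have hτt : Tendsto (fun n : ℕ => K * τ ^ n) atTop (𝓝 0) := by
    have := (tendsto_pow_atTop_nhds_zero_of_lt_one hτ0.le hτ1).const_mul K
    rwa [mul_zero] at this
  have havg2 : ∀ x ∈ core m T δ, ∀ y ∈ core m T δ, ∀ n k l, 1 ≤ n → n ≤ k → n ≤ l →
      Near T δ n x y → ‖avg k x - avg l y‖ ≤ K * τ ^ n := by
    intro x hx y hy n k l hn hk hl hxy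
    refine h2 n _ _ hn (hM.measurableSet_cyl _ _) (hM.measurableSet_cyl _ _) (hx k) (hy l) ?_
    intro u hu v hv
    exact hM.near_trans (Near.mono hu hk).symm (hM.near_trans hxy (Near.mono hv hl))
  have hlim : ∀ x ∈ core m T δ, ∃ z, Tendsto (fun n => avg n x) atTop (𝓝 z) := by
    intro x hx
    apply cauchySeq_tendsto_of_complete
    -- The hypothesis `h2` says nothing at level `0`, so the first term of the bound is adjusted by
    -- hand.
    refine cauchySeq_of_le_tendsto_0' (fun n => if n = 0 then ‖avg 0 x - avg 1 x‖ + K * τ ^ 1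
      else K * τ ^ n) ?_ ?_
    · intro n k hnk
      rw [dist_eq_norm]
      by_cases hn : n = 0
      · subst hn
        simp only [if_true]
        by_cases hk : k = 0
        · subst hk
          simp only [sub_self, norm_zero]
          positivity
        · have := havg2 x hx x hx 1 1 k le_rfl le_rfl (by omega) (hM.near_refl _ _)
          calc _ = ‖(avg 0 x - avg 1 x) + (avg 1 x - avg k x)‖ := by congr 1; ring
            _ ≤ _ := (norm_add_le _ _).trans (by gcongr)
      · simp only [hn, if_false]
        exact havg2 x hx x hx n n k (by omega) le_rfl hnk (hM.near_refl _ _)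
    · refine hτt.congr' ?_
      filter_upwards [eventually_ge_atTop 1] with n hn
      rw [if_neg (by omega)]
  choose! g hg using hlim
  have hg1 : ∀ x ∈ core m T δ, ‖g x‖ ≤ K := by
    intro x hx
    refine le_of_tendsto (hg x hx).norm ?_
    filter_upwards [eventually_ge_atTop 1] with n hn
    obtain ⟨i, hi⟩ := hM.exists_mem x
    rw [norm_div, Complex.norm_real, Real.norm_of_nonneg measureReal_nonneg,
      div_le_iff₀ (hpos (hx n))]
    exact h1 i _ (hM.measurableSet_cyl _ _) ((cyl_anti hn x).trans (hM.cyl_one hi).subset)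
  have hg2 : ∀ x ∈ core m T δ, ∀ y ∈ core m T δ, ∀ n, 1 ≤ n → Near T δ n x y →
      ‖g x - g y‖ ≤ K * τ ^ n := by
    intro x hx y hy n hn hxy
    refine le_of_tendsto ((hg x hx).sub (hg y hy)).norm ?_
    filter_upwards [eventually_ge_atTop n] with k hk
    exact havg2 x hx y hy n k k hn hk hk hxy
  have hg3 : ∀ x ∈ core m T δ, ∀ n, 1 ≤ n → ‖g x - avg n x‖ ≤ K * τ ^ n := by
    intro x hx n hn
    refine le_of_tendsto ((hg x hx).sub_const _).norm ?_
    filter_upwards [eventually_ge_atTop n] with k hk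
    exact havg2 x hx x hx n k n hn hk le_rfl (hM.near_refl _ _)
  obtain ⟨F, hF, hFK⟩ := LSpace.exists_of_bounds (T := T) (δ := δ) (τ := τ) (p := p)
    (f := fun x => g (p x)) hτ0 (fun x => by simp only [hp.eq _ (hp.mem x)])
    (fun x => hg1 _ (hp.mem x))
    (fun n hn x _ y _ hxy => hg2 _ (hp.mem x) _ (hp.mem y) n hn (hp.near n x y hxy)) hK
  refine ⟨F, ?_, hFK⟩
  have hFi := F.integrable hM hτ0 hτ1
  refine hf.ae_eq_of_forall_setIntegral_eq _ _ hFi fun A hA _ => ?_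
  -- This replaces martingale convergence: on a piece of length `n`, the averages of `f` and `F`
  -- over its part in `A` are both within `K τ^n` of the same cylinder average, and summing over
  -- pieces controls the integral over any `A`.
  have hkey : ∀ n : ℕ, 1 ≤ n →
      ‖(∫ x in A, f x ∂m) - ∫ x in A, F x ∂m‖ ≤ 2 * (K * τ ^ n) * m.real A := by
    intro n hn
    have s1 := hM.hasSum_setIntegral_piece hf n hA
    have s2 := hM.hasSum_setIntegral_piece hFi n hA
    have s3 : HasSum (fun w => m.real (piece T δ n w ∩ A)) (m.real A) := by
      have := hM.hasSum_setIntegral_piece (f := fun _ => (1 : ℂ)) (integrable_const _) n hA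
      simp only [setIntegral_const, Complex.real_smul, mul_one] at this
      exact_mod_cast this
    have s4 := s1.sub s2
    rw [← s4.tsum_eq]
    refine tsum_of_norm_bounded (s3.mul_left (2 * (K * τ ^ n))) fun w => ?_
    by_cases h0 : m (piece T δ n w ∩ A) = 0
    · rw [setIntegral_measure_zero _ h0, setIntegral_measure_zero _ h0]
      simp only [sub_zero, norm_zero]
      positivity
    have hw0 : m (piece T δ n w) ≠ 0 := fun h => h0 (measure_mono_null Set.inter_subset_left h)
    obtain ⟨x, hx, hxc⟩ := hM.exists_mem_core hw0
    have hwc := hM.piece_eq_cyl hx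
    have b1 := h2 n _ _ hn ((hM.measurableSet_piece n w).inter hA) (hM.measurableSet_cyl n x) h0
      (hxc n) (by
        intro u hu v hv
        rw [← hwc] at hv
        exact near_of_mem_piece hu.1 hv)
    have b2 : ‖(∫ y in piece T δ n w ∩ A, F y ∂m) - m.real (piece T δ n w ∩ A) * avg n x‖ ≤
        K * τ ^ n * m.real (piece T δ n w ∩ A) := by
      have e : (∫ y in piece T δ n w ∩ A, F y ∂m) - m.real (piece T δ n w ∩ A) * avg n x =
          ∫ y in piece T δ n w ∩ A, (F y - avg n x) ∂m := by
        rw [integral_sub hFi.integrableOn (integrable_const _)]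
        simp
      rw [e]
      refine norm_setIntegral_le_of_norm_le_const_ae' (measure_lt_top _ _) ?_
      filter_upwards [hM.ae_mem_core] with y hy hyw
      have hxy := near_of_mem_piece hyw.1 hx
      rw [hF, hp.eq y hy]
      have := hg3 y hy n hn
      simp only [havg] at this ⊢
      rwa [hM.cyl_eq_of_near hxy] at this
    have hm' := hpos h0
    have hmc : (m.real (piece T δ n w ∩ A) : ℂ) ≠ 0 := by exact_mod_cast hm'.ne'
    have b3 : ‖(∫ y in piece T δ n w ∩ A, f y ∂m) - m.real (piece T δ n w ∩ A) * avg n x‖ ≤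
        K * τ ^ n * m.real (piece T δ n w ∩ A) := by
      have e : (∫ y in piece T δ n w ∩ A, f y ∂m) - m.real (piece T δ n w ∩ A) * avg n x =
          m.real (piece T δ n w ∩ A) * ((∫ y in piece T δ n w ∩ A, f y ∂m) /
            (m.real (piece T δ n w ∩ A) : ℂ) - avg n x) := by
        field_simp
      rw [e, norm_mul, Complex.norm_real, Real.norm_of_nonneg hm'.le, mul_comm]
      gcongr
    calc _ = ‖((∫ y in piece T δ n w ∩ A, f y ∂m) - m.real (piece T δ n w ∩ A) * avg n x) -
          ((∫ y in piece T δ n w ∩ A, F y ∂m) - m.real (piece T δ n w ∩ A) * avg n x)‖ := by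
          congr 1; ring
      _ ≤ _ := norm_sub_le _ _
      _ ≤ K * τ ^ n * m.real (piece T δ n w ∩ A) + K * τ ^ n * m.real (piece T δ n w ∩ A) :=
        add_le_add b3 b2
      _ = _ := by ring
  have hlim0 : Tendsto (fun n : ℕ => 2 * (K * τ ^ n) * m.real A) atTop (𝓝 0) := by
    have := (hτt.const_mul 2).mul_const (m.real A)
    simpa using this
  have h3 := ge_of_tendsto hlim0 (eventually_atTop.2 ⟨1, hkey⟩)
  exact sub_eq_zero.1 (norm_le_zero_iff.1 h3)

end Versions

/-! ### The transfer operators on the space of Hölder functions -/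

section Operators

variable {Z ι : Type*} [MeasurableSpace Z] [Countable ι]
  {m : Measure Z} [IsFiniteMeasure m] {T : Z → Z} {δ : ι → Set Z} {τ : ℝ} {p : Z → Z}
  {q : ℕ} {base : Set ι} {height : ι → ℕ} {floor : ι → ℕ → ι}

/-- An ergodic Markov map with the bounded tower big image property. -/
structure Setting (m : Measure Z) (T : Z → Z) (δ : ι → Set Z) (τ : ℝ) (p : Z → Z) (q : ℕ)
    (base : Set ι) (height : ι → ℕ) (floor : ι → ℕ → ι) : Prop where
  markov : IsMarkovMap m T δ
  ergodic : Ergodic T m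
  pos : 0 < τ
  lt_one : τ < 1
  retraction : IsRetraction m T δ p
  distortion : HolderDistortion m T δ τ
  tower : IsBoundedTower m T δ q base height floor
  bigImage : BigImage m T δ base

/-- The local suprema and Hölder constants of `f` are summable, with sum at most `N`, and they are
bounded by `N` on the elements which do not return to the basis. -/
def LocalBound (m : Measure Z) (T : Z → Z) (δ : ι → Set Z) (τ : ℝ) (base : Set ι) (f : Z → ℂ)
    (N : ℝ) : Prop :=
  ∃ s D : ι → ℝ, (∀ i, 0 ≤ s i) ∧ (∀ i, 0 ≤ D i) ∧ (∀ i, ∀ x ∈ δ i, ‖f x‖ ≤ s i) ∧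
    (∀ i, HolderBound T δ τ (D i) f (δ i)) ∧ (Summable fun i => m.real (δ i) * (s i + D i)) ∧
    ∑' i, m.real (δ i) * (s i + D i) ≤ N ∧
    ∀ i, ¬ Returns m T δ base i → s i ≤ N ∧ D i ≤ N

omit [MeasurableSpace Z] [Countable ι] in
theorem piece_one (w : Fin 1 → ι) : piece T δ 1 w = δ (w 0) := by
  ext x
  simp [piece]

omit [Countable ι] [IsFiniteMeasure m] in
theorem IsMarkovMap.exists_subset_of_near (hM : IsMarkovMap m T δ) {k : ℕ} (hk : 1 ≤ k)
    {A B : Set Z} (hA : m A ≠ 0) (hB : m B ≠ 0) (h : ∀ x ∈ A, ∀ y ∈ B, Near T δ k x y) :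
    ∃ i, A ⊆ δ i ∧ B ⊆ δ i := by
  obtain ⟨y₀, hy₀⟩ := nonempty_of_measure_ne_zero hB
  obtain ⟨z₀, hz₀⟩ := nonempty_of_measure_ne_zero hA
  obtain ⟨j, hj⟩ := hM.exists_mem y₀
  have hAj : A ⊆ δ j := by
    intro z hz
    obtain ⟨l, h1, h2⟩ := h z hz y₀ hy₀ 0 (by omega)
    rwa [hM.index_unique hj h2]
  refine ⟨j, hAj, ?_⟩
  intro z hz
  obtain ⟨l, h1, h2⟩ := h z₀ hz₀ z hz 0 (by omega)
  rwa [hM.index_unique (hAj hz₀) h1]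

omit [IsFiniteMeasure m] in
/-- Going down to the basis of the tower. -/
theorem IsBoundedTower.exists_descent (hM : IsMarkovMap m T δ)
    (hW : IsBoundedTower m T δ q base height floor) (hT : MeasurePreserving T m m) {a : ι}
    (ha : a ∈ base) (l : ℕ) : ∀ (_ : l < height a) (A : Set Z), MeasurableSet A →
    A ⊆ δ (floor a l) → ∃ E, MeasurableSet E ∧ E ⊆ basis δ base ∧ m E = m A ∧
      (∀ x ∈ E, T^[l] x ∈ A ∧ ∀ j < l, T^[j] x ∈ δ (floor a j)) ∧
      ∀ (f : Z → ℂ) (n : ℕ), ∫ x in T^[n + l] ⁻¹' A, f x ∂m = ∫ x in T^[n] ⁻¹' E, f x ∂m := by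
  induction l with
  | zero =>
    intro _ A hA hAa
    refine ⟨A, hA, ?_, rfl, fun x hx => ⟨hx, fun j hj => absurd hj (Nat.not_lt_zero _)⟩,
      fun f n => rfl⟩
    rw [hW.floor_zero a ha] at hAa
    exact hAa.trans (Set.subset_biUnion_of_mem (u := δ) ha)
  | succ l ih =>
    intro hl A hA hAa
    have h1 := fun f n => hW.setIntegral_climb hM hT ha hl hA hAa f n
    obtain ⟨E, hE1, hE2, hE3, hE4, hE5⟩ := ih (by omega) _ (h1 0 0).1 Set.inter_subset_left
    refine ⟨E, hE1, hE2, hE3.trans (h1 0 0).2.1, fun x hx => ⟨?_, fun j hj => ?_⟩, fun f n => ?_⟩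
    · rw [Function.iterate_succ_apply']
      exact (hE4 x hx).1.2
    · rcases Nat.lt_succ_iff_lt_or_eq.1 hj with hj | rfl
      · exact (hE4 x hx).2 j hj
      · exact (hE4 x hx).1.1
    · rw [← hE5, ← add_assoc, (h1 f (n + l)).2.2]

namespace Setting

variable [StandardBorelSpace Z] (hS : Setting m T δ τ p q base height floor)
include hS

/-- The transfer operator maps functions with a local bound to Hölder functions. -/
theorem exists_transfer_bound : ∃ C : ℝ, 0 ≤ C ∧ ∀ (f : Z → ℂ) (N : ℝ), Integrable f m →
    LocalBound m T δ τ base f N →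
    ∃ F : LSpace T δ τ p, transfer m T f =ᵐ[m] (F : Z → ℂ) ∧ ‖F‖ ≤ C * N := by
  have hM := hS.markov
  have hW := hS.tower
  have hT := hS.ergodic.toMeasurePreserving
  obtain ⟨K, hK0, hK⟩ := hW.exists_basis_estimate hM hT hS.pos hS.lt_one hS.distortion hS.bigImage
  have hpos : ∀ {s : Set Z}, m s ≠ 0 → 0 < m.real s := fun {s} hs =>
    ENNReal.toReal_pos hs (measure_ne_top _ _)
  have hτ0 := hS.pos
  -- `K` serves the basis, where `R` averages over all branches. The `2` serves the higher floors,
  -- where `R` merely transports `f` from the floor below; no summation helps there, hence the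
  -- separate bounds on non-returning elements.
  refine ⟨K + 2, by positivity, ?_⟩
  rintro f N hf ⟨s, D, hs0, hD0, hs, hD, hsum, htsum, hret⟩
  have hN0 : 0 ≤ N := (tsum_nonneg fun i =>
    mul_nonneg measureReal_nonneg (add_nonneg (hs0 i) (hD0 i))).trans htsum
  have hsum' : HasSum (fun w : Fin 1 → ι => m.real (piece T δ 1 w) *
      (s (w 0) + D (w 0))) (∑' i, m.real (δ i) * (s i + D i)) := by
    have e : (fun w : Fin 1 → ι => m.real (piece T δ 1 w) * (s (w 0) + D (w 0))) =
        (fun i => m.real (δ i) * (s i + D i)) ∘ (Equiv.funUnique (Fin 1) ι) := by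
      ext w
      simp [piece_one]
    rw [e, Equiv.hasSum_iff]
    exact hsum.hasSum
  have hbase := hK 0 f (fun w => s (w 0)) (fun w => D (w 0)) _ hf (fun w => hs0 _) (fun w => hD0 _)
    (fun w x hx => hs _ x (hx 0))
    (fun w k hk x hx y hy hxy => hD _ k hk x (hx 0) y (hy 0) (hxy.mono (by omega))) hsum'
  simp only [zero_add, Function.iterate_one] at hbase
  have hKN : K * ∑' i, m.real (δ i) * (s i + D i) ≤ (K + 2) * N := by
    calc _ ≤ K * N := by gcongr
      _ ≤ _ := by linarith
  have hN2 : 2 * N ≤ (K + 2) * N := by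
    have : 0 ≤ K * N := by positivity
    linarith
  refine exists_version hM hS.pos hS.lt_one hS.retraction (integrable_transfer f)
    (by positivity) ?_ ?_
  · intro i A hA hAi
    rw [setIntegral_transfer hT hf hA]
    obtain ⟨a, ha, l, hl, rfl⟩ := hW.exists_floor i
    cases l with
    | zero =>
      refine (hbase.1 A hA ?_).trans (by gcongr)
      rw [hW.floor_zero a ha] at hAi
      exact hAi.trans (Set.subset_biUnion_of_mem (u := δ) ha)
    | succ l =>
      obtain ⟨h1, h2, h3⟩ := hW.setIntegral_climb hM hT ha hl hA hAi f 0
      simp only [zero_add, Function.iterate_one, Function.iterate_zero, Set.preimage_id] at h3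
      rw [h3]
      have h4 := norm_setIntegral_le_mul (m := m) (f := f) (s := s (floor a l))
        (E := δ (floor a l) ∩ T ⁻¹' A) fun x hx => hs _ x hx.1
      rw [measureReal_def, h2, ← measureReal_def] at h4
      refine h4.trans ?_
      gcongr
      linarith [(hret _ (hW.not_returns hM ha hl)).1]
  · intro k A B hk hA hB hA0 hB0 hnear
    rw [setIntegral_transfer hT hf hA, setIntegral_transfer hT hf hB]
    obtain ⟨i, hAi, hBi⟩ := hM.exists_subset_of_near hk hA0 hB0 hnear
    obtain ⟨a, ha, l, hl, rfl⟩ := hW.exists_floor i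
    cases l with
    | zero =>
      rw [hW.floor_zero a ha] at hAi hBi
      have hb : δ a ⊆ basis δ base := Set.subset_biUnion_of_mem (u := δ) ha
      refine (hbase.2 k A B hk hA hB (hAi.trans hb) (hBi.trans hb) hA0 hB0 hnear).trans ?_
      gcongr
    | succ l =>
      obtain ⟨h1, h2, h3⟩ := hW.setIntegral_climb hM hT ha hl hA hAi f 0
      obtain ⟨h1', h2', h3'⟩ := hW.setIntegral_climb hM hT ha hl hB hBi f 0
      simp only [zero_add, Function.iterate_one, Function.iterate_zero, Set.preimage_id] at h3 h3'
      rw [h3, h3']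
      have hnear' : ∀ x ∈ A ∪ B, ∀ y ∈ A ∪ B, Near T δ k x y := by
        obtain ⟨a, ha⟩ := nonempty_of_measure_ne_zero hA0
        obtain ⟨b, hb⟩ := nonempty_of_measure_ne_zero hB0
        have hall : ∀ x ∈ A ∪ B, Near T δ k x b := by
          rintro x (hx | hx)
          · exact hnear x hx b hb
          · exact hM.near_trans (hnear a ha x hx).symm (hnear a ha b hb)
        exact fun x hx y hy => hM.near_trans (hall x hx) (hall y hy).symm
      have h4 := norm_average_sub_average_le (m := m) (f := f) (s := s (floor a l))
        (K := D (floor a l) * τ ^ k) (E := δ (floor a l) ∩ T ⁻¹' A)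
        (F := δ (floor a l) ∩ T ⁻¹' B) (hpos hA0) (hpos hB0)
        hf.integrableOn hf.integrableOn (fun x hx => hs _ x hx.1) (fun x hx => hs _ x hx.1) (by
          intro x hx y hy
          rw [← Set.inter_union_distrib_left, ← Set.preimage_union] at hx hy
          exact hD _ k hk x hx.1 y hy.1 (Near.mono
            (near_succ_of_mem hx.1 hy.1 (hnear' _ hx.2 _ hy.2)) (Nat.le_succ k)))
      rw [measureReal_def (s := _ ∩ T ⁻¹' A), measureReal_def (s := _ ∩ T ⁻¹' B), h2, h2',
        ← measureReal_def, ← measureReal_def, div_self (hpos hA0).ne', div_self (hpos hB0).ne'] at h4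
      have h5 := (hret _ (hW.not_returns hM ha hl)).2
      have h6 : 0 < τ ^ k := pow_pos hτ0 k
      simp only [sub_self, abs_zero, zero_mul, zero_add] at h4
      refine h4.trans ?_
      calc (1 + 1) * (D (floor a l) * τ ^ k) ≤ (1 + 1) * (N * τ ^ k) := by gcongr
        _ = 2 * N * τ ^ k := by ring
        _ ≤ (K + 2) * N * τ ^ k := by gcongr

omit [StandardBorelSpace Z] [Countable ι] [IsFiniteMeasure m] in
/-- Multiplying by a Hölder function preserves the local bounds. -/
theorem localBound_mul {φ : Z → ℂ} {N : ℝ} (hφ : LocalBound m T δ τ base φ N)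
    (F : LSpace T δ τ p) : LocalBound m T δ τ base (fun x => φ x * F x) (2 * N * ‖F‖) := by
  obtain ⟨s, D, hs0, hD0, hs, hD, hsum, htsum, hret⟩ := hφ
  have hF := norm_nonneg F
  have h1 : ∀ i, m.real (δ i) * (s i * ‖F‖ + (D i * ‖F‖ + s i * ‖F‖)) ≤
      2 * (m.real (δ i) * (s i + D i)) * ‖F‖ := by
    intro i
    have := mul_nonneg (mul_nonneg (measureReal_nonneg (μ := m) (s := δ i)) (hD0 i)) hF
    nlinarith
  have h2 : ∀ i, 0 ≤ m.real (δ i) * (s i * ‖F‖ + (D i * ‖F‖ + s i * ‖F‖)) := by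
    intro i
    have := hs0 i
    have := hD0 i
    positivity
  have h3 : Summable fun i => 2 * (m.real (δ i) * (s i + D i)) * ‖F‖ :=
    (hsum.mul_left 2).mul_right _
  have h4 := Summable.of_nonneg_of_le h2 h1 h3
  refine ⟨fun i => s i * ‖F‖, fun i => D i * ‖F‖ + s i * ‖F‖, fun i => ?_, fun i => ?_, ?_, ?_,
    h4, ?_, ?_⟩
  · exact mul_nonneg (hs0 i) hF
  · exact add_nonneg (mul_nonneg (hD0 i) hF) (mul_nonneg (hs0 i) hF)
  · intro i x hx
    rw [norm_mul]
    exact mul_le_mul (hs i x hx) (F.norm_apply_le x) (norm_nonneg _) (hs0 i)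
  · intro i n hn x hx y hy hxy
    have e : φ x * F x - φ y * F y = (φ x - φ y) * F x + φ y * (F x - F y) := by ring
    rw [e, add_mul]
    refine (norm_add_le _ _).trans ?_
    rw [norm_mul, norm_mul]
    have h5 := hD i n hn x hx y hy hxy
    have h6 := F.holder hS.pos hn hxy
    have h7 := hs i y hy
    have h8 := F.norm_apply_le x
    refine add_le_add ?_ ?_
    · calc _ ≤ (D i * τ ^ n) * ‖F‖ := mul_le_mul h5 h8 (norm_nonneg _) ((norm_nonneg _).trans h5)
        _ = _ := by ring
    · calc _ ≤ s i * (‖F‖ * τ ^ n) := mul_le_mul h7 h6 (norm_nonneg _) (hs0 i)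
        _ = _ := by ring
  · refine (h4.tsum_le_tsum h1 h3).trans ?_
    rw [tsum_mul_right, tsum_mul_left]
    gcongr
  · intro i hi
    have h5 := hret i hi
    have hN0 : 0 ≤ N := (hs0 i).trans h5.1
    have h6 : s i * ‖F‖ ≤ N * ‖F‖ := mul_le_mul_of_nonneg_right h5.1 hF
    have h7 : D i * ‖F‖ ≤ N * ‖F‖ := mul_le_mul_of_nonneg_right h5.2 hF
    have h8 : 0 ≤ N * ‖F‖ := mul_nonneg hN0 hF
    exact ⟨by linarith, by linarith⟩

/-- The operator `F ↦ R (φ F)` on the space of Hölder functions. -/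
theorem exists_operator : ∃ C : ℝ, 0 ≤ C ∧ ∀ (φ : Z → ℂ) (N : ℝ), Integrable φ m →
    LocalBound m T δ τ base φ N →
    ∃ S : LSpace T δ τ p →L[ℂ] LSpace T δ τ p,
      (∀ F : LSpace T δ τ p, transfer m T (fun x => φ x * F x) =ᵐ[m] (S F : Z → ℂ)) ∧
      ‖S‖ ≤ C * N := by
  obtain ⟨C, hC0, hC⟩ := hS.exists_transfer_bound
  refine ⟨2 * C, by positivity, fun φ N hφi hφ => ?_⟩
  have hT := hS.ergodic.toMeasurePreserving
  have hi : ∀ F : LSpace T δ τ p, Integrable (fun x => φ x * F x) m := fun F =>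
    hφi.mul_bdd (F.measurable hS.markov hS.pos hS.lt_one).aestronglyMeasurable
      (ae_of_all _ F.norm_apply_le)
  choose S hS1 hS2 using fun F : LSpace T δ τ p => hC _ _ (hi F) (hS.localBound_mul hφ F)
  have hext : ∀ {F G : LSpace T δ τ p}, (F : Z → ℂ) =ᵐ[m] (G : Z → ℂ) → F = G := fun h =>
    LSpace.ext_ae hS.pos hS.lt_one hS.retraction h
  let L : LSpace T δ τ p →ₗ[ℂ] LSpace T δ τ p :=
    { toFun := S
      map_add' := by
        intro F G
        apply hext
        have h1 := transfer_add hT (hi F) (hi G)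
        have e : (fun x => φ x * F x) + (fun x => φ x * G x) = fun x => φ x * (F + G) x := by
          ext x
          simp only [Pi.add_apply, LSpace.add_apply]
          ring
        rw [e] at h1
        filter_upwards [h1, hS1 (F + G), hS1 F, hS1 G] with x e1 e2 e3 e4
        rw [← e2, e1, LSpace.add_apply, ← e3, ← e4]
        rfl
      map_smul' := by
        intro c F
        apply hext
        have h1 := transfer_smul hT (hi F) c
        have e : (c • fun x => φ x * F x) = fun x => φ x * (c • F) x := by
          ext x
          simp only [Pi.smul_apply, LSpace.smul_apply, smul_eq_mul]
          ring
        rw [e] at h1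
        filter_upwards [h1, hS1 (c • F), hS1 F] with x e1 e2 e3
        rw [← e2, e1, RingHom.id_apply, LSpace.smul_apply, ← e3]
        rfl }
  have hL : ∀ F, ‖L F‖ ≤ 2 * C * N * ‖F‖ := fun F => (hS2 F).trans (by
    apply le_of_eq; ring)
  refine ⟨L.mkContinuous _ hL, fun F => hS1 F, ?_⟩
  refine L.mkContinuous_norm_le ?_ hL
  obtain ⟨s, D, hs0, hD0, -, -, -, htsum, -⟩ := hφ
  have hN0 : 0 ≤ N := (tsum_nonneg fun i =>
    mul_nonneg measureReal_nonneg (add_nonneg (hs0 i) (hD0 i))).trans htsum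
  positivity

/-- The Lasota-Yorke inequality. -/
theorem exists_lasotaYorke : ∃ C : ℝ, 0 ≤ C ∧ ∀ (n : ℕ) (F G : LSpace T δ τ p), q ≤ n →
    (∀ A, MeasurableSet A → ∫ x in A, G x ∂m = ∫ x in T^[n] ⁻¹' A, F x ∂m) →
    ‖G‖ ≤ C * (∫ x, ‖F x‖ ∂m + ‖F‖ * τ ^ (n - q)) := by
  have hM := hS.markov
  have hW := hS.tower
  have hT := hS.ergodic.toMeasurePreserving
  have hτ0 := hS.pos
  have hτ1 := hS.lt_one
  obtain ⟨K, hK0, hK⟩ := hW.exists_basis_estimate hM hT hS.pos hS.lt_one hS.distortion hS.bigImage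
  have hpos : ∀ {s : Set Z}, m s ≠ 0 → 0 < m.real s := fun {s} hs =>
    ENNReal.toReal_pos hs (measure_ne_top _ _)
  have hmZ : 0 ≤ m.real Set.univ := measureReal_nonneg
  refine ⟨K * (1 + 2 * m.real Set.univ), by positivity, fun n F G hqn hG => ?_⟩
  have hFi := F.integrable hM hτ0 hτ1 (m := m)
  have hF0 := norm_nonneg F
  set I := ∫ x, ‖F x‖ ∂m with hI
  have hI0 : 0 ≤ I := integral_nonneg fun x => norm_nonneg _
  set Q := K * (1 + 2 * m.real Set.univ) * (I + ‖F‖ * τ ^ (n - q)) with hQ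
  have hQ0 : 0 ≤ Q := by positivity
  -- On a piece of length `n' + 1`, `sup |F|` is at most the average of `|F|` plus its oscillation,
  -- and the weighted averages sum to the `L¹` norm. On a null piece the quotient is `0` by
  -- convention, so `‖F‖` is used; its weight is zero.
  have hbase := fun n' : ℕ => hK n' (F : Z → ℂ)
    (fun w => if m (piece T δ (n' + 1) w) = 0 then ‖F‖ else
      (∫ x in piece T δ (n' + 1) w, ‖F x‖ ∂m) / m.real (piece T δ (n' + 1) w) +
        ‖F‖ * τ ^ (n' + 1))
    (fun w => ‖F‖ * τ ^ (n' + 1)) (I + 2 * (‖F‖ * τ ^ (n' + 1) * m.real Set.univ)) hFi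
    (fun w => by
      split_ifs
      · exact hF0
      · have : 0 ≤ ∫ x in piece T δ (n' + 1) w, ‖F x‖ ∂m := integral_nonneg fun x => norm_nonneg _
        positivity)
    (fun w => by positivity)
    (fun w x hx => by
      split_ifs with h0
      · exact F.norm_apply_le x
      · have hm' := hpos h0
        rw [← sub_le_iff_le_add, le_div_iff₀ hm']
        have h1 : ∫ _ in piece T δ (n' + 1) w, (‖F x‖ - ‖F‖ * τ ^ (n' + 1)) ∂m ≤
            ∫ y in piece T δ (n' + 1) w, ‖F y‖ ∂m := by
          refine setIntegral_mono_on (integrable_const _) hFi.norm.integrableOn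
            (hM.measurableSet_piece _ _) fun y hy => ?_
          have h2 := F.holder hτ0 (Nat.le_add_left 1 n') (near_of_mem_piece hx hy)
          have h3 := norm_sub_norm_le (F x) (F y)
          linarith
        simpa [mul_comm] using h1)
    (fun w k hk x hx y hy hxy => by
      have := F.holder hτ0 (by omega) hxy
      rwa [pow_add, ← mul_assoc] at this)
    (by
      have s1 : HasSum (fun w => ∫ x in piece T δ (n' + 1) w, ‖F x‖ ∂m) I := by
        have h := hasSum_integral_iUnion (μ := m) (f := fun x => ‖F x‖)
          (s := fun w => piece T δ (n' + 1) w) (fun w => hM.measurableSet_piece _ w)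
          (hM.pairwise_disjoint_piece _) hFi.norm.integrableOn
        rwa [hM.iUnion_piece, setIntegral_univ] at h
      have s2 : HasSum (fun w => m.real (piece T δ (n' + 1) w)) (m.real Set.univ) := by
        have h := hasSum_integral_iUnion (μ := m) (f := fun x => (1 : ℝ))
          (s := fun w => piece T δ (n' + 1) w) (fun w => hM.measurableSet_piece _ w)
          (hM.pairwise_disjoint_piece _) (integrable_const _).integrableOn
        rw [hM.iUnion_piece, setIntegral_univ] at h
        simpa using h
      refine (s1.add ((s2.mul_left (‖F‖ * τ ^ (n' + 1))).mul_left 2)).congr_fun ?_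
      intro w
      by_cases h0 : m (piece T δ (n' + 1) w) = 0
      · simp [h0, measureReal_def, setIntegral_measure_zero _ h0]
      · have hm' := (hpos h0).ne'
        simp only [h0, if_false]
        field_simp
        ring)
  have hbound : ∀ n' : ℕ, n - q ≤ n' + 1 →
      K * (I + 2 * (‖F‖ * τ ^ (n' + 1) * m.real Set.univ)) ≤ Q := by
    intro n' hn'
    have h1 : τ ^ (n' + 1) ≤ τ ^ (n - q) := pow_le_pow_of_le_one hτ0.le hτ1.le hn'
    rw [hQ, mul_assoc K]
    refine mul_le_mul_of_nonneg_left ?_ hK0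
    have h2 : ‖F‖ * τ ^ (n' + 1) ≤ ‖F‖ * τ ^ (n - q) := by gcongr
    have h3 : 0 ≤ ‖F‖ * τ ^ (n - q) := by positivity
    nlinarith [mul_nonneg hmZ hI0, mul_le_mul_of_nonneg_right h2 hmZ]
  obtain ⟨F', h1, h2⟩ := exists_version hM hτ0 hτ1 hS.retraction
    (G.integrable hM hτ0 hτ1) (K := Q) hQ0 (by
      intro i A hA hAi
      obtain ⟨a, ha, l, hl, rfl⟩ := hW.exists_floor i
      have hlq : l < q := hl.trans_le (hW.height_le a ha)
      obtain ⟨E, hE1, hE2, hE3, -, hE5⟩ := hW.exists_descent hM hT ha l hl A hA hAi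
      -- Descending `l < q` floors leaves `n' + 1 ≥ n - q` iterations towards the basis, which
      -- explains the exponent; `q ≤ n` ensures that at least one remains.
      obtain ⟨n', rfl⟩ : ∃ n', n = n' + 1 + l := ⟨n - l - 1, by omega⟩
      rw [hG A hA, hE5]
      refine ((hbase n').1 E hE1 hE2).trans ?_
      rw [measureReal_def (s := E), hE3, ← measureReal_def]
      exact mul_le_mul_of_nonneg_right (hbound n' (by omega)) measureReal_nonneg) (by
      intro k A B hk hA hB hA0 hB0 hnear
      obtain ⟨i, hAi, hBi⟩ := hM.exists_subset_of_near hk hA0 hB0 hnear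
      obtain ⟨a, ha, l, hl, rfl⟩ := hW.exists_floor i
      have hlq : l < q := hl.trans_le (hW.height_le a ha)
      obtain ⟨E, hE1, hE2, hE3, hE4, hE5⟩ := hW.exists_descent hM hT ha l hl A hA hAi
      obtain ⟨E', hE1', hE2', hE3', hE4', hE5'⟩ := hW.exists_descent hM hT ha l hl B hB hBi
      obtain ⟨n', rfl⟩ : ∃ n', n = n' + 1 + l := ⟨n - l - 1, by omega⟩
      rw [hG A hA, hG B hB, hE5, hE5']
      have h3 := (hbase n').2 k E E' hk hE1 hE1' hE2 hE2' (by rwa [hE3]) (by rwa [hE3'])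
        (fun x hx y hy => Near.mono (near_add
          (fun j hj => ⟨_, (hE4 x hx).2 j hj, (hE4' y hy).2 j hj⟩)
          (hnear _ (hE4 x hx).1 _ (hE4' y hy).1)) (Nat.le_add_left k l))
      rw [measureReal_def (s := E), measureReal_def (s := E'), hE3, hE3', ← measureReal_def,
        ← measureReal_def] at h3
      refine h3.trans ?_
      exact mul_le_mul_of_nonneg_right (hbound n' (by omega)) (pow_pos hτ0 k).le)
  rw [LSpace.ext_ae hτ0 hτ1 hS.retraction h1]
  exact h2

end Setting

end Operators

/-! ### Perturbation of a simple eigenvalue -/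

section Perturbation

variable {X : Type*} [NormedAddCommGroup X] [NormedSpace ℂ X] [CompleteSpace X]

/-- If `S` is power bounded and has no approximate eigenvector for the eigenvalue `1`, then `1 - S`
is invertible. -/
theorem isUnit_one_sub_of_bounded_below {S : X →L[ℂ] X} {C : ℝ} (hC : ∀ n : ℕ, ‖S ^ n‖ ≤ C)
    {ε : ℝ} (hε : 0 < ε) (h : ∀ v, ε * ‖v‖ ≤ ‖v - S v‖) : IsUnit (1 - S) := by
  rcases subsingleton_or_nontrivial X with hX | hX
  · have : Subsingleton (X →L[ℂ] X) := inferInstance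
    exact isUnit_of_subsingleton _
  -- Power boundedness makes a power of `zS` a strict contraction, and `1 - zS` is a factor of the
  -- invertible `1 - (zS)^N`, with a commuting cofactor.
  have hunit : ∀ z : ℝ, 0 ≤ z → z < 1 → IsUnit (1 - (z : ℂ) • S) := by
    intro z hz0 hz1
    have hC0 : 0 ≤ C := (norm_nonneg _).trans (hC 0)
    obtain ⟨N, hN⟩ := exists_pow_lt_of_lt_one (show (0 : ℝ) < 1 / (C + 1) by positivity) hz1
    have h1 : ‖((z : ℂ) • S) ^ N‖ < 1 := by
      rw [smul_pow, norm_smul, norm_pow, Complex.norm_real, Real.norm_of_nonneg hz0]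
      calc z ^ N * ‖S ^ N‖ ≤ z ^ N * (C + 1) := by
            gcongr
            exact (hC N).trans (by linarith)
        _ < 1 / (C + 1) * (C + 1) := by gcongr
        _ = 1 := by field_simp
    have h2 : IsUnit (1 - ((z : ℂ) • S) ^ N) := isUnit_one_sub_of_norm_lt_one h1
    rw [← mul_neg_geom_sum] at h2
    have hcomm : Commute (1 - (z : ℂ) • S) (∑ i ∈ Finset.range N, ((z : ℂ) • S) ^ i) := by
      refine Commute.sum_right _ _ _ fun i _ => ?_
      exact ((Commute.one_left _).sub_left (Commute.refl _)).pow_right i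
    exact (hcomm.isUnit_mul_iff.1 h2).1
  -- With `z` this close to `1`, `(1 - z) ‖S‖ ≤ ε / 4`. Then `1 - zS` is still bounded below by `ε /
  -- 2`, its inverse has norm at most `2 / ε`, and `1 - S` lies in the ball of invertible operators
  -- around it.
  set η := ε / (4 * (‖S‖ + 1)) with hη
  have hSn := norm_nonneg S
  have hη0 : 0 < η := by positivity
  have hηS : η * ‖S‖ ≤ ε / 4 := by
    rw [hη, div_mul_eq_mul_div, div_le_div_iff₀ (by positivity) (by positivity)]
    nlinarith
  set z : ℝ := 1 - min η (1 / 2) with hz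
  have hmin : min η (1 / 2) ≤ η := min_le_left _ _
  have hmin' : min η (1 / 2) ≤ 1 / 2 := min_le_right _ _
  have hmin0 : 0 < min η (1 / 2) := lt_min hη0 (by norm_num)
  obtain ⟨u, hu⟩ := hunit z (by linarith) (by linarith)
  have hzS : ‖((1 - z : ℝ) : ℂ) • S‖ ≤ ε / 4 := by
    rw [norm_smul, Complex.norm_real, Real.norm_of_nonneg (by linarith)]
    calc (1 - z) * ‖S‖ ≤ η * ‖S‖ := by
          gcongr
          linarith
      _ ≤ _ := hηS
  have hlow : ∀ v, ε / 2 * ‖v‖ ≤ ‖(u : X →L[ℂ] X) v‖ := by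
    intro v
    have e : (u : X →L[ℂ] X) v = (v - S v) + (((1 - z : ℝ) : ℂ) • S) v := by
      rw [hu]
      simp only [sub_apply, one_apply_eq_self, smul_apply, Complex.ofReal_sub, Complex.ofReal_one,
        sub_smul, one_smul]
      abel
    have h1 := (((1 - z : ℝ) : ℂ) • S).le_of_opNorm_le hzS v
    have h2 := norm_sub_le_norm_add (v - S v) ((((1 - z : ℝ) : ℂ) • S) v)
    rw [e]
    have := h v
    have := norm_nonneg v
    nlinarith
  have hinv : ‖((u⁻¹ : (X →L[ℂ] X)ˣ) : X →L[ℂ] X)‖ ≤ 2 / ε := by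
    refine ContinuousLinearMap.opNorm_le_bound _ (by positivity) fun w => ?_
    have h1 := hlow (((u⁻¹ : (X →L[ℂ] X)ˣ) : X →L[ℂ] X) w)
    have h2 : (u : X →L[ℂ] X) (((u⁻¹ : (X →L[ℂ] X)ˣ) : X →L[ℂ] X) w) = w := by
      rw [← mul_apply_eq_comp, Units.mul_inv]
      rfl
    rw [h2] at h1
    rw [div_mul_eq_mul_div, le_div_iff₀ hε]
    linarith
  have hnt : 0 < ‖((u⁻¹ : (X →L[ℂ] X)ˣ) : X →L[ℂ] X)‖ := Units.norm_pos _
  have hlt : ‖-(((1 - z : ℝ) : ℂ) • S)‖ < ‖((u⁻¹ : (X →L[ℂ] X)ˣ) : X →L[ℂ] X)‖⁻¹ := by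
    rw [norm_neg]
    calc _ ≤ ε / 4 := hzS
      _ < ε / 2 := by linarith
      _ = (2 / ε)⁻¹ := (inv_div 2 ε).symm
      _ ≤ _ := inv_anti₀ hnt hinv
  refine ⟨u.add _ hlt, ?_⟩
  rw [Units.val_add, hu]
  ext v
  simp only [add_apply, neg_apply, sub_apply, one_apply_eq_self, smul_apply, Complex.ofReal_sub,
    Complex.ofReal_one, sub_smul, one_smul]
  abel

/-- Bordering takes the place of spectral projections. Put `P = φ(·) e` and `Y t z = z - R_t + P`,
invertible for `(t, z)` near `(0, 1)`. The equation `R_t ξ = z ξ` reads `Y t z ξ = φ(ξ) e`, so `z`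
is an eigenvalue exactly when `φ ((Y t z)⁻¹ e) = 1`, with eigenvector `(Y t z)⁻¹ e`. At `(0, 1)` the
`z`-derivative of the left side is `-1`, which gives a single root near `1`. -/
theorem exists_perturbed_eigenvalue {R : X →L[ℂ] X} {e : X} {φ : X →L[ℂ] ℂ} (hφe : φ e = 1)
    (hRe : R e = e) (hφR : ∀ x, φ (R x) = φ x) (hA : IsUnit (1 - R + φ.smulRight e))
    {Rt : ℝ → X →L[ℂ] X} (hRt : (fun t => Rt t - R) =O[𝓝 0] fun t : ℝ => t)
    {a b : X} (hab : a - R a = b) (ha : φ a = 0)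
    (hb : (fun t : ℝ => Rt t e - e - (t : ℂ) • b) =o[𝓝 0] fun t : ℝ => t) :
    ∃ (lam : ℝ → ℂ) (v : ℝ → X) (r : ℝ), 0 < r ∧
      (∀ᶠ t in 𝓝 (0 : ℝ), φ (v t) = 0 ∧ Rt t (e + v t) = lam t • (e + v t) ∧
        ∀ z : ℂ, ‖z - 1‖ < r → ∀ ξ : X, ξ ≠ 0 → Rt t ξ = z • ξ → z = lam t) ∧
      (fun t : ℝ => v t - (t : ℂ) • a) =o[𝓝 0] fun t : ℝ => t := by
  set P : X →L[ℂ] X := φ.smulRight e with hP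
  have hPx : ∀ x, P x = φ x • e := fun x => rfl
  obtain ⟨u, hu⟩ := hA
  set A : X →L[ℂ] X := 1 - R + P with hAdef
  set B : X →L[ℂ] X := ((u⁻¹ : (X →L[ℂ] X)ˣ) : X →L[ℂ] X) with hB
  have hBA : ∀ x, B (A x) = x := fun x => by
    rw [← hu, ← mul_apply_eq_comp, Units.inv_mul]
    rfl
  have hAx : ∀ x, A x = x - R x + φ x • e := fun x => rfl
  have hAe : A e = e := by rw [hAx, hRe, hφe]; simp
  have hBe : B e = e := by rw [← hAe, hBA, hAe]
  have hAa : B b = a := by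
    have : A a = b := by rw [hAx, ha, hab]; simp
    rw [← this, hBA]
  have hcont : ContinuousAt Ring.inverse A := hu ▸ NormedRing.inverse_continuousAt u
  have hinvA : Ring.inverse A = B := by rw [← hu, Ring.inverse_unit]
  -- The bound on pairs `(Y, Y')` controls, through the resolvent identity, the difference quotients
  -- of `z ↦ φ ((Y t z)⁻¹ e)`, so no differentiation is needed.
  obtain ⟨ρ, hρ0, hρ⟩ : ∃ ρ > 0, ∀ Y ∈ Metric.ball A ρ, ∀ Y' ∈ Metric.ball A ρ,
      IsUnit Y ∧ ‖Ring.inverse Y‖ ≤ ‖B‖ + 1 ∧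
      ‖φ (Ring.inverse Y (Ring.inverse Y' e)) - 1‖ < 1 / 2 := by
    have h1 : ∀ᶠ Y in 𝓝 A, IsUnit Y := hu ▸ Units.nhds u
    have h2 : ∀ᶠ Y in 𝓝 A, ‖Ring.inverse Y‖ < ‖B‖ + 1 :=
      hcont.norm.eventually_lt_const (by simp only [hinvA]; linarith)
    have h3 : ∀ᶠ p : (X →L[ℂ] X) × (X →L[ℂ] X) in 𝓝 (A, A),
        ‖φ (Ring.inverse p.1 (Ring.inverse p.2 e)) - 1‖ < 1 / 2 := by
      have c1 : ContinuousAt (fun p : (X →L[ℂ] X) × (X →L[ℂ] X) => Ring.inverse p.1) (A, A) :=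
        ContinuousAt.comp (x := (A, A)) (f := Prod.fst) hcont continuousAt_fst
      have c2 : ContinuousAt (fun p : (X →L[ℂ] X) × (X →L[ℂ] X) => Ring.inverse p.2) (A, A) :=
        ContinuousAt.comp (x := (A, A)) (f := Prod.snd) hcont continuousAt_snd
      have c3 : ContinuousAt (fun p : (X →L[ℂ] X) × (X →L[ℂ] X) =>
          φ (Ring.inverse p.1 (Ring.inverse p.2 e)) - 1) (A, A) :=
        (φ.continuous.continuousAt.comp (c1.clm_apply (c2.clm_apply continuousAt_const))).sub
          continuousAt_const
      refine c3.norm.eventually_lt_const ?_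
      simp only [hinvA, hBe, hφe, sub_self, norm_zero]
      norm_num
    obtain ⟨ρ₁, hρ₁, h4⟩ := Metric.eventually_nhds_iff_ball.1 (h1.and h2)
    obtain ⟨ρ₂, hρ₂, h5⟩ := Metric.eventually_nhds_iff_ball.1 h3
    refine ⟨min ρ₁ ρ₂, lt_min hρ₁ hρ₂, fun Y hY Y' hY' => ?_⟩
    have h6 := h4 Y (Metric.ball_subset_ball (min_le_left _ _) hY)
    refine ⟨h6.1, h6.2.le, h5 (Y, Y') ?_⟩
    rw [← ball_prod_same]
    exact ⟨Metric.ball_subset_ball (min_le_right _ _) hY,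
      Metric.ball_subset_ball (min_le_right _ _) hY'⟩
  set Y : ℝ → ℂ → (X →L[ℂ] X) := fun t z => z • 1 - Rt t + P with hY
  have hYx : ∀ t z x, Y t z x = z • x - Rt t x + φ x • e := fun t z x => rfl
  have hRt0 : Tendsto (fun t => Rt t - R) (𝓝 0) (𝓝 0) :=
    hRt.trans_tendsto tendsto_id
  have hball : ∀ᶠ t in 𝓝 (0 : ℝ), ∀ z : ℂ, ‖z - 1‖ ≤ ρ / 4 → Y t z ∈ Metric.ball A ρ := by
    have h1 : ∀ᶠ t in 𝓝 (0 : ℝ), ‖Rt t - R‖ < ρ / 4 := by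
      have := hRt0.norm
      rw [norm_zero] at this
      exact this.eventually_lt_const (by positivity)
    filter_upwards [h1] with t ht z hz
    rw [mem_ball_iff_norm]
    have e1 : Y t z - A = (z - 1) • (1 : X →L[ℂ] X) - (Rt t - R) := by
      simp only [hY, hAdef, sub_smul, one_smul]
      abel
    rw [e1]
    calc _ ≤ ‖(z - 1) • (1 : X →L[ℂ] X)‖ + ‖Rt t - R‖ := norm_sub_le _ _
      _ ≤ ‖z - 1‖ * 1 + ‖Rt t - R‖ := by
        rw [norm_smul]
        gcongr
        exact ContinuousLinearMap.norm_id_le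
      _ < ρ := by linarith
  set F : ℝ → ℂ → ℂ := fun t z => φ (Ring.inverse (Y t z) e) with hF
  have hF1 : Tendsto (fun t => F t 1) (𝓝 0) (𝓝 1) := by
    have e1 : Tendsto (fun t => Y t 1) (𝓝 0) (𝓝 A) := by
      have : (fun t => Y t 1) = fun t => A - (Rt t - R) := by
        ext t
        simp only [hY, hAdef, one_smul]
        abel_nf
      rw [this]
      simpa using tendsto_const_nhds.sub hRt0
    have e2 : Tendsto (fun t => Ring.inverse (Y t 1)) (𝓝 0) (𝓝 B) := by
      have := hcont.tendsto.comp e1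
      rwa [hinvA] at this
    have e3 : Tendsto (fun t => F t 1) (𝓝 0) (𝓝 (φ (B e))) := (φ.continuous.tendsto (B e)).comp
      (((ContinuousLinearMap.apply ℂ X e).continuous.tendsto B).comp e2)
    rwa [hBe, hφe] at e3
  -- The map `z ↦ z + F t z - 1` will contract by `1/2`; it preserves the ball of radius `ρ / 4`
  -- because `ρ / 8 + ρ / 8 = ρ / 4`.
  have hF1' : ∀ᶠ t in 𝓝 (0 : ℝ), ‖F t 1 - 1‖ < ρ / 8 := by
    have := (hF1.sub_const 1).norm
    rw [sub_self, norm_zero] at this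
    exact this.eventually_lt_const (by positivity)
  have hexists : ∀ᶠ t in 𝓝 (0 : ℝ), ∃ l : ℂ, ‖l - 1‖ ≤ ρ / 4 ∧ F t l = 1 ∧
      ∀ z, ‖z - 1‖ ≤ ρ / 4 → F t z = 1 → z = l := by
    filter_upwards [hball, hF1'] with t ht ht1
    have hdiff : ∀ z z' : ℂ, ‖z - 1‖ ≤ ρ / 4 → ‖z' - 1‖ ≤ ρ / 4 →
        ‖(z + F t z - 1) - (z' + F t z' - 1)‖ ≤ 1 / 2 * ‖z - z'‖ := by
      intro z z' hz hz'
      obtain ⟨u1, -, u3⟩ := hρ _ (ht z hz) _ (ht z' hz')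
      obtain ⟨u1', -⟩ := hρ _ (ht z' hz') _ (ht z' hz')
      have e1 : Ring.inverse (Y t z) - Ring.inverse (Y t z') =
          Ring.inverse (Y t z) * (Y t z' - Y t z) * Ring.inverse (Y t z') := by
        rw [mul_sub, sub_mul, Ring.inverse_mul_cancel _ u1, mul_assoc,
          Ring.mul_inverse_cancel _ u1', one_mul, mul_one]
      have e2 : Y t z' - Y t z = (z' - z) • 1 := by
        simp only [hY, sub_smul]
        abel
      have e3 : F t z - F t z' =
          (z' - z) * φ (Ring.inverse (Y t z) (Ring.inverse (Y t z') e)) := by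
        have := congrArg (fun L : X →L[ℂ] X => φ (L e)) e1
        rw [e2] at this
        simpa [hF] using this
      have e4 : (z + F t z - 1) - (z' + F t z' - 1) =
          -((z - z') * (φ (Ring.inverse (Y t z) (Ring.inverse (Y t z') e)) - 1)) := by
        linear_combination e3
      rw [e4, norm_neg, norm_mul, mul_comm]
      gcongr
    have hmaps : Set.MapsTo (fun z => z + F t z - 1) (Metric.closedBall (1 : ℂ) (ρ / 4))
        (Metric.closedBall (1 : ℂ) (ρ / 4)) := by
      intro z hz
      rw [mem_closedBall_iff_norm] at hz ⊢
      have h1 := hdiff z 1 hz (by simp; positivity)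
      have h2 : z + F t z - 1 - 1 = ((z + F t z - 1) - (1 + F t 1 - 1)) + (F t 1 - 1) := by ring
      rw [h2]
      refine (norm_add_le _ _).trans ?_
      linarith
    have hcontr : ContractingWith (1 / 2) (hmaps.restrict _ _ _) := by
      refine ⟨by rw [← NNReal.coe_lt_coe]; norm_num, LipschitzWith.of_dist_le_mul fun x y => ?_⟩
      have := hdiff x y (mem_closedBall_iff_norm.1 x.2) (mem_closedBall_iff_norm.1 y.2)
      rw [Subtype.dist_eq, Subtype.dist_eq, dist_eq_norm, dist_eq_norm]
      simpa using this
    obtain ⟨l, hl1, hl2, -⟩ := hcontr.exists_fixedPoint' Metric.isClosed_closedBall.isComplete hmaps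
      (x := 1) (Metric.mem_closedBall_self (by positivity)) (edist_ne_top _ _)
    have hl3 : F t l = 1 := by
      have : l + F t l - 1 = l := hl2
      linear_combination this
    refine ⟨l, mem_closedBall_iff_norm.1 hl1, hl3, fun z hz hFz => ?_⟩
    have h1 := hdiff z l hz (mem_closedBall_iff_norm.1 hl1)
    rw [hFz, hl3] at h1
    have h2 : z + 1 - 1 - (l + 1 - 1) = z - l := by ring
    rw [h2] at h1
    have h3 : ‖z - l‖ ≤ 0 := by linarith
    exact sub_eq_zero.1 (norm_le_zero_iff.1 h3)
  obtain ⟨lam, hlam⟩ := hexists.choice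
  set ξ : ℝ → X := fun t => Ring.inverse (Y t (lam t)) e with hξ
  have hmain : ∀ᶠ t in 𝓝 (0 : ℝ), φ (ξ t) = 1 ∧ Rt t (ξ t) = lam t • ξ t ∧
      ‖ξ t‖ ≤ (‖B‖ + 1) * ‖e‖ := by
    filter_upwards [hball, hlam] with t ht ⟨h1, h2, h3⟩
    obtain ⟨u1, u2, -⟩ := hρ _ (ht _ h1) _ (ht _ h1)
    refine ⟨h2, ?_, ContinuousLinearMap.le_of_opNorm_le _ u2 _⟩
    have e1 : Y t (lam t) (ξ t) = e := by
      have := congrArg (fun L : X →L[ℂ] X => L e) (Ring.mul_inverse_cancel _ u1)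
      exact this
    rw [hYx, show φ (ξ t) = 1 from h2, one_smul] at e1
    exact (sub_eq_zero.1 (by simpa using e1)).symm
  refine ⟨lam, fun t => ξ t - e, ρ / 4, by positivity, ?_, ?_⟩
  · filter_upwards [hball, hlam, hmain] with t ht ⟨h1, h2, h3⟩ ⟨h4, h5, _⟩
    refine ⟨by rw [map_sub, h4, hφe, sub_self], by simpa using h5, fun z hz x hx hRx => ?_⟩
    obtain ⟨u1, -⟩ := hρ _ (ht z hz.le) _ (ht z hz.le)
    have e1 : Y t z x = φ x • e := by rw [hYx, hRx]; simp
    have e2 : x = φ x • Ring.inverse (Y t z) e := by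
      have := congrArg (fun L : X →L[ℂ] X => L x) (Ring.inverse_mul_cancel _ u1)
      simp only [mul_apply_eq_comp, e1, map_smul] at this
      exact this.symm
    have e3 : φ x ≠ 0 := by
      intro h0
      rw [h0, zero_smul] at e2
      exact hx e2
    refine h3 z hz.le ?_
    have e4 := congrArg φ e2
    rw [map_smul, smul_eq_mul] at e4
    have : φ x * F t z = φ x * 1 := by rw [mul_one]; exact e4.symm
    exact mul_left_cancel₀ e3 this
  · have hξO : ξ =O[𝓝 0] fun _ : ℝ => (1 : ℝ) := by
      refine IsBigO.of_bound ((‖B‖ + 1) * ‖e‖) ?_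
      filter_upwards [hmain] with t ht
      simpa using ht.2.2
    have hDξ : (fun t => (Rt t - R) (ξ t)) =O[𝓝 0] fun t : ℝ => t := by
      have h1 : (fun t => (Rt t - R) (ξ t)) =O[𝓝 0] fun t => ‖Rt t - R‖ * ‖ξ t‖ :=
        IsBigO.of_bound 1 (Eventually.of_forall fun t => by
          rw [one_mul, Real.norm_of_nonneg (by positivity)]
          exact (Rt t - R).le_opNorm _)
      simpa using h1.trans (hRt.norm_left.mul hξO.norm_left)
    -- Apply `φ` to the eigenvalue equation, with `φ ∘ R = φ` and `φ (ξ t) = 1`.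
    have hlamξ : (fun t => lam t - 1) =ᶠ[𝓝 0] fun t => φ ((Rt t - R) (ξ t)) := by
      filter_upwards [hmain] with t ⟨h1, h2, _⟩
      rw [sub_apply, map_sub, h2, hφR, map_smul, h1, smul_eq_mul, mul_one]
    have hlamO : (fun t => lam t - 1) =O[𝓝 0] fun t : ℝ => t :=
      hlamξ.trans_isBigO ((φ.isBigO_comp _ _).trans hDξ)
    have hv : (fun t => ξ t - e) =ᶠ[𝓝 0]
        fun t => B ((Rt t - R) (ξ t) - (lam t - 1) • ξ t) := by
      filter_upwards [hmain] with t ⟨h1, h2, _⟩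
      have : A (ξ t - e) = (Rt t - R) (ξ t) - (lam t - 1) • ξ t := by
        rw [map_sub, hAe, hAx, h1, sub_apply, h2, sub_smul, one_smul, one_smul]
        abel
      rw [← this, hBA]
    have hvO : (fun t => ξ t - e) =O[𝓝 0] fun t : ℝ => t := by
      refine hv.trans_isBigO ((B.isBigO_comp _ _).trans (hDξ.sub ?_))
      simpa using hlamO.smul hξO
    have hDv : (fun t => (Rt t - R) (ξ t - e)) =o[𝓝 0] fun t : ℝ => t := by
      have h1 : (fun t => (Rt t - R) (ξ t - e)) =O[𝓝 0] fun t => ‖Rt t - R‖ * ‖ξ t - e‖ :=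
        IsBigO.of_bound 1 (Eventually.of_forall fun t => by
          rw [one_mul, Real.norm_of_nonneg (by positivity)]
          exact (Rt t - R).le_opNorm _)
      have h2 := h1.trans (hRt.norm_left.mul hvO.norm_left)
      refine h2.trans_isLittleO ?_
      have h3 : (fun t : ℝ => t) =o[𝓝 0] fun _ : ℝ => (1 : ℝ) :=
        (isLittleO_one_iff ℝ).2 tendsto_id
      simpa using h3.mul_isBigO (isBigO_refl (fun t : ℝ => t) (𝓝 0))
    have hDe : (fun t => (Rt t - R) (ξ t) - (t : ℂ) • b) =o[𝓝 0] fun t : ℝ => t := by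
      refine (hDv.add hb).congr_left fun t => ?_
      simp only [sub_apply, map_sub, hRe]
      abel
    -- The vector `b` is in the image of `1 - R`, so the first order term of the eigenvalue
    -- vanishes. The first order term of the eigenvector is then `B (t b) = t a`.
    have hφb : φ b = 0 := by rw [← hab, map_sub, hφR, sub_self]
    have hlamo : (fun t => lam t - 1) =o[𝓝 0] fun t : ℝ => t := by
      refine hlamξ.trans_isLittleO (((φ.isBigO_comp _ _).trans_isLittleO hDe).congr_left
        fun t => ?_)
      rw [map_sub, map_smul, hφb, smul_zero, sub_zero]
    have h5 : (fun t => (lam t - 1) • ξ t) =o[𝓝 0] fun t : ℝ => t := by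
      simpa using hlamo.smul_isBigO hξO
    have h6 := (B.isBigO_comp (fun t => ((Rt t - R) (ξ t) - (t : ℂ) • b) - (lam t - 1) • ξ t)
      (𝓝 0)).trans_isLittleO (hDe.sub h5)
    refine EventuallyEq.trans_isLittleO ?_ h6
    filter_upwards [hv] with t ht
    rw [ht, ← hAa, ← map_smul B, ← map_sub B]
    congr 1
    abel

end Perturbation

/-! ### Invertibility from a Lasota-Yorke inequality -/

section QuasiCompact

variable {X : Type*} [NormedAddCommGroup X] [NormedSpace ℂ X] [CompleteSpace X]

/-- An operator which satisfies a Lasota-Yorke inequality for a weak norm `w`, and whose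
approximate fixed points modulo `e` are small for the weak norm, has a spectral gap once its
fixed vector `e` is removed. -/
theorem isUnit_one_sub_of_lasotaYorke {R : X →L[ℂ] X} {e : X} {φ : X →L[ℂ] ℂ} {w : X → ℝ}
    {c M C τ : ℝ} {q : ℕ} (hφe : φ e = 1) (hRe : R e = e) (hφR : ∀ x, φ (R x) = φ x)
    (hc : 0 ≤ c) (hφw : ∀ x, ‖φ x‖ ≤ c * w x) (hwM : ∀ x, w x ≤ M * ‖x‖) (hM : 0 ≤ M)
    (hC0 : 0 ≤ C) (hτ0 : 0 < τ) (hτ1 : τ < 1)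
    (hC : ∀ n x, q ≤ n → ‖R^[n] x‖ ≤ C * (w x + ‖x‖ * τ ^ (n - q)))
    (hcomp : ∀ v : ℕ → X, (∀ n, ‖v n‖ = 1) →
      Tendsto (fun n => ‖v n - R (v n) + φ (v n) • e‖) atTop (𝓝 0) →
      ∃ ψ : ℕ → ℕ, StrictMono ψ ∧ Tendsto (fun n => w (v (ψ n))) atTop (𝓝 0)) :
    IsUnit (1 - R + φ.smulRight e) := by
  set P : X →L[ℂ] X := φ.smulRight e with hP
  have hPx : ∀ F, P F = φ F • e := fun F => rfl
  set S := R - P with hSdef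
  -- From `R P = P R = P = P²` the mixed terms collapse, and bounds on powers of `R` pass to powers
  -- of `S`.
  have hSpow : ∀ n : ℕ, S ^ (n + 1) = R ^ (n + 1) - P := by
    have e1 : R * P = P := by
      ext1 F
      change R (P F) = P F
      rw [hPx, map_smul, hRe]
    have e2 : P * R = P := by
      ext1 F
      change P (R F) = P F
      rw [hPx, hPx, hφR]
    have e3 : P * P = P := by
      ext1 F
      change P (P F) = P F
      rw [hPx, hPx, map_smul, hφe, smul_eq_mul, mul_one]
    have e4 : ∀ n : ℕ, R ^ n * P = P := by
      intro n
      induction n with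
      | zero => simp
      | succ n ih => rw [pow_succ, mul_assoc, e1, ih]
    intro n
    induction n with
    | zero => simp [hSdef]
    | succ n ih => rw [pow_succ, ih, hSdef, sub_mul, mul_sub, mul_sub, e4, e2, e3, ← pow_succ]; abel
  set C' := C + c * ‖e‖ with hC'
  have hC'0 : 0 ≤ C' := by positivity
  have hSn : ∀ (n : ℕ) (F : X), q ≤ n + 1 →
      ‖(S ^ (n + 1)) F‖ ≤ C' * w F + C * τ ^ (n + 1 - q) * ‖F‖ := by
    intro n F hn
    rw [hSpow]
    have h1 := hC (n + 1) F hn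
    rw [show R^[n + 1] F = (R ^ (n + 1)) F from
      congrFun (FunLike.coe_pow_eq_iterate R (n + 1)).symm F] at h1
    have h2 : ‖P F‖ ≤ c * w F * ‖e‖ := by
      rw [hPx, norm_smul]
      exact mul_le_mul_of_nonneg_right (hφw F) (norm_nonneg _)
    calc ‖(R ^ (n + 1)) F - P F‖ ≤ ‖(R ^ (n + 1)) F‖ + ‖P F‖ := norm_sub_le _ _
      _ ≤ _ := add_le_add h1 h2
      _ = _ := by rw [hC']; ring
  obtain ⟨K, hK⟩ : ∃ K, ∀ n : ℕ, ‖S ^ n‖ ≤ K := by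
    refine ⟨∑ j ∈ Finset.range (q + 1), ‖S ^ j‖ + (C' * M + C), fun n => ?_⟩
    have hpos : 0 ≤ C' * M + C := by positivity
    by_cases hn : n < q + 1
    · have := Finset.single_le_sum (f := fun j => ‖S ^ j‖) (fun j _ => norm_nonneg _)
        (Finset.mem_range.2 hn)
      linarith
    · obtain ⟨k, rfl⟩ : ∃ k, n = k + 1 := ⟨n - 1, by omega⟩
      have h1 : ‖S ^ (k + 1)‖ ≤ C' * M + C := by
        refine ContinuousLinearMap.opNorm_le_bound _ hpos fun F => ?_
        refine (hSn k F (by omega)).trans ?_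
        have h2 : τ ^ (k + 1 - q) ≤ 1 := pow_le_one₀ hτ0.le hτ1.le
        calc _ ≤ C' * (M * ‖F‖) + C * 1 * ‖F‖ := by
              gcongr
              exact hwM F
          _ = _ := by ring
      have h2 : 0 ≤ ∑ j ∈ Finset.range (q + 1), ‖S ^ j‖ :=
        Finset.sum_nonneg fun j _ => norm_nonneg _
      linarith
  have hgoal : (1 : X →L[ℂ] X) - R + P = 1 - S := by
    rw [hSdef]; abel
  rw [hgoal]
  by_contra hnot
  -- `S` is power bounded, so if `1 - S` is not invertible it is not bounded below, and unit
  -- approximate fixed vectors exist.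
  have hseq : ∀ k : ℕ, ∃ v : X, ‖v‖ = 1 ∧ ‖v - S v‖ < 1 / ((k : ℝ) + 1) := by
    intro k
    by_contra hcon
    push Not at hcon
    refine hnot (isUnit_one_sub_of_bounded_below hK (ε := 1 / ((k : ℝ) + 1)) (by positivity) ?_)
    intro v
    by_cases hv : v = 0
    · simp [hv]
    have hv' : ‖v‖ ≠ 0 := norm_ne_zero_iff.2 hv
    have h1 := hcon (((‖v‖⁻¹ : ℝ) : ℂ) • v) (by
      rw [norm_smul, Complex.norm_real, Real.norm_of_nonneg (by positivity)]
      exact inv_mul_cancel₀ hv')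
    rw [map_smul, ← smul_sub, norm_smul, Complex.norm_real, Real.norm_of_nonneg (by positivity),
      inv_mul_eq_div, le_div_iff₀ (by positivity)] at h1
    exact h1
  choose v hv1 hv2 using hseq
  have hlim0 : Tendsto (fun n => ‖v n - S (v n)‖) atTop (𝓝 0) :=
    squeeze_zero (fun n => norm_nonneg _) (fun n => (hv2 n).le)
      tendsto_one_div_add_atTop_nhds_zero_nat
  have hvS : ∀ x, x - R x + φ x • e = x - S x := fun x => by
    change _ = x - (R x - φ x • e)
    abel
  obtain ⟨ψ, hψ, hL1lim⟩ := hcomp v hv1 (by simpa only [hvS] using hlim0)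
  have hsmall := hlim0.comp hψ.tendsto_atTop
  simp only [Function.comp_def] at hsmall
  -- `N` makes the strong part of the inequality at time `q + N + 1` at most `1/2`. As that fixed
  -- power almost fixes `v`, one gets `1 = ‖v‖ ≤ o(1) + C' w(v) + 1/2`, contradicting `w(v) → 0`.
  obtain ⟨N, hN⟩ := exists_pow_lt_of_lt_one (show 0 < 1 / (2 * (C + 1)) by positivity) hτ1
  have hiter : ∀ (n : ℕ) (F : X), ‖F - (S ^ n) F‖ ≤ n * K * ‖F - S F‖ := by
    intro n F
    induction n with
    | zero => simp
    | succ n ih =>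
      have e1 : F - (S ^ (n + 1)) F = (F - (S ^ n) F) + (S ^ n) (F - S F) := by
        rw [map_sub, pow_succ]
        change _ = _ + ((S ^ n) F - (S ^ n * S) F)
        abel
      rw [e1, Nat.cast_succ]
      calc _ ≤ _ := norm_add_le _ _
        _ ≤ n * K * ‖F - S F‖ + K * ‖F - S F‖ :=
          add_le_add ih (ContinuousLinearMap.le_of_opNorm_le _ (hK n) _)
        _ = _ := by ring
  have hfin : ∀ n, (1 : ℝ) ≤ ((q + N + 1 : ℕ) : ℝ) * K * ‖v (ψ n) - S (v (ψ n))‖ +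
      C' * w (v (ψ n)) + 1 / 2 := by
    intro n
    have h1 := hiter (q + N + 1) (v (ψ n))
    have h2 := hSn (q + N) (v (ψ n)) (by omega)
    have h3 : ‖v (ψ n)‖ ≤ ‖v (ψ n) - (S ^ (q + N + 1)) (v (ψ n))‖ +
        ‖(S ^ (q + N + 1)) (v (ψ n))‖ := by
      have := norm_add_le (v (ψ n) - (S ^ (q + N + 1)) (v (ψ n))) ((S ^ (q + N + 1)) (v (ψ n)))
      rwa [sub_add_cancel] at this
    rw [hv1] at h2 h3
    have h4 : C * τ ^ (q + N + 1 - q) ≤ 1 / 2 := by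
      have h5 : τ ^ (q + N + 1 - q) ≤ τ ^ N := pow_le_pow_of_le_one hτ0.le hτ1.le (by omega)
      calc C * τ ^ (q + N + 1 - q) ≤ (C + 1) * (1 / (2 * (C + 1))) := by
            apply mul_le_mul (by linarith) (h5.trans hN.le) (by positivity) (by positivity)
        _ = 1 / 2 := by field_simp
    linarith
  have hlim2 := ((hsmall.const_mul (((q + N + 1 : ℕ) : ℝ) * K)).add
    (hL1lim.const_mul C')).add_const (1 / 2 : ℝ)
  have := ge_of_tendsto' hlim2 hfin
  norm_num at this

end QuasiCompact

/-! ### Spectral gap -/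

section SpectralGap

variable {Z ι : Type*} [MeasurableSpace Z] [Countable ι]
  {m : Measure Z} [IsFiniteMeasure m] {T : Z → Z} {δ : ι → Set Z} {τ : ℝ} {p : Z → Z}
  {q : ℕ} {base : Set ι} {height : ι → ℕ} {floor : ι → ℕ → ι}

omit [IsFiniteMeasure m] in
/-- Compactness of bounded sequences of Hölder functions for the pointwise convergence. -/
theorem LSpace.exists_tendsto_subseq (hM : IsMarkovMap m T δ) (hτ0 : 0 < τ) (hτ1 : τ < 1)
    {v : ℕ → LSpace T δ τ p} (hv : ∀ n, ‖v n‖ ≤ 1) :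
    ∃ (V : LSpace T δ τ p) (ψ : ℕ → ℕ), StrictMono ψ ∧
      ∀ x, Tendsto (fun n => v (ψ n) x) atTop (𝓝 (V x)) := by
  by_cases hZ : Nonempty Z
  swap
  · have := not_nonempty_iff.1 hZ
    exact ⟨0, id, strictMono_id, fun x => (IsEmpty.false x).elim⟩
  -- One point per cylinder gives a countable family, on which sequential compactness of the product
  -- applies; the common Hölder bound spreads convergence to every point.
  let c : (Σ n : ℕ, Fin n → ι) → Z := fun j => Classical.epsilon fun y => y ∈ piece T δ j.1 j.2
  have hc : ∀ n x, ∃ j, Near T δ n x (c j) := by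
    intro n x
    obtain ⟨w, hw⟩ := hM.exists_piece n x
    exact ⟨⟨n, w⟩, near_of_mem_piece hw
      (Classical.epsilon_spec (p := fun y => y ∈ piece T δ n w) ⟨x, hw⟩)⟩
  have hcomp : IsCompact (Set.univ.pi fun _ : (Σ n : ℕ, Fin n → ι) =>
      Metric.closedBall (0 : ℂ) 1) := isCompact_univ_pi fun _ => isCompact_closedBall _ _
  have hv1 : ∀ n x, ‖v n x‖ ≤ 1 := fun n x => ((v n).norm_apply_le x).trans (hv n)
  have hv2 : ∀ k n x y, 1 ≤ n → Near T δ n x y → ‖v k x - v k y‖ ≤ 1 * τ ^ n :=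
    fun k n x y hn hxy => ((v k).holder hτ0 hn hxy).trans
      (mul_le_mul_of_nonneg_right (hv k) (pow_pos hτ0 n).le)
  obtain ⟨a, -, ψ, hψ, hlim⟩ := hcomp.tendsto_subseq (x := fun n j => v n (c j))
    (fun n j _ => by simpa using hv1 n (c j))
  rw [tendsto_pi_nhds] at hlim
  have hex : ∀ x, ∃ z, Tendsto (fun n => v (ψ n) x) atTop (𝓝 z) := by
    intro x
    apply cauchySeq_tendsto_of_complete
    rw [Metric.cauchySeq_iff]
    intro ε hε
    obtain ⟨n, hn⟩ := exists_pow_lt_of_lt_one (show 0 < ε / 3 by positivity) hτ1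
    obtain ⟨j, hj⟩ := hc (n + 1) x
    obtain ⟨N, hN⟩ := Metric.cauchySeq_iff.1 (hlim j).cauchySeq (ε / 3) (by positivity)
    refine ⟨N, fun k hk l hl => ?_⟩
    have h1 := hN k hk l hl
    simp only [Function.comp_apply] at h1
    rw [dist_eq_norm] at h1 ⊢
    have h2 := hv2 (ψ k) (n + 1) x (c j) (by omega) hj
    have h3 := hv2 (ψ l) (n + 1) x (c j) (by omega) hj
    have h4 : τ ^ (n + 1) ≤ τ ^ n := pow_le_pow_of_le_one hτ0.le hτ1.le (Nat.le_succ n)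
    have e : v (ψ k) x - v (ψ l) x = (v (ψ k) x - v (ψ k) (c j)) +
      (v (ψ k) (c j) - v (ψ l) (c j)) - (v (ψ l) x - v (ψ l) (c j)) := by ring
    rw [e]
    refine ((norm_sub_le _ _).trans (add_le_add_left (norm_add_le _ _) _)).trans_lt ?_
    linarith
  choose f hf using hex
  obtain ⟨V, hV, -⟩ := LSpace.exists_of_bounds (T := T) (δ := δ) (τ := τ) (p := p) (f := f)
    (K := 1) hτ0 (fun x => tendsto_nhds_unique (hf (p x)) (by
      simp only [LSpace.apply_retraction]
      exact hf x))
    (fun x => le_of_tendsto (hf x).norm (Eventually.of_forall fun n => hv1 _ x))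
    (fun n hn x _ y _ hxy => le_of_tendsto ((hf x).sub (hf y)).norm
      (Eventually.of_forall fun k => hv2 _ n x y hn hxy)) zero_le_one
  exact ⟨V, ψ, hψ, fun x => by rw [hV]; exact hf x⟩

omit [MeasurableSpace Z] [Countable ι] in
theorem LSpace.exists_one (hτ0 : 0 < τ) : ∃ e : LSpace T δ τ p, ∀ x, e x = 1 := by
  obtain ⟨e, he, -⟩ := LSpace.exists_of_bounds (T := T) (δ := δ) (τ := τ) (p := p)
    (f := fun _ => 1) (K := 1) hτ0 (fun _ => rfl) (fun _ => by simp)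
    (fun n _ x _ y _ _ => by simp; positivity) zero_le_one
  exact ⟨e, he⟩

theorem LSpace.exists_average (hM : IsMarkovMap m T δ) (hτ0 : 0 < τ) (hτ1 : τ < 1) :
    ∃ φ : LSpace T δ τ p →L[ℂ] ℂ, ∀ F : LSpace T δ τ p,
      φ F = (∫ x, F x ∂m) / (m.real Set.univ : ℂ) := by
  let L : LSpace T δ τ p →ₗ[ℂ] ℂ :=
    { toFun := fun F => (∫ x, F x ∂m) / (m.real Set.univ : ℂ)
      map_add' := fun F G => by
        simp only [LSpace.add_apply]
        rw [integral_add (F.integrable hM hτ0 hτ1) (G.integrable hM hτ0 hτ1), add_div]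
      map_smul' := fun c F => by
        simp only [LSpace.smul_apply, RingHom.id_apply, smul_eq_mul]
        rw [integral_const_mul, mul_div_assoc] }
  refine ⟨L.mkContinuous 1 fun F => ?_, fun F => rfl⟩
  change ‖(∫ x, F x ∂m) / (m.real Set.univ : ℂ)‖ ≤ 1 * ‖F‖
  rw [norm_div, Complex.norm_real, Real.norm_of_nonneg measureReal_nonneg, one_mul]
  refine div_le_of_le_mul₀ measureReal_nonneg (norm_nonneg _) ?_
  exact norm_integral_le_of_norm_le_const (ae_of_all _ F.norm_apply_le)

namespace Setting

variable [StandardBorelSpace Z] (hS : Setting m T δ τ p q base height floor)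
include hS

omit [StandardBorelSpace Z] in
theorem setIntegral_iterate {R : LSpace T δ τ p →L[ℂ] LSpace T δ τ p}
    (hR : ∀ F : LSpace T δ τ p, transfer m T F =ᵐ[m] (R F : Z → ℂ)) (n : ℕ)
    (F : LSpace T δ τ p) {A : Set Z} (hA : MeasurableSet A) :
    ∫ x in A, (R^[n] F : LSpace T δ τ p) x ∂m = ∫ x in T^[n] ⁻¹' A, F x ∂m := by
  have hT := hS.ergodic.toMeasurePreserving
  induction n generalizing A with
  | zero => simp
  | succ n ih =>
    rw [Function.iterate_succ_apply', ← integral_congr_ae (ae_restrict_of_ae (hR (R^[n] F))),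
      setIntegral_transfer hT ((R^[n] F).integrable hS.markov hS.pos hS.lt_one) hA,
      ih (hT.measurable hA), Function.iterate_succ', Set.preimage_comp]

/-- `1 - R` is invertible once the eigenvalue `1` has been removed. -/
theorem isUnit_one_sub [NeZero m] {R : LSpace T δ τ p →L[ℂ] LSpace T δ τ p}
    (hR : ∀ F : LSpace T δ τ p, transfer m T F =ᵐ[m] (R F : Z → ℂ)) {e : LSpace T δ τ p}
    (he : ∀ x, e x = 1) {φ : LSpace T δ τ p →L[ℂ] ℂ}
    (hφ : ∀ F : LSpace T δ τ p, φ F = (∫ x, F x ∂m) / (m.real Set.univ : ℂ)) (hRe : R e = e)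
    (hφR : ∀ F, φ (R F) = φ F) : IsUnit (1 - R + φ.smulRight e) := by
  have hM := hS.markov
  have hT := hS.ergodic.toMeasurePreserving
  have hτ0 := hS.pos
  have hτ1 := hS.lt_one
  have hint : ∀ F : LSpace T δ τ p, Integrable (F : Z → ℂ) m := fun F => F.integrable hM hτ0 hτ1
  have hmpos : 0 < m.real Set.univ :=
    ENNReal.toReal_pos (NeZero.ne _) (measure_ne_top _ _)
  have hmC : (m.real Set.univ : ℂ) ≠ 0 := by exact_mod_cast hmpos.ne'
  have hφe : φ e = 1 := by
    rw [hφ]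
    simp only [he, integral_const, Complex.real_smul, mul_one]
    exact div_self hmC
  obtain ⟨C, hC0, hC⟩ := hS.exists_lasotaYorke
  have hL1 : ∀ F : LSpace T δ τ p, ‖φ F‖ ≤ (m.real Set.univ)⁻¹ * ∫ x, ‖F x‖ ∂m := by
    intro F
    rw [hφ, norm_div, Complex.norm_real, Real.norm_of_nonneg hmpos.le, div_eq_inv_mul]
    gcongr
    exact norm_integral_le_integral_norm _
  have hL1le : ∀ F : LSpace T δ τ p, ∫ x, ‖F x‖ ∂m ≤ m.real Set.univ * ‖F‖ := by
    intro F
    have h1 : ∫ x, ‖F x‖ ∂m ≤ ∫ _, ‖F‖ ∂m :=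
      integral_mono (hint F).norm (integrable_const _) F.norm_apply_le
    simpa using h1
  refine isUnit_one_sub_of_lasotaYorke hφe hRe hφR (inv_nonneg.2 hmpos.le) hL1 hL1le hmpos.le hC0
    hτ0 hτ1 (fun n F hn => hC n F _ hn fun A hA => hS.setIntegral_iterate hR n F hA) ?_
  intro v hv1 hsm
  obtain ⟨V, ψ, hψ, hlim⟩ := LSpace.exists_tendsto_subseq hM hτ0 hτ1 fun n => (hv1 n).le
  refine ⟨ψ, hψ, ?_⟩
  have hsmall := hsm.comp hψ.tendsto_atTop
  simp only [Function.comp_def] at hsmall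
  have hdct : ∀ A : Set Z, Tendsto (fun n => ∫ x in A, v (ψ n) x ∂m) atTop
      (𝓝 (∫ x in A, V x ∂m)) := by
    intro A
    refine tendsto_integral_of_dominated_convergence (fun _ => 1) ?_ (integrable_const _) ?_ ?_
    · exact fun n => (hint _).1.restrict
    · exact fun n => ae_of_all _ fun x => ((v (ψ n)).norm_apply_le x).trans (hv1 _).le
    · exact ae_of_all _ hlim
  -- The limit equation `V - R V + φ(V) = 0` is tested on sets, since pointwise convergence passes
  -- to integrals without any continuity of `R` for it.
  have hV : ∀ A, MeasurableSet A →
      ∫ x in A, V x ∂m = ∫ x in T ⁻¹' A, V x ∂m - φ V * m.real A := by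
    intro A hA
    have h1 : ∀ F : LSpace T δ τ p,
        ∫ x in A, (F - R F + φ F • e) x ∂m =
          ∫ x in A, F x ∂m - (∫ x in T ⁻¹' A, F x ∂m - φ F * m.real A) := by
      intro F
      have h2 := hS.setIntegral_iterate hR 1 F hA
      rw [Function.iterate_one, Function.iterate_one] at h2
      have h3 : ∀ x, (F - R F + φ F • e) x = F x - (R F x - φ F) := by
        intro x
        rw [LSpace.add_apply, LSpace.sub_apply, LSpace.smul_apply, he, mul_one]
        ring
      simp only [h3]
      rw [integral_sub (hint F).integrableOn (g := fun x => R F x - φ F)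
          ((hint (R F)).integrableOn.sub (integrable_const _)),
        integral_sub (hint (R F)).integrableOn (g := fun _ => φ F) (integrable_const _), h2]
      simp [mul_comm]
    have h4 : Tendsto (fun n => φ (v (ψ n))) atTop (𝓝 (φ V)) := by
      simp only [hφ]
      have := hdct Set.univ
      simp only [setIntegral_univ] at this
      exact this.div_const _
    have h5 := (hdct A).sub ((hdct (T ⁻¹' A)).sub (h4.mul_const (m.real A : ℂ)))
    have h6 : Tendsto (fun n => ∫ x in A, (v (ψ n) - R (v (ψ n)) + φ (v (ψ n)) • e) x ∂m) atTop (𝓝 0) := by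
      refine squeeze_zero_norm (fun n => norm_setIntegral_le_mul (m := m)
        fun x _ => LSpace.norm_apply_le _ x) ?_
      simpa using hsmall.mul_const (m.real A)
    have h7 := tendsto_nhds_unique (h6.congr fun n => h1 _) h5
    exact (sub_eq_zero.1 h7.symm)
  -- Total mass gives `φ V = 0`, so `R V = V`. Ergodicity makes `V` constant and the zero mean kills
  -- it; dominated convergence then gives `L¹` convergence to `0`.
  have hφV : φ V = 0 := by
    have h1 := hV Set.univ MeasurableSet.univ
    rw [Set.preimage_univ] at h1
    have h2 : φ V * (m.real Set.univ : ℂ) = 0 := by linear_combination h1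
    exact (mul_eq_zero.1 h2).resolve_right hmC
  have hVtr : transfer m T V =ᵐ[m] (V : Z → ℂ) := by
    refine transfer_ae_eq hT (hint V) (hint V) fun A hA => ?_
    rw [hV A hA, hφV]
    simp
  obtain ⟨c, hc⟩ := ae_eq_const_of_transfer_eq hS.ergodic (hint V).1 V.norm_apply_le hVtr
  have hc0 : c = 0 := by
    have h1 := hφ V
    rw [hφV, integral_congr_ae hc] at h1
    simp only [integral_const, Complex.real_smul] at h1
    rw [mul_comm, mul_div_assoc, div_self hmC, mul_one] at h1
    exact h1.symm
  have h1 : Tendsto (fun n => ∫ x, ‖v (ψ n) x‖ ∂m) atTop (𝓝 (∫ x, ‖V x‖ ∂m)) := by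
    refine tendsto_integral_of_dominated_convergence (fun _ => 1) ?_ (integrable_const _) ?_ ?_
    · exact fun n => (hint _).1.norm
    · exact fun n => ae_of_all _ fun x => by
        rw [norm_norm]
        exact ((v (ψ n)).norm_apply_le x).trans (hv1 _).le
    · exact ae_of_all _ fun x => (hlim x).norm
  have h2 : ∫ x, ‖V x‖ ∂m = 0 := by
    rw [← integral_zero Z ℝ (μ := m)]
    refine integral_congr_ae ?_
    filter_upwards [hc] with x hx
    rw [hx, hc0, norm_zero]
  rwa [h2] at h1

end Setting

end SpectralGap

/-! ### Perturbed transfer operators -/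

section Observable

theorem norm_exp_sub_exp_le (t x y : ℝ) :
    ‖Complex.exp (Complex.I * t * x) - Complex.exp (Complex.I * t * y)‖ ≤ |t| * |x - y| := by
  have e : Complex.exp (Complex.I * t * x) - Complex.exp (Complex.I * t * y) =
      Complex.exp (Complex.I * ((t * y : ℝ) : ℂ)) *
        (Complex.exp (Complex.I * ((t * (x - y) : ℝ) : ℂ)) - 1) := by
    rw [mul_sub, ← Complex.exp_add, mul_one]
    push_cast
    ring_nf
  rw [e, norm_mul, mul_comm Complex.I, Complex.norm_exp_ofReal_mul_I, one_mul, ← abs_mul]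
  exact Real.norm_exp_I_mul_ofReal_sub_one_le

theorem norm_exp_sub_one_le (t x : ℝ) :
    ‖Complex.exp (Complex.I * t * x) - 1‖ ≤ |t| * |x| := by
  simpa using norm_exp_sub_exp_le t x 0

theorem norm_exp (t x : ℝ) : ‖Complex.exp (Complex.I * t * x)‖ = 1 := by
  rw [show Complex.I * t * x = ((t * x : ℝ) : ℂ) * Complex.I by push_cast; ring,
    Complex.norm_exp_ofReal_mul_I]

/-- Mean value inequality: the derivative `i t (e^{itz} - 1)` is at most `|t| min 2 (|t| S)` on
`[-S, S]`. The `2` in the minimum is what later permits dominated convergence without a second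
moment of the local suprema. -/
theorem norm_exp_remainder_sub_le {t x y S : ℝ} (hx : |x| ≤ S) (hy : |y| ≤ S) :
    ‖(Complex.exp (Complex.I * t * x) - 1 - Complex.I * t * x) -
      (Complex.exp (Complex.I * t * y) - 1 - Complex.I * t * y)‖ ≤
      |t| * min 2 (|t| * S) * |x - y| := by
  have hd : ∀ z ∈ Set.Icc (-S) S, HasDerivWithinAt
      (fun z : ℝ => Complex.exp (Complex.I * t * z) - 1 - Complex.I * t * z)
      (Complex.exp (Complex.I * t * z) * (Complex.I * t) - Complex.I * t) (Set.Icc (-S) S) z := by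
    intro z _
    have h1 : HasDerivAt (fun z : ℝ => Complex.I * t * z) (Complex.I * t) z := by
      simpa using (Complex.ofRealCLM.hasDerivAt (x := z)).const_mul (Complex.I * (t : ℂ))
    exact ((h1.cexp.sub_const 1).sub h1).hasDerivWithinAt
  refine Convex.norm_image_sub_le_of_norm_hasDerivWithin_le hd (fun z hz => ?_)
    (convex_Icc _ _) (abs_le.1 hy) (abs_le.1 hx)
  have e : Complex.exp (Complex.I * t * z) * (Complex.I * t) - Complex.I * t =
      (Complex.I * t) * (Complex.exp (Complex.I * t * z) - 1) := by ring
  rw [e, norm_mul, norm_mul, Complex.norm_I, one_mul, Complex.norm_real, Real.norm_eq_abs]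
  refine mul_le_mul_of_nonneg_left (le_min ?_ ?_) (abs_nonneg _)
  · refine (norm_sub_le _ _).trans ?_
    rw [norm_exp, norm_one]
    norm_num
  · exact (norm_exp_sub_one_le t z).trans
      (mul_le_mul_of_nonneg_left (abs_le.2 hz) (abs_nonneg _))

theorem norm_exp_remainder_le (t x : ℝ) :
    ‖Complex.exp (Complex.I * t * x) - 1 - Complex.I * t * x‖ ≤ t ^ 2 * x ^ 2 := by
  have h := norm_exp_remainder_sub_le (t := t) (x := x) (y := 0) (S := |x|) le_rfl (by simp)
  simp only [Complex.ofReal_zero, mul_zero, Complex.exp_zero, sub_self, sub_zero] at h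
  refine h.trans ?_
  calc |t| * min 2 (|t| * |x|) * |x| ≤ |t| * (|t| * |x|) * |x| := by
        gcongr
        exact min_le_right _ _
    _ = |t| ^ 2 * |x| ^ 2 := by ring
    _ = _ := by rw [sq_abs, sq_abs]

/-- Serves for pointwise convergence only, so the cubic growth in `x` is harmless; domination will
come from the quadratic bound. -/
theorem norm_exp_second_remainder_le (t x : ℝ) :
    ‖Complex.exp (Complex.I * t * x) - 1 - Complex.I * t * x + (t : ℂ) ^ 2 * (x : ℂ) ^ 2 / 2‖ ≤
      2 * |t * x| ^ 3 := by
  set s := t * x with hs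
  have e1 : Complex.I * t * x = Complex.I * (s : ℂ) := by rw [hs]; push_cast; ring
  have e2 : (t : ℂ) ^ 2 * (x : ℂ) ^ 2 / 2 = (s : ℂ) ^ 2 / 2 := by rw [hs]; push_cast; ring
  have hn : ‖Complex.I * (s : ℂ)‖ = |s| := by simp
  rcases le_total |s| 1 with h1 | h1
  · have h2 := Complex.exp_bound (x := Complex.I * (s : ℂ)) (by rwa [hn]) (n := 3) (by norm_num)
    rw [hn] at h2
    have e3 : Complex.exp (Complex.I * (s : ℂ)) -
        ∑ m ∈ Finset.range 3, (Complex.I * (s : ℂ)) ^ m / (m.factorial : ℂ) =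
        Complex.exp (Complex.I * t * x) - 1 - Complex.I * t * x +
          (t : ℂ) ^ 2 * (x : ℂ) ^ 2 / 2 := by
      rw [e1, e2]
      simp only [Finset.sum_range_succ, Finset.sum_range_zero, mul_pow, Complex.I_sq]
      norm_num [Nat.factorial]
      ring
    rw [e3] at h2
    refine h2.trans ?_
    rw [mul_comm]
    refine mul_le_mul_of_nonneg_right ?_ (by positivity)
    norm_num [Nat.factorial]
  · have h2 := norm_exp_remainder_le t x
    rw [← mul_pow, ← hs] at h2
    rw [e2]
    refine (norm_add_le _ _).trans ?_
    have h3 : ‖(s : ℂ) ^ 2 / 2‖ = s ^ 2 / 2 := by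
      rw [norm_div, norm_pow, Complex.norm_real, Real.norm_eq_abs, sq_abs]
      norm_num
    rw [h3]
    have h4 : s ^ 2 ≤ |s| ^ 3 := by
      rw [← sq_abs, pow_succ |s| 2]
      exact le_mul_of_one_le_right (by positivity) h1
    have : 0 ≤ |s| ^ 3 := by positivity
    linarith

variable {Z ι : Type*} [MeasurableSpace Z]
  {m : Measure Z} {T : Z → Z} {δ : ι → Set Z} {τ : ℝ} {p : Z → Z}
  {q : ℕ} {base : Set ι} {height : ι → ℕ} {floor : ι → ℕ → ι} {h : Z → ℝ} {S D : ι → ℝ} {N : ℝ}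

/-- `S` and `D` bound the local suprema and the local Hölder constants of `h`. They are summable,
and bounded by `N` on the elements which do not return to the basis. -/
structure ObservableBound (m : Measure Z) (T : Z → Z) (δ : ι → Set Z) (τ : ℝ) (base : Set ι)
    (h : Z → ℝ) (S D : ι → ℝ) (N : ℝ) : Prop where
  sup_nonneg : ∀ i, 0 ≤ S i
  holder_nonneg : ∀ i, 0 ≤ D i
  abs_le : ∀ i, ∀ x ∈ δ i, |h x| ≤ S i
  holder : ∀ i, HolderBound T δ τ (D i) h (δ i)
  summable : Summable fun i => m.real (δ i) * (S i + D i)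
  nonReturning : ∀ i, ¬ Returns m T δ base i → S i ≤ N ∧ D i ≤ N

/-- A value of `|h|` on `δ i` is at most the average of `|h|` there plus the oscillation `D i * τ`.
Weighted by the measures, the averages sum to `∫ |h|` and the oscillations are summable by
hypothesis. -/
theorem exists_observableBound [IsFiniteMeasure m] [Countable ι] (hM : IsMarkovMap m T δ)
    (hτ0 : 0 < τ) (hτ1 : τ < 1) (hh : Integrable h m)
    (hsum : ∑' i, m (δ i) * holderConst T δ τ h (δ i) < ⊤)
    (hbdd : ∃ C : ℝ, ∀ x ∈ nonReturning m T δ base, |h x| ≤ C)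
    (hhol : holderConst T δ τ h (nonReturning m T δ base) < ⊤) :
    ∃ S D N, ObservableBound m T δ τ base h S D N := by
  classical
  obtain ⟨C, hC⟩ := hbdd
  set c : ι → ℝ≥0∞ := fun i => holderConst T δ τ h (δ i) with hc
  have hm0 : ∀ i, 0 < m.real (δ i) := fun i =>
    ENNReal.toReal_pos (hM.pos i).ne' (measure_ne_top _ _)
  have hcfin : ∀ i, c i < ⊤ := by
    intro i
    by_contra hcon
    have h1 : c i = ⊤ := not_lt_top_iff.1 hcon
    have h2 := (ENNReal.le_tsum (f := fun i => m (δ i) * c i) i).trans_lt hsum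
    rw [h1, ENNReal.mul_top (hM.pos i).ne'] at h2
    exact lt_irrefl _ h2
  set d := (holderConst T δ τ h (MarkovTower.nonReturning m T δ base)).toReal + 1 with hd
  have hd0 : 0 ≤ d := by positivity
  set D : ι → ℝ := fun i => if Returns m T δ base i then (c i).toReal + 1 else d with hD
  have hD0 : ∀ i, 0 ≤ D i := fun i => by
    simp only [hD]
    split_ifs <;> positivity
  have hsub : ∀ i, ¬ Returns m T δ base i → δ i ⊆ MarkovTower.nonReturning m T δ base :=
    fun i hi => Set.subset_iUnion₂ (s := fun j (_ : ¬ Returns m T δ base j) => δ j) i hi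
  have hhold : ∀ i, HolderBound T δ τ (D i) h (δ i) := by
    intro i
    simp only [hD]
    split_ifs with hi
    · exact exists_holderBound hτ0 hτ1 (hcfin i)
    · exact fun n hn x hx y hy hxy =>
        exists_holderBound hτ0 hτ1 hhol n hn x (hsub i hi hx) y (hsub i hi hy) hxy
  set J : ι → ℝ := fun i => ∫ x in δ i, |h x| ∂m with hJ
  have hJ0 : ∀ i, 0 ≤ J i := fun i => integral_nonneg fun x => abs_nonneg _
  have hJsum : Summable J :=
    (hasSum_integral_iUnion (μ := m) (f := fun x => |h x|) hM.measurableSet hM.disjoint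
      hh.abs.integrableOn).summable
  have hmsum : Summable fun i => m.real (δ i) := by
    have h1 := (hasSum_integral_iUnion (μ := m) (f := fun _ => (1 : ℝ)) hM.measurableSet hM.disjoint
      (integrable_const _).integrableOn).summable
    simpa using h1
  have hcsum : Summable fun i => m.real (δ i) * (c i).toReal := by
    have h1 := ENNReal.summable_toReal hsum.ne
    simpa only [ENNReal.toReal_mul, measureReal_def, hc] using h1
  have hDsum : Summable fun i => m.real (δ i) * D i := by
    refine Summable.of_nonneg_of_le (fun i => mul_nonneg (hm0 i).le (hD0 i)) (fun i => ?_)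
      (hcsum.add ((hmsum.mul_right (1 + d))))
    rw [← mul_add]
    refine mul_le_mul_of_nonneg_left ?_ (hm0 i).le
    have : 0 ≤ (c i).toReal := ENNReal.toReal_nonneg
    simp only [hD]
    split_ifs <;> linarith
  refine ⟨fun i => J i / m.real (δ i) + D i * τ, D, |C| + d, ?_, hD0, ?_, hhold, ?_, ?_⟩
  · intro i
    have := hJ0 i
    have := hD0 i
    have := hm0 i
    positivity
  · intro i x hx
    rw [← sub_le_iff_le_add, le_div_iff₀ (hm0 i)]
    have h1 : ∫ _ in δ i, (|h x| - D i * τ) ∂m ≤ J i := by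
      refine setIntegral_mono_on (integrable_const _) hh.abs.integrableOn (hM.measurableSet i)
        fun y hy => ?_
      have h2 := hhold i 1 le_rfl x hx y hy fun k hk => ⟨i, by
        obtain rfl : k = 0 := by omega
        exact ⟨hx, hy⟩⟩
      rw [pow_one, Real.norm_eq_abs] at h2
      have h3 := abs_sub_abs_le_abs_sub (h x) (h y)
      linarith
    simpa [mul_comm] using h1
  · have h1 : (fun i => m.real (δ i) * (J i / m.real (δ i) + D i * τ + D i)) =
        fun i => J i + m.real (δ i) * D i * (τ + 1) := by
      ext i
      have := (hm0 i).ne'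
      field_simp
      ring
    rw [h1]
    exact hJsum.add (hDsum.mul_right _)
  · intro i hi
    have hDi : D i = d := if_neg hi
    have h1 : J i / m.real (δ i) ≤ |C| := by
      rw [div_le_iff₀ (hm0 i)]
      have h2 : J i ≤ ∫ _ in δ i, |C| ∂m := by
        refine setIntegral_mono_on hh.abs.integrableOn (integrable_const _) (hM.measurableSet i)
          fun y hy => ?_
        exact (hC y (hsub i hi hy)).trans (le_abs_self C)
      simpa [mul_comm] using h2
    have h3 : d * τ ≤ d := mul_le_of_le_one_right hd0 hτ1.le
    rw [hDi]
    exact ⟨by linarith, by linarith [abs_nonneg C]⟩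

namespace ObservableBound

variable (hb : ObservableBound m T δ τ base h S D N)
include hb

/-- The Lipschitz constant of `g` is allowed to depend on the element, through the range of `h` on
it: the remainder of the exponential is nearly flat only where `h` is not large. -/
theorem localBound_comp {g : ℝ → ℂ} {L : ι → ℝ} {c N' : ℝ} (hL0 : ∀ i, 0 ≤ L i)
    (hLc : ∀ i, L i ≤ c) (hg0 : g 0 = 0)
    (hg : ∀ i x y, |x| ≤ S i → |y| ≤ S i → ‖g x - g y‖ ≤ L i * |x - y|)
    (hN : ∑' i, L i * (m.real (δ i) * (S i + D i)) ≤ N')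
    (hret : ∀ i, ¬ Returns m T δ base i → L i * S i ≤ N' ∧ L i * D i ≤ N') :
    LocalBound m T δ τ base (fun x => g (h x)) N' := by
  have e : (fun i => m.real (δ i) * (L i * S i + L i * D i)) =
      fun i => L i * (m.real (δ i) * (S i + D i)) := by
    ext i
    ring
  have h0 : ∀ i, 0 ≤ m.real (δ i) * (S i + D i) := fun i =>
    mul_nonneg measureReal_nonneg (add_nonneg (hb.sup_nonneg i) (hb.holder_nonneg i))
  refine ⟨fun i => L i * S i, fun i => L i * D i, fun i => mul_nonneg (hL0 i) (hb.sup_nonneg i),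
    fun i => mul_nonneg (hL0 i) (hb.holder_nonneg i), ?_, ?_, ?_, ?_, hret⟩
  · intro i x hx
    have h1 := hg i (h x) 0 (hb.abs_le i x hx) (by simpa using hb.sup_nonneg i)
    rw [hg0, sub_zero, sub_zero] at h1
    exact h1.trans (mul_le_mul_of_nonneg_left (hb.abs_le i x hx) (hL0 i))
  · intro i n hn x hx y hy hxy
    refine (hg i _ _ (hb.abs_le i x hx) (hb.abs_le i y hy)).trans ?_
    rw [mul_assoc]
    exact mul_le_mul_of_nonneg_left (hb.holder i n hn x hx y hy hxy) (hL0 i)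
  · rw [e]
    exact Summable.of_nonneg_of_le (fun i => mul_nonneg (hL0 i) (h0 i))
      (fun i => mul_le_mul_of_nonneg_right (hLc i) (h0 i)) (hb.summable.mul_left c)
  · rwa [e]

/-- A function of `h` with Lipschitz constant `c`. -/
theorem localBound_lipschitz {g : ℝ → ℂ} {c : ℝ} (hc : 0 ≤ c) (hg0 : g 0 = 0)
    (hg : ∀ x y, ‖g x - g y‖ ≤ c * |x - y|) :
    LocalBound m T δ τ base (fun x => g (h x))
      (c * (∑' i, m.real (δ i) * (S i + D i) + |N|)) := by
  have h0 : 0 ≤ ∑' i, m.real (δ i) * (S i + D i) := tsum_nonneg fun i =>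
    mul_nonneg measureReal_nonneg (add_nonneg (hb.sup_nonneg i) (hb.holder_nonneg i))
  have hN := le_abs_self N
  have hN' := abs_nonneg N
  refine hb.localBound_comp (fun _ => hc) (fun _ => le_rfl) hg0 (fun i x y _ _ => hg x y) ?_ ?_
  · rw [tsum_mul_left]
    refine mul_le_mul_of_nonneg_left ?_ hc
    linarith
  · intro i hi
    obtain ⟨h1, h2⟩ := hb.nonReturning i hi
    exact ⟨mul_le_mul_of_nonneg_left (by linarith) hc, mul_le_mul_of_nonneg_left (by linarith) hc⟩

/-- The second order term of `exp (i t h)`. -/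
theorem exists_localBound_remainder : ∃ ε : ℝ → ℝ, ε =o[𝓝 0] (fun t : ℝ => t) ∧ ∀ t : ℝ,
    LocalBound m T δ τ base
      (fun x => Complex.exp (Complex.I * t * h x) - 1 - Complex.I * t * h x) (ε t) := by
  have h0 : ∀ i, 0 ≤ m.real (δ i) * (S i + D i) := fun i =>
    mul_nonneg measureReal_nonneg (add_nonneg (hb.sup_nonneg i) (hb.holder_nonneg i))
  have hmin0 : ∀ (t : ℝ) i, 0 ≤ min 2 (|t| * S i) := fun t i =>
    le_min (by norm_num) (mul_nonneg (abs_nonneg _) (hb.sup_nonneg i))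
  set M : ℝ → ℝ := fun t => ∑' i, min 2 (|t| * S i) * (m.real (δ i) * (S i + D i)) with hM
  have hMlim : Tendsto M (𝓝 0) (𝓝 0) := by
    rw [show (0 : ℝ) = ∑' _ : ι, (0 : ℝ) by simp]
    refine tendsto_tsum_of_dominated_convergence (bound := fun i =>
      2 * (m.real (δ i) * (S i + D i))) (hb.summable.mul_left 2) ?_ ?_
    · intro i
      have h1 : Continuous fun t : ℝ => min 2 (|t| * S i) * (m.real (δ i) * (S i + D i)) := by
        fun_prop
      have h2 := h1.tendsto 0
      simpa using h2
    · refine Eventually.of_forall fun t i => ?_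
      rw [Real.norm_of_nonneg (mul_nonneg (hmin0 t i) (h0 i))]
      exact mul_le_mul_of_nonneg_right (min_le_left _ _) (h0 i)
  have hM0 : ∀ t, 0 ≤ M t := fun t => tsum_nonneg fun i => mul_nonneg (hmin0 t i) (h0 i)
  -- `M t` tends to `0` by dominated convergence; the summand `|t| * N ^ 2` covers the non-returning
  -- elements, where both local bounds are at most `N`.
  refine ⟨fun t => |t| * (M t + |t| * N ^ 2), ?_, fun t => ?_⟩
  · have h1 : Tendsto (fun t : ℝ => M t + |t| * N ^ 2) (𝓝 0) (𝓝 0) := by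
      have h2 : Continuous fun t : ℝ => |t| * N ^ 2 := by fun_prop
      have h3 := hMlim.add (h2.tendsto 0)
      simpa using h3
    have h4 := (isBigO_refl (fun t : ℝ => t) (𝓝 0)).norm_left.mul_isLittleO
      ((isLittleO_one_iff ℝ).2 h1)
    simpa using h4
  · refine hb.localBound_comp (g := fun s => Complex.exp (Complex.I * t * s) - 1 - Complex.I * t * s)
      (L := fun i => |t| * min 2 (|t| * S i)) (c := |t| * 2)
      (fun i => mul_nonneg (abs_nonneg _) (hmin0 t i))
      (fun i => mul_le_mul_of_nonneg_left (min_le_left _ _) (abs_nonneg _)) (by simp)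
      (fun i x y hx hy => norm_exp_remainder_sub_le hx hy) ?_ ?_
    · simp only [mul_assoc |t|]
      rw [tsum_mul_left]
      refine mul_le_mul_of_nonneg_left ?_ (abs_nonneg _)
      have : 0 ≤ |t| * N ^ 2 := by positivity
      linarith
    · intro i hi
      obtain ⟨h1, h2⟩ := hb.nonReturning i hi
      have hS0 := hb.sup_nonneg i
      have hD0 := hb.holder_nonneg i
      have key : ∀ w, 0 ≤ w → w ≤ N →
          |t| * min 2 (|t| * S i) * w ≤ |t| * (M t + |t| * N ^ 2) := by
        intro w hw0 hw
        rw [mul_assoc]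
        refine mul_le_mul_of_nonneg_left ?_ (abs_nonneg _)
        calc min 2 (|t| * S i) * w ≤ (|t| * N) * N := by
              refine mul_le_mul ((min_le_right _ _).trans
                (mul_le_mul_of_nonneg_left h1 (abs_nonneg _))) hw hw0 ?_
              exact mul_nonneg (abs_nonneg _) (hS0.trans h1)
          _ = |t| * N ^ 2 := by ring
          _ ≤ _ := by linarith [hM0 t]
      exact ⟨key _ hS0 h1, key _ hD0 h2⟩

end ObservableBound

set_option maxHeartbeats 1000000 in
/-- The transfer operator, its perturbations, and their first order expansion at `0`. -/
theorem Setting.exists_perturbed_operators [IsFiniteMeasure m] [Countable ι]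
    [StandardBorelSpace Z] (hS : Setting m T δ τ p q base height floor)
    (hb : ObservableBound m T δ τ base h S D N) (hh : Integrable h m) :
    ∃ (R : LSpace T δ τ p →L[ℂ] LSpace T δ τ p) (Rt : ℝ → LSpace T δ τ p →L[ℂ] LSpace T δ τ p)
      (b : LSpace T δ τ p),
      (∀ F : LSpace T δ τ p, transfer m T F =ᵐ[m] (R F : Z → ℂ)) ∧
      (∀ (t : ℝ) (F : LSpace T δ τ p), perturbed m T h t F =ᵐ[m] (Rt t F : Z → ℂ)) ∧
      (fun t => Rt t - R) =O[𝓝 0] (fun t : ℝ => t) ∧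
      transfer m T (fun x => (h x : ℂ)) =ᵐ[m] (b : Z → ℂ) ∧
      ∀ e : LSpace T δ τ p, (∀ x, e x = 1) → R e = e →
        (fun t : ℝ => Rt t e - e - (t : ℂ) • (Complex.I • b)) =o[𝓝 0] fun t : ℝ => t := by
  have hM := hS.markov
  have hT := hS.ergodic.toMeasurePreserving
  have hτ0 := hS.pos
  have hτ1 := hS.lt_one
  have hint : ∀ F : LSpace T δ τ p, Integrable (F : Z → ℂ) m := fun F => F.integrable hM hτ0 hτ1
  have hhC : Integrable (fun x => (h x : ℂ)) m := hh.ofReal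
  obtain ⟨C, hC0, hC⟩ := hS.exists_operator
  obtain ⟨C₁, hC₁0, hC₁⟩ := hS.exists_transfer_bound
  have hmsum : HasSum (fun i => m.real (δ i)) (m.real Set.univ) := by
    have h1 := hasSum_integral_iUnion (μ := m) (f := fun _ => (1 : ℝ)) hM.measurableSet hM.disjoint
      (integrable_const _).integrableOn
    rw [hM.iUnion_eq] at h1
    simpa using h1
  -- The multiplier `1` gives `R`. The `+ 1` in its bound accounts for its supremum on non-returning
  -- elements.
  obtain ⟨R, hR, -⟩ := hC (fun _ => 1) (m.real Set.univ + 1) (integrable_const _)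
    ⟨fun _ => 1, fun _ => 0, fun _ => zero_le_one, fun _ => le_rfl, fun i x _ => by simp,
      fun i n _ x _ y _ _ => by simp, by simpa using hmsum.summable, by
        simp [hmsum.tsum_eq], fun i _ => by
        have : 0 ≤ m.real (Set.univ : Set Z) := measureReal_nonneg
        constructor <;> linarith⟩
  simp only [one_mul] at hR
  have hexp : ∀ t : ℝ, AEStronglyMeasurable (fun x => Complex.exp (Complex.I * t * h x)) m :=
    fun t => Complex.continuous_exp.comp_aestronglyMeasurable
      (hhC.1.const_mul (Complex.I * (t : ℂ)))
  have hexpi : ∀ t : ℝ, Integrable (fun x => Complex.exp (Complex.I * t * h x)) m := fun t =>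
    Integrable.of_bound (hexp t) 1 (ae_of_all _ fun x => (norm_exp t (h x)).le)
  set N₀ := ∑' i, m.real (δ i) * (S i + D i) + |N| with hN₀
  -- `Q t F = R ((e^{ith} - 1) F)`. As `s ↦ e^{its} - 1` vanishes at `0` and is `|t|`-Lipschitz, `‖Q
  -- t‖ = O(t)` even though `h` is unbounded.
  have hQex := fun t : ℝ => hC (fun x => Complex.exp (Complex.I * t * h x) - 1) (|t| * N₀)
    ((hexpi t).sub (integrable_const _))
    (hb.localBound_lipschitz (g := fun s => Complex.exp (Complex.I * t * s) - 1) (abs_nonneg t)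
      (by simp) fun x y => by
        rw [sub_sub_sub_cancel_right]
        exact norm_exp_sub_exp_le t x y)
  choose Q hQ hQn using hQex
  obtain ⟨b, hb1, -⟩ := hC₁ (fun x => (h x : ℂ)) (1 * N₀) hhC
    (hb.localBound_lipschitz (g := fun s => (s : ℂ)) zero_le_one (by simp) fun x y => by
      rw [← Complex.ofReal_sub, Complex.norm_real, one_mul, Real.norm_eq_abs])
  have hQF : ∀ (t : ℝ) (F : LSpace T δ τ p),
      Integrable (fun x => (Complex.exp (Complex.I * t * h x) - 1) * F x) m := fun t F =>
    ((hexpi t).sub (integrable_const _)).mul_bdd (hint F).1 (ae_of_all _ F.norm_apply_le)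
  refine ⟨R, fun t => R + Q t, b, hR, ?_, ?_, hb1, ?_⟩
  · intro t F
    have h1 := transfer_add hT (hint F) (hQF t F)
    have e : (F : Z → ℂ) + (fun x => (Complex.exp (Complex.I * t * h x) - 1) * F x) =
        fun x => Complex.exp (Complex.I * t * h x) * F x := by
      ext x
      simp only [Pi.add_apply]
      ring
    rw [e] at h1
    filter_upwards [h1, hR F, hQ t F] with x h2 h3 h4
    change transfer m T (fun x => Complex.exp (Complex.I * t * h x) * F x) x = R F x + Q t F x
    rw [h2, Pi.add_apply, h3, h4]
  · refine IsBigO.of_bound (C * N₀) (Eventually.of_forall fun t => ?_)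
    have e : R + Q t - R = Q t := by
      ext1 F
      change R F + Q t F - R F = Q t F
      exact add_sub_cancel_left _ _
    beta_reduce
    rw [e, Real.norm_eq_abs]
    refine (hQn t).trans (le_of_eq ?_)
    ring
  · intro e he hRe
    obtain ⟨ε, hε, hεb⟩ := hb.exists_localBound_remainder
    have hrem : ∀ t : ℝ,
        Integrable (fun x => Complex.exp (Complex.I * t * h x) - 1 - Complex.I * t * h x) m :=
      fun t => ((hexpi t).sub (integrable_const _)).sub (hhC.const_mul _)
    refine IsBigO.trans_isLittleO (IsBigO.of_bound C₁ (Eventually.of_forall fun t => ?_)) hε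
    obtain ⟨G, hG1, hG2⟩ := hC₁ _ _ (hrem t) (hεb t)
    have hGe : (R + Q t) e - e - (t : ℂ) • (Complex.I • b) = G := by
      have e1 : (R + Q t) e - e = Q t e := by
        change R e + Q t e - e = Q t e
        rw [hRe, add_sub_cancel_left]
      rw [e1]
      refine LSpace.ext_ae hτ0 hτ1 hS.retraction ?_
      have h1 := transfer_sub hT (hQF t e) (hhC.smul (Complex.I * (t : ℂ)))
      have h2 := transfer_smul hT hhC (Complex.I * (t : ℂ))
      have e2 : (fun x => (Complex.exp (Complex.I * t * h x) - 1) * e x) -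
          ((Complex.I * (t : ℂ)) • fun x => (h x : ℂ)) =
          fun x => Complex.exp (Complex.I * t * h x) - 1 - Complex.I * t * h x := by
        ext x
        simp only [Pi.sub_apply, Pi.smul_apply, he, mul_one, smul_eq_mul]
      rw [e2] at h1
      filter_upwards [h1, h2, hb1, hG1, hQ t e] with x h3 h4 h5 h6 h7
      rw [← h6, h3, Pi.sub_apply, h4, Pi.smul_apply, h5, h7, LSpace.sub_apply, LSpace.smul_apply,
        LSpace.smul_apply, smul_eq_mul]
      ring
    rw [hGe]
    refine hG2.trans (mul_le_mul_of_nonneg_left (le_abs_self _) hC₁0)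

end Observable

/-! ### The asymptotic variance -/

section Variance

variable {Z ι : Type*} [MeasurableSpace Z] {m : Measure Z} [IsFiniteMeasure m] {T : Z → Z}
  {δ : ι → Set Z} {τ : ℝ} {p : Z → Z} {h : Z → ℝ}

/-- Write `u = h + a`, so `R u = a`. Duality gives `∫ u · (a ∘ T) = ∫ a²`, hence `∫ (u - a ∘ T)² = ∫
u² - ∫ a²`. Both formulas compute this nonnegative number, of which `σ` is the square root; it
vanishes when `u = a ∘ T`. -/
theorem exists_variance (hT : MeasurePreserving T m m) (hL2 : MemLp h 2 m) {a : Z → ℝ}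
    (ham : Measurable a) {C : ℝ} (haC : ∀ x, |a x| ≤ C)
    (hRu : transfer m T (fun x => (h x : ℂ) + a x) =ᵐ[m] fun x => (a x : ℂ)) :
    ∃ σ : ℝ, (σ : ℂ) ^ 2 = ∫ x, (h x : ℂ) ^ 2 ∂m + 2 * ∫ x, (a x : ℂ) * h x ∂m ∧
      (σ : ℂ) ^ 2 = ∫ x, (transfer m T (fun y => ((h y : ℂ) + a y) ^ 2) x -
        transfer m T (fun y => (h y : ℂ) + a y) x ^ 2) ∂m ∧
      (σ ^ 2 = 0 ↔ ∀ᵐ x ∂m, h x + a x = a (T x)) := by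
  have ha2 : MemLp a 2 m := MemLp.of_bound ham.aestronglyMeasurable C (ae_of_all _ haC)
  have haT : MemLp (fun x => a (T x)) 2 m := ha2.comp_measurePreserving hT
  have hu2 : MemLp (fun x => h x + a x) 2 m := hL2.add ha2
  have hw2 : MemLp (fun x => h x + a x - a (T x)) 2 m := hu2.sub haT
  have ih2 := hL2.integrable_sq
  have ia2 := ha2.integrable_sq
  have iaT2 := haT.integrable_sq
  have iu2 := hu2.integrable_sq
  have iah : Integrable (fun x => a x * h x) m := ha2.integrable_mul hL2
  have iuaT : Integrable (fun x => (h x + a x) * a (T x)) m := hu2.integrable_mul haT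
  have hu : Integrable (fun x => (h x : ℂ) + a x) m := by
    have := (hu2.integrable one_le_two).ofReal (𝕜 := ℂ)
    simpa using this
  have hu2C : Integrable (fun x => ((h x : ℂ) + a x) ^ 2) m := by
    have := iu2.ofReal (𝕜 := ℂ)
    simpa using this
  have e1 : ∫ x, (h x + a x) * a (T x) ∂m = ∫ x, a x ^ 2 ∂m := by
    have h1 := integral_mul_comp hT hu (g := fun x => (a x : ℂ)) (C := C)
      (Complex.measurable_ofReal.comp ham).aestronglyMeasurable
      (ae_of_all _ fun x => by rw [Complex.norm_real]; exact haC x)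
    have h2 : ∫ x, transfer m T (fun x => (h x : ℂ) + a x) x * a x ∂m =
        ∫ x, ((a x ^ 2 : ℝ) : ℂ) ∂m := by
      refine integral_congr_ae ?_
      filter_upwards [hRu] with x hx
      rw [hx]
      push_cast
      ring
    have h3 : ∫ x, ((h x : ℂ) + a x) * a (T x) ∂m =
        ∫ x, (((h x + a x) * a (T x) : ℝ) : ℂ) ∂m := by
      push_cast
      rfl
    rw [h2, h3, integral_complex_ofReal, integral_complex_ofReal] at h1
    exact_mod_cast h1
  have e2 : ∫ x, a (T x) ^ 2 ∂m = ∫ x, a x ^ 2 ∂m :=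
    integral_map hT.measurable.aemeasurable (f := fun x => a x ^ 2)
      (by rw [hT.map_eq]; exact ia2.1) |>.symm.trans (by rw [hT.map_eq])
  have e3 : ∫ x, (h x + a x - a (T x)) ^ 2 ∂m = ∫ x, (h x + a x) ^ 2 ∂m - ∫ x, a x ^ 2 ∂m := by
    have h1 : ∀ x, (h x + a x - a (T x)) ^ 2 =
        (h x + a x) ^ 2 - 2 * ((h x + a x) * a (T x)) + a (T x) ^ 2 := fun x => by ring
    simp only [h1]
    have i1 : Integrable (fun x => (h x + a x) ^ 2 - 2 * ((h x + a x) * a (T x))) m :=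
      iu2.sub (iuaT.const_mul 2)
    rw [integral_add i1 iaT2, integral_sub iu2 (iuaT.const_mul 2),
      integral_const_mul, e1, e2]
    ring
  have e4 : ∫ x, (h x + a x) ^ 2 ∂m =
      ∫ x, h x ^ 2 ∂m + 2 * ∫ x, a x * h x ∂m + ∫ x, a x ^ 2 ∂m := by
    have h1 : ∀ x, (h x + a x) ^ 2 = h x ^ 2 + 2 * (a x * h x) + a x ^ 2 := fun x => by ring
    simp only [h1]
    have i1 : Integrable (fun x => h x ^ 2 + 2 * (a x * h x)) m := ih2.add (iah.const_mul 2)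
    rw [integral_add i1 ia2, integral_add ih2 (iah.const_mul 2),
      integral_const_mul]
  set V := ∫ x, (h x + a x - a (T x)) ^ 2 ∂m with hV
  have hV0 : 0 ≤ V := integral_nonneg fun x => sq_nonneg _
  have hσ : Real.sqrt V ^ 2 = V := Real.sq_sqrt hV0
  have hσC : (Real.sqrt V : ℂ) ^ 2 = (V : ℂ) := by exact_mod_cast hσ
  refine ⟨Real.sqrt V, ?_, ?_, ?_⟩
  · have h1 : ∫ x, (h x : ℂ) ^ 2 ∂m = ((∫ x, h x ^ 2 ∂m : ℝ) : ℂ) := by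
      rw [← integral_complex_ofReal]
      push_cast
      rfl
    have h2 : ∫ x, (a x : ℂ) * h x ∂m = ((∫ x, a x * h x ∂m : ℝ) : ℂ) := by
      rw [← integral_complex_ofReal]
      push_cast
      rfl
    rw [hσC, h1, h2, e3, e4]
    push_cast
    ring
  · have h1 : ∫ x, (transfer m T (fun y => ((h y : ℂ) + a y) ^ 2) x -
        transfer m T (fun y => (h y : ℂ) + a y) x ^ 2) ∂m =
        ∫ x, (transfer m T (fun y => ((h y : ℂ) + a y) ^ 2) x - ((a x ^ 2 : ℝ) : ℂ)) ∂m := by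
      refine integral_congr_ae ?_
      filter_upwards [hRu] with x hx
      rw [hx]
      push_cast
      rfl
    have h2 : ∫ x, ((h x : ℂ) + a x) ^ 2 ∂m = ((∫ x, (h x + a x) ^ 2 ∂m : ℝ) : ℂ) := by
      rw [← integral_complex_ofReal]
      push_cast
      rfl
    have ia2C : Integrable (fun x => ((a x ^ 2 : ℝ) : ℂ)) m := ia2.ofReal
    rw [h1, integral_sub (integrable_transfer _) ia2C, integral_transfer hT hu2C,
      integral_complex_ofReal, h2, hσC, e3]
    push_cast
    rfl
  · rw [hσ, hV, integral_eq_zero_iff_of_nonneg (fun x => sq_nonneg _) hw2.integrable_sq]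
    refine eventually_congr (Eventually.of_forall fun x => ?_)
    simp only [Pi.zero_apply, ne_eq, OfNat.ofNat_ne_zero, not_false_eq_true, pow_eq_zero_iff]
    exact sub_eq_zero

/-- The integral is `(λ(t) - 1) m(Z)` when `1 + v t` is the eigenvector with `v t` of zero mean.
Putting `v t = i t a + o(t)`, the main terms are `i t ∫ h = 0`, `-t²/2 ∫ h²` and `-t² ∫ a h`. -/
theorem isLittleO_integral_exp [Countable ι] (hM : IsMarkovMap m T δ) (hτ0 : 0 < τ) (hτ1 : τ < 1)
    (hL2 : MemLp h 2 m) (hmean : ∫ x, h x ∂m = 0) {v : ℝ → LSpace T δ τ p} {a : LSpace T δ τ p}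
    (hv : (fun t : ℝ => v t - (t : ℂ) • (Complex.I • a)) =o[𝓝 0] fun t : ℝ => t) :
    (fun t : ℝ => ∫ x, (Complex.exp (Complex.I * t * h x) - 1) * (1 + v t x) ∂m +
      (t : ℂ) ^ 2 / 2 * (∫ x, (h x : ℂ) ^ 2 ∂m + 2 * ∫ x, a x * h x ∂m))
      =o[𝓝 0] fun t : ℝ => t ^ 2 := by
  have hh := hL2.integrable one_le_two
  have hhC : Integrable (fun x => (h x : ℂ)) m := hh.ofReal
  have ih2 : Integrable (fun x => h x ^ 2) m := hL2.integrable_sq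
  have ih2C : Integrable (fun x => (h x : ℂ) ^ 2) m := by
    have := ih2.ofReal (𝕜 := ℂ)
    simpa using this
  have hint : ∀ F : LSpace T δ τ p, Integrable (F : Z → ℂ) m := fun F => F.integrable hM hτ0 hτ1
  have hexp : ∀ t : ℝ, AEStronglyMeasurable (fun x => Complex.exp (Complex.I * t * h x)) m :=
    fun t => Complex.continuous_exp.comp_aestronglyMeasurable
      (hhC.1.const_mul (Complex.I * (t : ℂ)))
  have i0 : ∀ t : ℝ, Integrable (fun x => Complex.exp (Complex.I * t * h x) - 1) m := fun t =>
    (Integrable.of_bound (hexp t) 1 (ae_of_all _ fun x => (norm_exp t (h x)).le)).sub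
      (integrable_const _)
  have i1 : ∀ t : ℝ,
      Integrable (fun x => Complex.exp (Complex.I * t * h x) - 1 - Complex.I * t * h x) m :=
    fun t => (i0 t).sub (hhC.const_mul _)
  -- Three errors: the Taylor remainder of the exponential, the `o(t)` part of the eigenvector
  -- against `e^{ith} - 1 = O(t)` in `L¹`, and the quadratic remainder against `i t a`.
  set E₁ : ℝ → ℂ := fun t => ∫ x, (Complex.exp (Complex.I * t * h x) - 1 - Complex.I * t * h x +
    (t : ℂ) ^ 2 * (h x : ℂ) ^ 2 / 2) ∂m with hE₁
  set w : ℝ → LSpace T δ τ p := fun t => v t - (t : ℂ) • (Complex.I • a) with hw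
  set E₂ : ℝ → ℂ := fun t => ∫ x, (Complex.exp (Complex.I * t * h x) - 1) * w t x ∂m with hE₂
  set E₃ : ℝ → ℂ := fun t => ∫ x, (Complex.exp (Complex.I * t * h x) - 1 - Complex.I * t * h x) *
    (Complex.I * t * a x) ∂m with hE₃
  have hcomb : ∀ {f₁ f₂ f₃ f₄ f₅ f₆ : Z → ℂ}, Integrable f₁ m → Integrable f₂ m →
      Integrable f₃ m → Integrable f₄ m → Integrable f₅ m → Integrable f₆ m →
      ∫ x, (f₁ x + f₂ x + f₃ x + f₄ x - f₅ x - f₆ x) ∂m = ∫ x, f₁ x ∂m + ∫ x, f₂ x ∂m +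
        ∫ x, f₃ x ∂m + ∫ x, f₄ x ∂m - ∫ x, f₅ x ∂m - ∫ x, f₆ x ∂m := by
    intro f₁ f₂ f₃ f₄ f₅ f₆ k1 k2 k3 k4 k5 k6
    rw [← integral_add' k1 k2, ← integral_add' (k1.add k2) k3,
      ← integral_add' ((k1.add k2).add k3) k4, ← integral_sub' (((k1.add k2).add k3).add k4) k5,
      ← integral_sub' ((((k1.add k2).add k3).add k4).sub k5) k6]
    rfl
  have hsum : (fun t : ℝ => ∫ x, (Complex.exp (Complex.I * t * h x) - 1) * (1 + v t x) ∂m +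
      (t : ℂ) ^ 2 / 2 * (∫ x, (h x : ℂ) ^ 2 ∂m + 2 * ∫ x, a x * h x ∂m)) =
      fun t => E₁ t + E₂ t + E₃ t := by
    ext t
    have j1 : Integrable (fun x => Complex.exp (Complex.I * t * h x) - 1 - Complex.I * t * h x +
        (t : ℂ) ^ 2 * (h x : ℂ) ^ 2 / 2) m := (i1 t).add ((ih2C.const_mul _).div_const _)
    have j2 : Integrable (fun x => (Complex.exp (Complex.I * t * h x) - 1) * w t x) m :=
      (i0 t).mul_bdd (hint _).1 (ae_of_all _ (w t).norm_apply_le)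
    have j3 : Integrable (fun x => (Complex.exp (Complex.I * t * h x) - 1 - Complex.I * t * h x) *
        (Complex.I * t * a x)) m :=
      (i1 t).mul_bdd ((hint a).const_mul _).1
        (ae_of_all _ (((Complex.I * (t : ℂ)) • a).norm_apply_le))
    have j4 : Integrable (fun x => Complex.I * t * (h x : ℂ)) m := hhC.const_mul _
    have j5 : Integrable (fun x => (t : ℂ) ^ 2 / 2 * (h x : ℂ) ^ 2) m := ih2C.const_mul _
    have j6' : Integrable (fun x => a x * (h x : ℂ)) m :=
      hhC.bdd_mul (hint a).1 (ae_of_all _ a.norm_apply_le)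
    have j6 : Integrable (fun x => (t : ℂ) ^ 2 * (a x * (h x : ℂ))) m := j6'.const_mul _
    have e1 : ∀ x, (Complex.exp (Complex.I * t * h x) - 1) * (1 + v t x) =
        (Complex.exp (Complex.I * t * h x) - 1 - Complex.I * t * h x +
          (t : ℂ) ^ 2 * (h x : ℂ) ^ 2 / 2) + (Complex.exp (Complex.I * t * h x) - 1) * w t x +
        (Complex.exp (Complex.I * t * h x) - 1 - Complex.I * t * h x) * (Complex.I * t * a x) +
        Complex.I * t * (h x : ℂ) - (t : ℂ) ^ 2 / 2 * (h x : ℂ) ^ 2 -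
        (t : ℂ) ^ 2 * (a x * (h x : ℂ)) := by
      intro x
      have e2 : w t x = v t x - t * (Complex.I * a x) := rfl
      rw [e2]
      linear_combination ((t : ℂ) ^ 2 * a x * h x) * Complex.I_sq
    simp only [e1]
    rw [hcomb j1 j2 j3 j4 j5 j6, integral_const_mul, integral_const_mul,
      integral_const_mul, integral_complex_ofReal, hmean]
    simp only [hE₁, hE₂, hE₃, Complex.ofReal_zero]
    ring
  rw [hsum]
  refine (IsLittleO.add ?_ ?_).add ?_
  · have hlim : Tendsto (fun t : ℝ => ∫ x, (Complex.exp (Complex.I * t * h x) - 1 -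
        Complex.I * t * h x + (t : ℂ) ^ 2 * (h x : ℂ) ^ 2 / 2) / (t : ℂ) ^ 2 ∂m) (𝓝 0)
        (𝓝 (∫ _, (0 : ℂ) ∂m)) := by
      -- After division by `t²` the remainder is dominated by `2 h²` uniformly in `t`, so two
      -- moments of `h` suffice.
      refine tendsto_integral_filter_of_dominated_convergence (fun x => 2 * h x ^ 2) ?_ ?_
        (ih2.const_mul 2) ?_
      · exact Eventually.of_forall fun t =>
          (((i1 t).add ((ih2C.const_mul ((t : ℂ) ^ 2)).div_const 2)).div_const _).1
      · refine Eventually.of_forall fun t => ae_of_all _ fun x => ?_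
        rcases eq_or_ne t 0 with rfl | ht
        · simp
          positivity
        have ht2 : 0 < t ^ 2 := by positivity
        rw [norm_div, norm_pow, Complex.norm_real, Real.norm_eq_abs, sq_abs, div_le_iff₀ ht2]
        refine (norm_add_le _ _).trans ?_
        have h1 := norm_exp_remainder_le t (h x)
        have h2 : ‖(t : ℂ) ^ 2 * (h x : ℂ) ^ 2 / 2‖ = t ^ 2 * h x ^ 2 / 2 := by
          rw [norm_div, norm_mul, norm_pow, norm_pow, Complex.norm_real, Complex.norm_real,
            Real.norm_eq_abs, Real.norm_eq_abs, sq_abs, sq_abs]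
          norm_num
        rw [h2]
        have : 0 ≤ t ^ 2 * h x ^ 2 := by positivity
        linarith
      · refine ae_of_all _ fun x => ?_
        refine squeeze_zero_norm (a := fun t : ℝ => 2 * |h x| ^ 3 * |t|) (fun t => ?_) ?_
        · rcases eq_or_ne t 0 with rfl | ht
          · simp
          have ht2 : 0 < t ^ 2 := by positivity
          rw [norm_div, norm_pow, Complex.norm_real, Real.norm_eq_abs, sq_abs, div_le_iff₀ ht2]
          refine (norm_exp_second_remainder_le t (h x)).trans (le_of_eq ?_)
          rw [abs_mul, ← sq_abs t]
          ring
        · have h1 : Continuous fun t : ℝ => 2 * |h x| ^ 3 * |t| := by fun_prop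
          simpa using h1.tendsto 0
    rw [integral_zero] at hlim
    have h1 : (fun t : ℝ => ((t ^ 2 : ℝ) : ℂ)) =O[𝓝 0] fun t : ℝ => t ^ 2 :=
      IsBigO.of_bound 1 (Eventually.of_forall fun t => by rw [Complex.norm_real, one_mul])
    have h2 := h1.mul_isLittleO ((isLittleO_one_iff ℝ).2 hlim)
    simp only [mul_one] at h2
    refine h2.congr_left fun t => ?_
    rw [integral_div]
    rcases eq_or_ne t 0 with rfl | ht
    · simp [hE₁]
    have : (t : ℂ) ≠ 0 := by exact_mod_cast ht
    rw [Complex.ofReal_pow, ← mul_div_assoc, mul_div_cancel_left₀ _ (pow_ne_zero 2 this)]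
  · have h1 : E₂ =O[𝓝 0] fun t => t * ‖w t‖ := by
      refine IsBigO.of_bound (∫ x, |h x| ∂m) (Eventually.of_forall fun t => ?_)
      refine (norm_integral_le_of_norm_le (hh.abs.const_mul (|t| * ‖w t‖))
        (ae_of_all _ fun x => ?_)).trans (le_of_eq ?_)
      · rw [norm_mul]
        refine (mul_le_mul (norm_exp_sub_one_le t (h x)) ((w t).norm_apply_le x) (norm_nonneg _)
          (by positivity)).trans (le_of_eq ?_)
        ring
      · rw [integral_const_mul, norm_mul, norm_norm, Real.norm_eq_abs]
        ring
    refine h1.trans_isLittleO ?_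
    simpa only [sq] using (isBigO_refl (fun t : ℝ => t) (𝓝 0)).mul_isLittleO hv.norm_left
  · have h1 : E₃ =O[𝓝 0] fun t : ℝ => t ^ 3 := by
      refine IsBigO.of_bound (‖a‖ * ∫ x, h x ^ 2 ∂m) (Eventually.of_forall fun t => ?_)
      refine (norm_integral_le_of_norm_le (ih2.const_mul (|t| ^ 3 * ‖a‖))
        (ae_of_all _ fun x => ?_)).trans (le_of_eq ?_)
      · rw [norm_mul, norm_mul, norm_mul, Complex.norm_I, one_mul, Complex.norm_real,
          Real.norm_eq_abs]
        refine (mul_le_mul (norm_exp_remainder_le t (h x))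
          (mul_le_mul_of_nonneg_left (a.norm_apply_le x) (abs_nonneg t)) (by positivity)
          (by positivity)).trans (le_of_eq ?_)
        rw [← sq_abs t]
        ring
      · rw [integral_const_mul, norm_pow, Real.norm_eq_abs]
        ring
    refine h1.trans_isLittleO ?_
    exact isLittleO_pow_pow (by norm_num)

end Variance

/-! ### Solving the cohomological equation -/

section Resolvent

/-- On the kernel of `φ` the rank one term disappears, and applying `φ` to the equation shows that
the inverse preserves this kernel. -/
theorem exists_unique_sub_eq {X : Type*} [NormedAddCommGroup X] [NormedSpace ℂ X]
    {R : X →L[ℂ] X} {e : X} {φ : X →L[ℂ] ℂ} (hφe : φ e = 1) (hφR : ∀ x, φ (R x) = φ x)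
    (hA : IsUnit (1 - R + φ.smulRight e)) {w : X} (hw : φ w = 0) :
    ∃ v, (φ v = 0 ∧ v - R v = w) ∧ ∀ v', φ v' = 0 → v' - R v' = w → v' = v := by
  obtain ⟨u, hu⟩ := hA
  have hux : ∀ x, (u : X →L[ℂ] X) x = x - R x + φ x • e := fun x => by rw [hu]; rfl
  have h1 : ∀ x, (u : X →L[ℂ] X) (((u⁻¹ : (X →L[ℂ] X)ˣ) : X →L[ℂ] X) x) = x := fun x => by
    rw [← mul_apply_eq_comp, Units.mul_inv]
    rfl
  have h2 : ∀ x, ((u⁻¹ : (X →L[ℂ] X)ˣ) : X →L[ℂ] X) ((u : X →L[ℂ] X) x) = x := fun x => by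
    rw [← mul_apply_eq_comp, Units.inv_mul]
    rfl
  have h3 := h1 w
  rw [hux] at h3
  have h4 : φ (((u⁻¹ : (X →L[ℂ] X)ˣ) : X →L[ℂ] X) w) = 0 := by
    have := congrArg φ h3
    rwa [map_add, map_sub, hφR, sub_self, zero_add, map_smul, hφe, smul_eq_mul, mul_one, hw] at this
  rw [h4, zero_smul, add_zero] at h3
  refine ⟨_, ⟨h4, h3⟩, fun v' h5 h6 => ?_⟩
  rw [← h2 v', hux, h5, h6, zero_smul, add_zero]

variable {Z ι : Type*} [MeasurableSpace Z] [Countable ι] [StandardBorelSpace Z]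
  {m : Measure Z} [IsFiniteMeasure m] [NeZero m] {T : Z → Z} {δ : ι → Set Z} {τ : ℝ} {p : Z → Z}
  {q : ℕ} {base : Set ι} {height : ι → ℕ} {floor : ι → ℕ → ι}

theorem Setting.exists_isUnit (hS : Setting m T δ τ p q base height floor)
    {R : LSpace T δ τ p →L[ℂ] LSpace T δ τ p}
    (hR : ∀ F : LSpace T δ τ p, transfer m T F =ᵐ[m] (R F : Z → ℂ)) :
    ∃ (e : LSpace T δ τ p) (φ : LSpace T δ τ p →L[ℂ] ℂ), (∀ x, e x = 1) ∧
      (∀ F : LSpace T δ τ p, φ F = (∫ x, F x ∂m) / (m.real Set.univ : ℂ)) ∧ φ e = 1 ∧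
      R e = e ∧ (∀ F, φ (R F) = φ F) ∧ IsUnit (1 - R + φ.smulRight e) := by
  have hM := hS.markov
  have hT := hS.ergodic.toMeasurePreserving
  have hτ0 := hS.pos
  have hτ1 := hS.lt_one
  have hmC : (m.real Set.univ : ℂ) ≠ 0 := by
    exact_mod_cast (ENNReal.toReal_pos (NeZero.ne _) (measure_ne_top m Set.univ)).ne'
  obtain ⟨e, he⟩ := LSpace.exists_one (T := T) (δ := δ) (p := p) hτ0
  obtain ⟨φ, hφ⟩ := LSpace.exists_average (p := p) hM hτ0 hτ1
  have hφe : φ e = 1 := by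
    rw [hφ]
    simp only [he, integral_const, Complex.real_smul, mul_one]
    exact div_self hmC
  have hRe : R e = e := by
    refine LSpace.ext_ae hτ0 hτ1 hS.retraction ?_
    have h1 : transfer m T (fun _ => (1 : ℂ)) =ᵐ[m] fun _ => 1 :=
      transfer_comp hT (f := fun _ => (1 : ℂ)) (integrable_const 1)
    have h2 : transfer m T (e : Z → ℂ) = transfer m T fun _ => 1 :=
      transfer_congr (ae_of_all _ he)
    filter_upwards [h1, hR e] with x h3 h4
    rw [← h4, h2, h3, he]
  have hφR : ∀ F, φ (R F) = φ F := fun F => by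
    rw [hφ, hφ, ← integral_congr_ae (hR F), integral_transfer hT (F.integrable hM hτ0 hτ1)]
  exact ⟨e, φ, he, hφ, hφe, hRe, hφR, hS.isUnit_one_sub hR he hφ hRe hφR⟩

omit [Countable ι] [StandardBorelSpace Z] [MeasurableSpace Z] in
theorem LSpace.exists_conj (hτ0 : 0 < τ) (F : LSpace T δ τ p) :
    ∃ G : LSpace T δ τ p, ∀ x, G x = (starRingEnd ℂ) (F x) := by
  obtain ⟨G, hG, -⟩ := LSpace.exists_of_bounds (T := T) (δ := δ) (τ := τ) (p := p)
    (f := fun x => (starRingEnd ℂ) (F x)) (K := ‖F‖) hτ0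
    (fun x => by rw [F.apply_retraction]) (fun x => by
      rw [RCLike.norm_conj]
      exact F.norm_apply_le x)
    (fun n hn x _ y _ hxy => by
      rw [← map_sub, RCLike.norm_conj]
      exact F.holder hτ0 hn hxy) (norm_nonneg _)
  exact ⟨G, hG⟩

end Resolvent

end MarkovTower

end

/-! ### The theorem -/

open MarkovTower in
set_option maxHeartbeats 1000000 in
theorem theorem3p7 {Z ι : Type*} [MeasurableSpace Z] [StandardBorelSpace Z] [Countable ι]
    (m : Measure Z) [IsFiniteMeasure m] [NeZero m] (T : Z → Z) (δ : ι → Set Z)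
    (hMarkov : IsMarkovMap m T δ) (hErg : Ergodic T m)
    (τ : ℝ) (hτ0 : 0 < τ) (hτ1 : τ < 1) (hdist : HolderDistortion m T δ τ)
    (q : ℕ) (base : Set ι) (height : ι → ℕ) (floor : ι → ℕ → ι)
    (hTower : IsBoundedTower m T δ q base height floor) (hBig : BigImage m T δ base)
    (h : Z → ℝ) (hsum : ∑' i, m (δ i) * holderConst T δ τ h (δ i) < ⊤)
    (hL2 : MemLp h 2 m) (hmean : ∫ x, h x ∂m = 0)
    (hbdd : ∃ C : ℝ, ∀ x ∈ nonReturning m T δ base, |h x| ≤ C)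
    (hhol : holderConst T δ τ h (nonReturning m T δ base) < ⊤) :
    -- the operators `R_t` (in particular `R = R_0`) act on `𝓛_τ`
    (∀ t : ℝ, ∀ f, MemL m T δ τ f → MemL m T δ τ (perturbed m T h t f)) ∧
    -- `I - R` is invertible on the functions of `𝓛_τ` with zero average
    (∀ w, MemL0 m T δ τ w → ∃ v, (MemL0 m T δ τ v ∧ v - transfer m T v =ᵐ[m] w) ∧
      ∀ v', MemL0 m T δ τ v' → v' - transfer m T v' =ᵐ[m] w → v' =ᵐ[m] v) ∧
    MemL0 m T δ τ (transfer m T fun x => (h x : ℂ)) ∧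
    -- `a = (I - R)⁻¹ (R h)` and `u = h + a`
    ∃ a u : Z → ℂ, MemL0 m T δ τ a ∧
      a - transfer m T a =ᵐ[m] transfer m T (fun x => (h x : ℂ)) ∧
      (∀ x, u x = h x + a x) ∧
      ∃ σ : ℝ,
        (σ : ℂ) ^ 2 = ∫ x, (h x : ℂ) ^ 2 ∂m + 2 * ∫ x, a x * h x ∂m ∧
        (σ : ℂ) ^ 2 = ∫ x, (transfer m T (fun y => u y ^ 2) x - transfer m T u x ^ 2) ∂m ∧
        -- `λ(t)` is the eigenvalue of `R_t` close to `1`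
        (∃ lam : ℝ → ℂ,
          (∃ r : ℝ, 0 < r ∧ ∀ᶠ t in 𝓝 (0 : ℝ),
            IsEigenvalue m T δ τ (perturbed m T h t) (lam t) ∧
            ∀ z : ℂ, ‖z - 1‖ < r → IsEigenvalue m T δ τ (perturbed m T h t) z → z = lam t) ∧
          (fun t : ℝ => lam t - (1 - (σ : ℂ) ^ 2 / (2 * (m.real Set.univ : ℂ)) * (t : ℂ) ^ 2))
            =o[𝓝 0] fun t : ℝ => t ^ 2) ∧
        (σ ^ 2 = 0 ↔ ∃ ψ : Z → ℂ, MemL m T δ τ ψ ∧ ∀ᵐ x ∂m, (h x : ℂ) = ψ (T x) - ψ x) := by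
  obtain ⟨p, hp1, hp2, hp3⟩ := hMarkov.exists_retraction
  have hS : Setting m T δ τ p q base height floor :=
    ⟨hMarkov, hErg, hτ0, hτ1, ⟨hp1, hp2, hp3⟩, hdist, hTower, hBig⟩
  have hp := hS.retraction
  have hT := hErg.toMeasurePreserving
  have hh : Integrable h m := hL2.integrable one_le_two
  have hhC : Integrable (fun x => (h x : ℂ)) m := hh.ofReal
  obtain ⟨S, D, N, hb⟩ := exists_observableBound hMarkov hτ0 hτ1 hh hsum hbdd hhol
  obtain ⟨R, Rt, b, hR, hRt, hRtO, hbh, hRte⟩ := hS.exists_perturbed_operators hb hh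
  obtain ⟨e, φ, he, hφ, hφe, hRe, hφR, hA⟩ := hS.exists_isUnit hR
  have hint : ∀ F : LSpace T δ τ p, Integrable (F : Z → ℂ) m := fun F =>
    F.integrable hMarkov hτ0 hτ1
  have hext : ∀ {F G : LSpace T δ τ p}, (F : Z → ℂ) =ᵐ[m] (G : Z → ℂ) → F = G := fun h =>
    LSpace.ext_ae hτ0 hτ1 hp h
  have hmC : (m.real Set.univ : ℂ) ≠ 0 := by
    exact_mod_cast (ENNReal.toReal_pos (NeZero.ne _) (measure_ne_top m Set.univ)).ne'
  have hφ0 : ∀ F : LSpace T δ τ p, φ F = 0 ↔ ∫ x, F x ∂m = 0 := fun F => by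
    rw [hφ, div_eq_zero_iff, or_iff_left hmC]
  have hmem : ∀ F : LSpace T δ τ p, MemL m T δ τ F := fun F =>
    LSpace.memL hτ0 hτ1 F (ae_eq_refl _)
  have hmem0 : ∀ F : LSpace T δ τ p, φ F = 0 → MemL0 m T δ τ F := fun F hF =>
    ⟨hmem F, (hφ0 F).1 hF⟩
  have hget0 : ∀ {f}, MemL0 m T δ τ f → ∃ F : LSpace T δ τ p, f =ᵐ[m] (F : Z → ℂ) ∧ φ F = 0 := by
    intro f hf
    obtain ⟨F, hF⟩ := hf.1.exists_lSpace hMarkov hτ0 hτ1 hp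
    exact ⟨F, hF, (hφ0 F).2 (by rw [← integral_congr_ae hF, hf.2])⟩
  -- Almost everywhere equations for classes become exact equations in the Banach space.
  have hsolve : ∀ {f} {F w : LSpace T δ τ p}, f =ᵐ[m] (F : Z → ℂ) →
      (f - transfer m T f =ᵐ[m] (w : Z → ℂ) ↔ F - R F = w) := by
    intro f F w hf
    have h1 : f - transfer m T f =ᵐ[m] (F - R F : LSpace T δ τ p) := by
      rw [transfer_congr hf]
      filter_upwards [hf, hR F] with x h2 h3
      rw [Pi.sub_apply, h2, h3, LSpace.sub_apply]
    exact ⟨fun h2 => hext (h1.symm.trans h2), fun h2 => by rwa [h2] at h1⟩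
  have hφb : φ b = 0 := by
    rw [hφ0, ← integral_congr_ae hbh, integral_transfer hT hhC, integral_complex_ofReal, hmean,
      Complex.ofReal_zero]
  obtain ⟨a, ⟨hφa, hab⟩, huniq⟩ := exists_unique_sub_eq hφe hφR hA hφb
  -- `R` commutes with conjugation and `R h` is real, so the conjugate of `a` solves the same
  -- equation; uniqueness makes `a` real.
  have hareal : ∀ x, a x = ((a x).re : ℂ) := by
    obtain ⟨a', ha'⟩ := a.exists_conj hτ0
    have e1 : (a' : Z → ℂ) = fun x => (starRingEnd ℂ) (a x) := funext ha'
    have h1 : a' = a := by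
      refine huniq a' ?_ ?_
      · rw [hφ0, e1, integral_conj, (hφ0 a).1 hφa, map_zero]
      · refine (hsolve (ae_eq_refl _)).1 ?_
        have h2 := transfer_conj hT (hint a)
        have h3 := transfer_conj hT hhC
        simp only [Complex.conj_ofReal] at h3
        have h4 := (hsolve (f := a) (F := a) (ae_eq_refl _)).2 hab
        rw [← e1] at h2
        filter_upwards [h2, h3, h4, hbh] with x k2 k3 k4 k5
        rw [Pi.sub_apply, k2, ← k5, k3, ha', ← map_sub, ← Pi.sub_apply, k4, k5]
    intro x
    rw [eq_comm, ← Complex.conj_eq_iff_re, ← ha', h1]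
  have hRu : transfer m T (fun x => (h x : ℂ) + a x) =ᵐ[m] (a : Z → ℂ) := by
    have h1 := transfer_add hT hhC (hint a)
    have h2 := (hsolve (f := a) (F := a) (ae_eq_refl _)).2 hab
    filter_upwards [h1, h2, hbh] with x k1 k2 k3
    refine k1.trans ?_
    rw [Pi.add_apply, k3, ← k2, Pi.sub_apply, sub_add_cancel]
  obtain ⟨σ, hσ1, hσ2, hσ3⟩ := exists_variance hT hL2 (a := fun x => (a x).re) (C := ‖a‖)
    (Complex.measurable_re.comp (a.measurable hMarkov hτ0 hτ1))
    (fun x => (Complex.abs_re_le_norm _).trans (a.norm_apply_le x)) (by simpa only [← hareal] using hRu)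
  simp only [← hareal] at hσ1 hσ2
  refine ⟨?_, ?_, ?_, a, fun x => (h x : ℂ) + a x, hmem0 a hφa, ?_, fun x => rfl, σ, hσ1, hσ2, ?_, ?_⟩
  · intro t f hf
    obtain ⟨F, hF⟩ := hf.exists_lSpace hMarkov hτ0 hτ1 hp
    refine LSpace.memL hτ0 hτ1 (Rt t F) (EventuallyEq.trans ?_ (hRt t F))
    refine Eq.eventuallyEq (transfer_congr ?_)
    filter_upwards [hF] with x hx
    rw [hx]
  · intro w hw
    obtain ⟨W, hW, hW0⟩ := hget0 hw
    obtain ⟨v, ⟨hv0, hv⟩, hvu⟩ := exists_unique_sub_eq hφe hφR hA hW0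
    refine ⟨v, ⟨hmem0 v hv0, ((hsolve (ae_eq_refl _)).2 hv).trans hW.symm⟩, fun v' hv' hv'w => ?_⟩
    obtain ⟨V, hV, hV0⟩ := hget0 hv'
    rwa [hvu V hV0 ((hsolve hV).1 (hv'w.trans hW))] at hV
  · exact ⟨LSpace.memL hτ0 hτ1 b hbh, by rw [integral_congr_ae hbh, (hφ0 b).1 hφb]⟩
  · exact ((hsolve (ae_eq_refl _)).2 hab).trans hbh.symm
  · obtain ⟨lam, v, r, hr, hev, hv⟩ := exists_perturbed_eigenvalue hφe hRe hφR hA hRtO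
      (a := Complex.I • a) (b := Complex.I • b) (by rw [map_smul, ← hab]; exact (smul_sub _ _ _).symm)
      (by rw [map_smul, hφa, smul_zero]) (hRte e he hRe)
    have hae0 : ∀ {ξ} {F : LSpace T δ τ p}, ξ =ᵐ[m] (F : Z → ℂ) → (ξ =ᵐ[m] 0 ↔ F = 0) := by
      intro ξ F hξ
      refine ⟨fun h0 => hext ?_, fun h0 => ?_⟩
      · exact hξ.symm.trans h0
      · rw [h0] at hξ
        exact hξ
    have hpert : ∀ {ξ} {F : LSpace T δ τ p} {z : ℂ} {t : ℝ}, ξ =ᵐ[m] (F : Z → ℂ) →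
        (perturbed m T h t ξ =ᵐ[m] (fun x => z * ξ x) ↔ Rt t F = z • F) := by
      intro ξ F z t hξ
      have h1 : perturbed m T h t ξ =ᵐ[m] (Rt t F : Z → ℂ) := by
        refine EventuallyEq.trans (Eq.eventuallyEq (transfer_congr ?_)) (hRt t F)
        filter_upwards [hξ] with x hx
        rw [hx]
      have h2 : (fun x => z * ξ x) =ᵐ[m] (z • F : LSpace T δ τ p) := by
        filter_upwards [hξ] with x hx
        rw [hx, LSpace.smul_apply]
      refine ⟨fun h3 => hext (h1.symm.trans (h3.trans h2)), fun h3 => ?_⟩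
      rw [h3] at h1
      exact h1.trans h2.symm
    refine ⟨lam, ⟨r, hr, ?_⟩, ?_⟩
    · filter_upwards [hev] with t ⟨h1, h2, h3⟩
      refine ⟨⟨(e + v t : LSpace T δ τ p), hmem _, ?_, (hpert (ae_eq_refl _)).2 h2⟩, ?_⟩
      · rw [hae0 (ae_eq_refl _)]
        intro h0
        have h4 := congrArg φ h0
        rw [map_add, hφe, h1, map_zero, add_zero] at h4
        exact one_ne_zero h4
      · rintro z hz ⟨ξ, hξ, hξ0, hξz⟩
        obtain ⟨F, hF⟩ := hξ.exists_lSpace hMarkov hτ0 hτ1 hp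
        exact h3 z hz F (fun h0 => hξ0 ((hae0 hF).2 h0)) ((hpert hF).1 hξz)
    · have h1 := (isLittleO_integral_exp hMarkov hτ0 hτ1 hL2 hmean hv).const_mul_left
        (m.real Set.univ : ℂ)⁻¹
      refine h1.congr' ?_ EventuallyEq.rfl
      filter_upwards [hev] with t ⟨h2, h3, _⟩
      rw [← hσ1]
      have i0 : Integrable (fun x => Complex.exp (Complex.I * t * h x) * (e + v t : LSpace T δ τ p) x)
          m := by
        refine (hint (e + v t)).bdd_mul (c := 1) ?_ (ae_of_all _ fun x => (norm_exp t (h x)).le)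
        exact Complex.continuous_exp.comp_aestronglyMeasurable (hhC.1.const_mul _)
      -- The normalisation `φ (v t) = 0` gives the eigenvector integral `m(Z)`, so integrating `R_t
      -- ξ = λ ξ` isolates `λ`.
      have h4 : ∫ x, (e + v t : LSpace T δ τ p) x ∂m = m.real Set.univ := by
        have h5 := hφ (e + v t)
        rw [map_add, hφe, h2, add_zero, eq_div_iff hmC, one_mul] at h5
        exact h5.symm
      have h6 : ∫ x, Complex.exp (Complex.I * t * h x) * (e + v t : LSpace T δ τ p) x ∂m =
          lam t * m.real Set.univ := by
        rw [← integral_transfer hT i0, ← h4, ← integral_const_mul]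
        exact integral_congr_ae ((hpert (ae_eq_refl _)).2 h3)
      have h7 : ∫ x, (Complex.exp (Complex.I * t * h x) - 1) * (1 + v t x) ∂m =
          lam t * m.real Set.univ - m.real Set.univ := by
        rw [← h6, ← h4, ← integral_sub i0 (hint _)]
        congr 1
        ext x
        rw [LSpace.add_apply, he]
        ring
      rw [h7]
      field_simp
      ring
  · rw [hσ3]
    constructor
    · intro h1
      refine ⟨a, hmem a, ?_⟩
      filter_upwards [h1] with x hx
      rw [hareal x, hareal (T x), ← hx]
      push_cast
      ring
    · rintro ⟨ψ, hψ, hcob⟩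
      obtain ⟨F, hF⟩ := hψ.exists_lSpace hMarkov hτ0 hτ1 hp
      have hFT : ∀ᵐ x ∂m, (h x : ℂ) = F (T x) - F x := by
        filter_upwards [hcob, hF, hT.quasiMeasurePreserving.ae hF] with x h1 h2 h3
        rw [h1, h2, h3]
      -- Applying `R` to `h = F ∘ T - F` gives `R h = F - R F`. Thus `F` minus its mean solves the
      -- equation of `a`, and equals it.
      have h1 : F - R F = b := by
        refine (hsolve (ae_eq_refl _)).1 (EventuallyEq.trans ?_ hbh)
        rw [transfer_congr (m := m) (T := T) (g := (fun x => F (T x)) - (F : Z → ℂ)) hFT]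
        have h2 := transfer_sub hT (hT.integrable_comp_of_integrable (hint F)) (hint F)
        filter_upwards [h2, transfer_comp hT (hint F)] with x h3 h4
        refine Eq.trans ?_ h3.symm
        rw [Pi.sub_apply, Pi.sub_apply]
        congr 1
        exact h4.symm
      have h2 : F - φ F • e = a := by
        refine huniq _ ?_ ?_
        · rw [map_sub, map_smul, hφe, smul_eq_mul, mul_one, sub_self]
        · rw [map_sub, map_smul, hRe, sub_sub_sub_cancel_right, h1]
      have h3 : ∀ x, a x = F x - φ F := fun x => by
        rw [← h2, LSpace.sub_apply, LSpace.smul_apply, he, mul_one]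
      filter_upwards [hFT] with x hx
      have h4 : ((h x + (a x).re : ℝ) : ℂ) = ((a (T x)).re : ℂ) := by
        rw [Complex.ofReal_add, ← hareal, ← hareal, h3, h3, hx]
        ring
      exact_mod_cast h4
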